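/- **Setting.** Let $d\ge 4$, let $\mathbb B(\mathbb Z^d)$ be the set of unordered nearest-neighbour edges of $\mathbb Z^d$, and let $\Omega=(0,1]^{\mathbb B(\mathbb Z^d)}$ with the product $\sigma$-algebra and the shifts $(\tau_x\omega)_{yz}=\omega_{y+x,z+x}$. For $\omega\in\Omega$ put $\pi_\omega(x)=\sum_{z:|z-x|=1}\omega_{xz}$ and $\mathsf P_\omega(x,y)=\omega_{xy}/\pi_\omega(x)$ (with $\omega_{xy}:=0$ for non-neighbours), and let $P^x_\omega$ be the law of the Markov chain $(X_n)_{n\ge0}$ on $\mathbb Z^d$ with transition kernel $\mathsf P_\omega$ and $X_0=x$. For $\alpha>0$ let $\mathscr C_{\infty,\alpha}=\mathscr C_{\infty,\alpha}(\omega)$ be the set of vertices lying on an infinite self-avoiding path of edges $b$ with $\omega_b\ge\alpha$. For $y\notin\mathscr C_{\infty,\alpha}$ let $\mathcal F_y$ be the connected component of $\mathbb Z^d\setminus\mathscr C_{\infty,\alpha}$ (as an induced subgraph of $\mathbb Z^d$) containing $y$; for $y\in\mathscr C_{\infty,\alpha}$ let $\mathcal F_y=\{y\}$; let $\mathcal G_x=\bigcup_{y:|y-x|=1}\mathcal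 F_y$. Let $T_0=0$ and, for $k\ge 0$, $T_{k+1}=\inf\{n>T_0+\dots+T_k: X_n\in\mathscr C_{\infty,\alpha}\}-(T_0+\dots+T_k)$. Put $\hat{\mathsf P}_\omega(x,y)=P^x_\omega(T_1<\infty,\,X_{T_1}=y)$, let $\hat{\mathsf P}^n_\omega$ be its $n$-fold product, and $\mathrm d_\omega(x,y)=\inf\{n\ge0:\hat{\mathsf P}^n_\omega(x,y)>0\}$. **Assumptions.** $\mathbb P$ is a probability measure on $\Omega$ such that: 1. $\mathbb P$ is invariant and jointly ergodic under the shifts $(\tau_x)_{x\in\mathbb Z^d}$. 2. $\bigcup_{\alpha>0}\mathscr C_{\infty,\alpha}(\omega)=\mathbb Z^d$ for $\mathbb P$-a.e. $\omega$. Let $\alpha_1=\inf\{\alpha>0:\mathbb P(0\in\mathscr C_{\infty,\alpha})=0\}$ and $\mathbb P_\alpha=\mathbb P(\,\cdot\mid 0\in\mathscr C_{\infty,\alpha})$. 3. There is $\alpha\in(0,\alpha_1)$ such that $|\mathcal G_0|\in L^p(\mathbb P_\alpha)$ for all $1\le p<\infty$. Let $\alpha_2$ be the supremum of all such $\alpha\in(0,\alpha_1)$.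 4. $\alpha_0\in(0,\alpha_2]$ is such that for all $\alpha\in(0,\alpha_0)$ and $\rho>0$, for $\mathbb P_\alpha$-a.e. $\omega$ there is $C(\omega)<\infty$ with $\hat{\mathsf P}^n_\omega(x,y)\le C(\omega)n^{-d/2}$ for all $n\ge1$ and all $x,y\in\mathscr C_{\infty,\alpha}$ with $\mathrm d_\omega(0,x)\le\rho n$. **The trapping event.** For $n\ge1$ let $\ell_n=\inf\{m\ge1:\sum_{k=1}^mT_k\ge2n\}$. For $\theta\ge1$ and $r\ge1$ let $\mathcal E^{(r)}_{\omega,\alpha}(\theta,n)$ be the event that $r\le\ell_n\le\theta$, that $T_1,\dots,T_{\ell_n}$ are finite, and that there are indices $1\le i_1<\dots<i_r\le\ell_n$ with $\sum_{1\le k\le\ell_n,\;k\notin\{i_1,\dots,i_r\}}T_k\le\theta$. (Thus by time $2n$ the walk makes at most $\theta$ visits to the strong cluster $\mathscr C_{\infty,\alpha}$ and spends all but $\theta$ units of time in at most $r$ excursions away from it, hence in at most $r$ components of its complement.) **Theorem 2.6.** Let $r=\lfloor d/2-1\rfloor$ and $\lambda_n(\omega)=n^{d/2}\,\mathsf P^{2n}_\omega(0,0)$.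 Under these assumptions, for every $\alpha\in(0,\alpha_0)$ there is a finite random variable $C=C(\omega)$ such that for $\mathbb P_\alpha$-a.e. $\omega$ the following holds: for all integers $n\ge1$ and all real $\theta$ with $1\le\theta\le n/2$ there is an integer $n^\star$ with $n-\theta\le n^\star\le n$ and $$P^0_\omega\bigl(\mathcal E^{(r)}_{\omega,\alpha}(\theta,n^\star)\,\big|\,X_{2n^\star}=0\bigr)\;\ge\;1-\frac{C(\omega)}{\lambda_n(\omega)}\begin{cases}\dfrac n\theta\log\dfrac n\theta,&d=4,\\[2mm]\Bigl(\dfrac n\theta\Bigr)^{d/2-1},&d\ge5.\end{cases}$$ -/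

import Mathlib

open MeasureTheory ProbabilityTheory
open scoped ENNReal

noncomputable section

namespace RandomConductance

/-! ### The lattice and the space of conductances -/

/-- The vertex set `ℤ^d`. -/
abbrev Vertex (d : ℕ) : Type := Fin d → ℤ

/-- The hypercubic lattice: `x` and `y` are neighbours when `|x - y|₁ = 1`. -/
def lattice (d : ℕ) : SimpleGraph (Vertex d) where
  Adj x y := ∑ i, |x i - y i| = 1
  symm := ⟨fun x y h => by simpa only [abs_sub_comm] using h⟩
  loopless := ⟨fun x h => by simp at h⟩

/-- The environments `Ω = (0,1]^{𝔹(ℤ^d)}`, with the product σ-algebra. -/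
abbrev Env (d : ℕ) : Type := (lattice d).edgeSet → Set.Ioc (0 : ℝ) 1

open Classical in
/-- The conductance `ω_{xy}`, set to `0` when `x`, `y` are not neighbours. -/
def conductance {d : ℕ} (ω : Env d) (x y : Vertex d) : ℝ :=
  if h : (lattice d).Adj x y then (ω ⟨s(x, y), h⟩ : ℝ) else 0

theorem map_add_mem_edgeSet {d : ℕ} (x : Vertex d) (e : Sym2 (Vertex d))
    (he : e ∈ (lattice d).edgeSet) : e.map (· + x) ∈ (lattice d).edgeSet := by
  induction e with
  | h y z => simpa [lattice] using he

/-- The shift `(τ_x ω)_{yz} = ω_{y+x, z+x}`. -/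
def shift {d : ℕ} (x : Vertex d) (ω : Env d) : Env d :=
  fun e => ω ⟨(e : Sym2 (Vertex d)).map (· + x), map_add_mem_edgeSet x e e.2⟩

/-! ### The random walk -/

theorem finite_neighborSet {d : ℕ} (x : Vertex d) : ((lattice d).neighborSet x).Finite := by
  refine (Set.finite_Icc (x - 1) (x + 1)).subset ?_
  intro y hy
  have hy' : ∑ i, |x i - y i| = 1 := hy
  have key : ∀ i, |x i - y i| ≤ 1 := fun i => hy' ▸
    Finset.single_le_sum (f := fun i => |x i - y i|) (fun _ _ => abs_nonneg _) (Finset.mem_univ i)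
  constructor <;> intro i <;> have := abs_le.mp (key i) <;> simp <;> omega

instance {d : ℕ} (x : Vertex d) : Fintype ((lattice d).neighborSet x) :=
  (finite_neighborSet x).fintype

/-- `π_ω(x) = ∑_{z : |z - x| = 1} ω_{xz}`. -/
def weight {d : ℕ} (ω : Env d) (x : Vertex d) : ℝ :=
  ∑ z ∈ (lattice d).neighborFinset x, conductance ω x z

/-- The transition kernel `P_ω(x,y) = ω_{xy} / π_ω(x)`. -/
def transProb {d : ℕ} (ω : Env d) (x y : Vertex d) : ℝ≥0∞ :=
  ENNReal.ofReal (conductance ω x y / weight ω x)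

theorem conductance_nonneg {d : ℕ} (ω : Env d) (x y : Vertex d) : 0 ≤ conductance ω x y := by
  unfold conductance
  split_ifs with h
  · exact (ω ⟨s(x, y), h⟩).2.1.le
  · exact le_rfl

theorem weight_pos {d : ℕ} [NeZero d] (ω : Env d) (x : Vertex d) : 0 < weight ω x := by
  obtain ⟨y, hy⟩ : ∃ y, (lattice d).Adj x y := by
    refine ⟨fun i => x i + if i = 0 then 1 else 0, ?_⟩
    have h : ∀ i : Fin d, |x i - (x i + if i = 0 then 1 else 0)| = if i = 0 then 1 else 0 := by
      intro i
      split_ifs <;> simp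
    simp only [lattice, h, Finset.sum_ite_eq', Finset.mem_univ, if_true]
  refine Finset.sum_pos' (fun z _ => conductance_nonneg ω x z) ⟨y, by simpa using hy, ?_⟩
  rw [conductance, dif_pos hy]
  exact (ω _).2.1

theorem hasSum_transProb {d : ℕ} [NeZero d] (ω : Env d) (x : Vertex d) :
    HasSum (transProb ω x) 1 := by
  have h0 : ∀ z ∉ (lattice d).neighborFinset x, transProb ω x z = 0 := by
    intro z hz
    have hz' : ¬ (lattice d).Adj x z := by simpa using hz
    simp [transProb, conductance, hz']
  have h1 : ∑ z ∈ (lattice d).neighborFinset x, transProb ω x z = 1 := by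
    unfold transProb
    rw [← ENNReal.ofReal_sum_of_nonneg
      (fun z _ => div_nonneg (conductance_nonneg ω x z) (weight_pos ω x).le),
      ← Finset.sum_div]
    change ENNReal.ofReal (weight ω x / weight ω x) = 1
    rw [div_self (weight_pos ω x).ne', ENNReal.ofReal_one]
  exact h1 ▸ hasSum_sum_of_ne_finset_zero h0

/-- The law `P_ω(x, ·)` of one step of the walk from `x`. -/
def stepPMF {d : ℕ} [NeZero d] (ω : Env d) (x : Vertex d) : PMF (Vertex d) :=
  ⟨transProb ω x, hasSum_transProb ω x⟩

/-- One step of the walk, as a Markov kernel on `ℤ^d`. -/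
def stepKernel {d : ℕ} [NeZero d] (ω : Env d) : Kernel (Vertex d) (Vertex d) where
  toFun x := (stepPMF ω x).toMeasure
  measurable' := Measurable.of_discrete

instance {d : ℕ} [NeZero d] (ω : Env d) : IsMarkovKernel (stepKernel ω) :=
  ⟨fun x => PMF.toMeasure.isProbabilityMeasure (stepPMF ω x)⟩

/-- The law `P_ω^x` of the path `(X_n)_{n ≥ 0}` of the Markov chain with transition kernel `P_ω`
started at `x` (by the Ionescu-Tulcea theorem): given the path up to time `n`, the vertex `X_{n+1}`
has law `P_ω(X_n, ·)`. -/
def walkLaw {d : ℕ} [NeZero d] (ω : Env d) (x : Vertex d) : Measure (ℕ → Vertex d) :=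
  Kernel.traj (X := fun _ => Vertex d)
    (fun n => (stepKernel ω).comap (fun h => h ⟨n, Finset.mem_Iic.2 le_rfl⟩)
      (measurable_pi_apply _)) 0 (fun _ => x)

/-- The `n`-fold product of a kernel `K` on `ℤ^d`. -/
def kernelPow {d : ℕ} (K : Vertex d → Vertex d → ℝ≥0∞) : ℕ → Vertex d → Vertex d → ℝ≥0∞
  | 0, x, y => if x = y then 1 else 0
  | n + 1, x, y => ∑' z, K x z * kernelPow K n z y

/-- `λ_n(ω) = n^{d/2} P_ω^{2n}(0,0)`. -/
def lam {d : ℕ} (ω : Env d) (n : ℕ) : ℝ :=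
  (n : ℝ) ^ ((d : ℝ) / 2) * (kernelPow (transProb ω) (2 * n) 0 0).toReal

/-! ### Strong edges, the strong cluster and the weak components -/

/-- `𝒞_{∞,α}(ω)`: the vertices lying on an infinite self-avoiding path of edges whose
conductance is at least `α`. -/
def cluster {d : ℕ} (ω : Env d) (α : ℝ) : Set (Vertex d) :=
  {x | ∃ γ : ℕ → Vertex d, Function.Injective γ ∧
    (∀ k, (lattice d).Adj (γ k) (γ (k + 1)) ∧ α ≤ conductance ω (γ k) (γ (k + 1))) ∧
    x ∈ Set.range γ}

/-- `ℱ_y`: the connected component of `ℤ^d ∖ 𝒞_{∞,α}` containing `y` when `y ∉ 𝒞_{∞,α}`, and `{y}`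
when `y ∈ 𝒞_{∞,α}`. -/
def weakComponent {d : ℕ} (ω : Env d) (α : ℝ) (y : Vertex d) : Set (Vertex d) :=
  {z | z = y ∨ ∃ (hy : y ∈ (cluster ω α)ᶜ) (hz : z ∈ (cluster ω α)ᶜ),
    ((lattice d).induce (cluster ω α)ᶜ).Reachable ⟨y, hy⟩ ⟨z, hz⟩}

/-- `𝒢_x`: the union of `ℱ_y` over the neighbours `y` of `x`. -/
def weakNeighborhood {d : ℕ} (ω : Env d) (α : ℝ) (x : Vertex d) : Set (Vertex d) :=
  ⋃ y ∈ (lattice d).neighborSet x, weakComponent ω α y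

/-- `ℙ_α = ℙ( · | 0 ∈ 𝒞_{∞,α})`. -/
def condLaw {d : ℕ} (P : Measure (Env d)) (α : ℝ) : Measure (Env d) :=
  P[|{ω | (0 : Vertex d) ∈ cluster ω α}]

/-! ### The coarse-grained walk -/

/-- The time `T_0 + ⋯ + T_k` of the `k`-th visit of the path `X` to `C` after time `0`
(`⊤` if there is none). -/
def visitTime {d : ℕ} (C : Set (Vertex d)) (X : ℕ → Vertex d) : ℕ → ℕ∞
  | 0 => 0
  | k + 1 => ⨅ (n : ℕ) (_ : visitTime C X k < n ∧ X n ∈ C), (n : ℕ∞)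

/-- `T_k`, the time between the `(k-1)`-st and the `k`-th visit to `C`; `T_0 = 0`. -/
def gapTime {d : ℕ} (C : Set (Vertex d)) (X : ℕ → Vertex d) (k : ℕ) : ℕ∞ :=
  visitTime C X k - visitTime C X (k - 1)

/-- The coarse-grained kernel `P̂_ω(x,y) = P_ω^x(X_{T_1} = y)`. -/
def coarseProb {d : ℕ} [NeZero d] (ω : Env d) (α : ℝ) (x y : Vertex d) : ℝ≥0∞ :=
  walkLaw ω x {X | ∃ n : ℕ, gapTime (cluster ω α) X 1 = n ∧ X n = y}

/-- The Markov distance `d_ω(x,y) = inf {n ≥ 0 : P̂_ω^n(x,y) > 0}` (`⊤` if there is no such `n`). -/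
def markovDist {d : ℕ} [NeZero d] (ω : Env d) (α : ℝ) (x y : Vertex d) : ℕ∞ :=
  ⨅ (n : ℕ) (_ : 0 < kernelPow (coarseProb ω α) n x y), (n : ℕ∞)

/-! ### The assumptions on the environment law -/

/-- `ℙ` is invariant and (jointly) ergodic with respect to the shifts `(τ_x)`. -/
def ShiftErgodic {d : ℕ} (P : Measure (Env d)) : Prop :=
  (∀ x, MeasurePreserving (shift x) P P) ∧
  ∀ A : Set (Env d), MeasurableSet A → (∀ x, shift x ⁻¹' A = A) → P A = 0 ∨ P A = 1

/-- Almost surely, the strong clusters exhaust `ℤ^d` as `α ↓ 0`. -/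
def ClustersExhaust {d : ℕ} (P : Measure (Env d)) : Prop :=
  ∀ᵐ ω ∂P, ⋃ α ∈ Set.Ioi (0 : ℝ), cluster ω α = Set.univ

/-- `α_1 = inf {α > 0 : ℙ(0 ∈ 𝒞_{∞,α}) = 0}`. -/
def alphaOne {d : ℕ} (P : Measure (Env d)) : ℝ :=
  sInf {α : ℝ | 0 < α ∧ P {ω | (0 : Vertex d) ∈ cluster ω α} = 0}

/-- `|𝒢_0| ∈ L^p(ℙ_α)` for all `1 ≤ p < ∞`. -/
def AllMoments {d : ℕ} (P : Measure (Env d)) (α : ℝ) : Prop :=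
  ∀ p : ℝ, 1 ≤ p →
    ∫⁻ ω, ((weakNeighborhood ω α 0).encard : ℝ≥0∞) ^ p ∂(condLaw P α) < ∞

/-- There is `α ∈ (0, α_1)` for which `|𝒢_0|` has all moments under `ℙ_α`. -/
def SmallWeakComponents {d : ℕ} (P : Measure (Env d)) : Prop :=
  ∃ α ∈ Set.Ioo 0 (alphaOne P), AllMoments P α

/-- `α_2 = sup {α ∈ (0, α_1) : |𝒢_0| has all moments under ℙ_α}`. -/
def alphaTwo {d : ℕ} (P : Measure (Env d)) : ℝ :=
  sSup {α : ℝ | α ∈ Set.Ioo 0 (alphaOne P) ∧ AllMoments P α}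

/-- The uniform diffusive upper bound for the coarse-grained walk, for all `α ∈ (0, α_0)`,
where `α_0 ∈ (0, α_2]`. -/
def DiffusiveBound {d : ℕ} [NeZero d] (P : Measure (Env d)) (α₀ : ℝ) : Prop :=
  α₀ ∈ Set.Ioc 0 (alphaTwo P) ∧
  ∀ α ∈ Set.Ioo 0 α₀, ∀ ρ : ℝ, 0 < ρ →
    ∀ᵐ ω ∂(condLaw P α), ∃ C : ℝ, ∀ n : ℕ, 1 ≤ n →
      ∀ x ∈ cluster ω α, (markovDist ω α 0 x : ℝ≥0∞) ≤ ENNReal.ofReal (ρ * n) →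
      ∀ y ∈ cluster ω α,
        kernelPow (coarseProb ω α) n x y ≤ ENNReal.ofReal (C / (n : ℝ) ^ ((d : ℝ) / 2))

/-! ### The trapping event -/

/-- `ℓ_n = inf {m ≥ 1 : T_1 + ⋯ + T_m ≥ 2n}`. -/
def ell {d : ℕ} (C : Set (Vertex d)) (X : ℕ → Vertex d) (n : ℕ) : ℕ :=
  sInf {m : ℕ | 1 ≤ m ∧ ((2 * n : ℕ) : ℕ∞) ≤ ∑ k ∈ Finset.Icc 1 m, gapTime C X k}

/-- `G_{ℓ,r}(θ)`: the `ℓ`-tuples of naturals for which the smallest value, over the choices of `r`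
indices, of the sum of the entries at the other indices is at most `θ`. -/
def trapTuples (ℓ r : ℕ) (θ : ℝ) : Set (Fin ℓ → ℕ) :=
  {t | ∃ I : Finset (Fin ℓ), I.card = r ∧ (∑ k ∈ Iᶜ, (t k : ℝ)) ≤ θ}

/-- The event `ℰ_{ω,α}^{(r)}(θ,n) = {r ≤ ℓ_n ≤ θ, (T_1, …, T_{ℓ_n}) ∈ G_{ℓ_n,r}(θ)}`. -/
def trapEvent {d : ℕ} (ω : Env d) (α : ℝ) (r : ℕ) (θ : ℝ) (n : ℕ) : Set (ℕ → Vertex d) :=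
  {X | r ≤ ell (cluster ω α) X n ∧ (ell (cluster ω α) X n : ℝ) ≤ θ ∧
    ∃ t ∈ trapTuples (ell (cluster ω α) X n) r θ,
      ∀ k : Fin (ell (cluster ω α) X n), gapTime (cluster ω α) X ((k : ℕ) + 1) = t k}

end RandomConductance

end

open RandomConductance

/-!
The walk is observed at its successive visits to the strong cluster. A path with `X_{2m} = 0` is
described by the sequence of its gaps `T_1, …, T_l`, and its probability is a matrix element of a
product of hitting kernels. If such a path violates the trapping event, then it has fewer than `r`
gaps, or more than `θ` gaps, or no `r` gaps exhaust the time `2m` up to `θ`. In the last case the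
elementary symmetric polynomial of degree `r + 1` in the gaps is at least of order `θ ^ r` times
their sum (`pow_mul_sum_le_tupleEsymm`). Adding up over all final times `m ∈ [n - θ, n]` removes the
constraint on the total duration, so Markov's inequality bounds the sum of the probabilities by

* a sum over `l > θ` of `n⁻¹` times the gap sequences weighted by `∑ T_i`,
* a sum over `r ≤ l ≤ θ` of `(n θ ^ r)⁻¹` times the gap sequences weighted by `e_{r+1}(T)`,
* a finite sum over `l < r` of gap sequences with a high moment of the durations, divided by `n ^ d`.

The weights in the first two sums turn into words in two operators: the coarse-grained kernel `P̂`
and the kernel `K(x, y) = E^x[T_1; X_{T_1} = y]`, with `j = 1` or `j = r + 1` letters `K`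
(`tsum_gapsOp_esymm`). The main estimate `words_return_le` says that the words of length `l` with
`j` letters `K` have a matrix element at `(0, 0)` of order `l ^ (j - d / 2)`. When a word is cut into
`j + 1` blocks of equal length, one block is free of `K`, and the diffusive bound for `P̂` yields the
factor `l ^ (-d / 2)`. Of the remaining two words, one starts at `0`, and the other one does so after
reversal of time; by `words_one_le` each letter `K` costs a factor `l` times a random constant.

These constants are values at `0` of maximal functions of iterates of `K` and of the maximal
operator for `P̂`. They are almost surely finite by the ergodic maximal inequality for the
environment seen from the walk (`mul_measure_maxFn_le`), which is a consequence of reversibility and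
mass transport, together with the moments of `K 1`. On the cluster `K 1` is at most linear in `|𝒢_x|`
(`kernelOp_moment_id_le`), again by reversibility. That `|𝒢_0|` has moments at every level below `α₂`
follows from the moments at a higher level by mass transport (`lintegral_nbhdSize_pow_lt_top`). The
high moments of the durations in the third sum are finite because all components are finite
(`kernelOp_moment_pow_lt_top`).

Finally some `m ∈ [n - θ, n]` does at least as well as the average, and the return probabilities at
even times are decreasing (`kernelPow_two_mul_antitone`), so that the conditioning costs at most the
factor `1 / P^{2n}(0, 0)`. The exponent `r = ⌊d / 2 - 1⌋` is the one for which
`∑_{l ≤ θ} l ^ (r + 1 - d / 2)` is dominated by its upper end and contributes at the same order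
`(n / θ) ^ (d / 2 - 1)` as `∑_{l > θ} l ^ (1 - d / 2)`; in dimension four the latter sum is
logarithmic.
-/

noncomputable section

namespace RandomConductance


/-! ### Kernels acting on nonnegative functions -/

section Operators

open Finset.HasAntidiagonal (antidiagonal)

variable {V : Type*}

/-- The operator `g ↦ ∑ y, k(·, y) g(y)` on `[0, ∞]`-valued functions with kernel `k`. Operators are
encoded as additive endomorphisms, so that sums, products and powers of operators come from the
semiring structure of `AddMonoid.End`; additivity already gives monotonicity. -/
def kernelOp (k : V → V → ℝ≥0∞) : AddMonoid.End (V → ℝ≥0∞) where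
  toFun g x := ∑' y, k x y * g y
  map_zero' := by ext x; simp
  map_add' g h := by ext x; simp [mul_add, ENNReal.tsum_add]

theorem kernelOp_apply (k : V → V → ℝ≥0∞) (g : V → ℝ≥0∞) (x : V) :
    kernelOp k g x = ∑' y, k x y * g y := rfl

theorem opMul_apply (A B : AddMonoid.End (V → ℝ≥0∞)) (g : V → ℝ≥0∞) : (A * B) g = A (B g) := rfl

theorem opAdd_apply (A B : AddMonoid.End (V → ℝ≥0∞)) (g : V → ℝ≥0∞) :
    (A + B) g = A g + B g := rfl

theorem opSum_apply {ι : Type*} (s : Finset ι) (A : ι → AddMonoid.End (V → ℝ≥0∞))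
    (g : V → ℝ≥0∞) : (∑ i ∈ s, A i) g = ∑ i ∈ s, A i g :=
  AddMonoidHom.finsetSum_apply A s g

/-- An additive map between functions with values in `[0, ∞]` is monotone. -/
theorem opMono (A : AddMonoid.End (V → ℝ≥0∞)) : Monotone A := by
  intro g h hgh
  obtain ⟨c, rfl⟩ := exists_add_of_le hgh
  rw [map_add]
  exact le_self_add

theorem kernelOp_single [DecidableEq V] (k : V → V → ℝ≥0∞) (x y : V) :
    kernelOp k (Pi.single y 1) x = k x y := by
  rw [kernelOp_apply, tsum_eq_single y]
  · simp
  · intro z hz; simp [hz]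

theorem kernelOp_tsum {ι : Type*} (k : V → V → ℝ≥0∞) (g : ι → V → ℝ≥0∞) (x : V) :
    kernelOp k (fun y => ∑' i, g i y) x = ∑' i, kernelOp k (g i) x := by
  simp only [kernelOp_apply, ← ENNReal.tsum_mul_left]
  exact ENNReal.tsum_comm

theorem kernelOp_const_mul (k : V → V → ℝ≥0∞) (c : ℝ≥0∞) (g : V → ℝ≥0∞) (x : V) :
    kernelOp k (fun y => c * g y) x = c * kernelOp k g x := by
  simp only [kernelOp_apply, ← ENNReal.tsum_mul_left]
  exact tsum_congr fun y => by ring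

theorem kernelOp_mul (k k' : V → V → ℝ≥0∞) :
    kernelOp k * kernelOp k' = kernelOp fun x y => ∑' z, k x z * k' z y := by
  ext g x
  simp only [opMul_apply, kernelOp_apply, ← ENNReal.tsum_mul_left,
    ← ENNReal.tsum_mul_right]
  rw [ENNReal.tsum_comm]
  exact tsum_congr fun y => tsum_congr fun z => by ring

theorem kernelOp_pow_const_mul (k : V → V → ℝ≥0∞) (n : ℕ) (c : ℝ≥0∞) (g : V → ℝ≥0∞) (x : V) :
    (kernelOp k ^ n) (fun y => c * g y) x = c * (kernelOp k ^ n) g x := by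
  induction n generalizing x with
  | zero => simp
  | succ n ih =>
    simp only [pow_succ', opMul_apply]
    rw [← kernelOp_const_mul]
    exact congrArg (fun h => kernelOp k h x) (funext ih)

theorem _root_.ENNReal.two_mul_mul_le_sq_add_sq (a b : ℝ≥0∞) : 2 * (a * b) ≤ a ^ 2 + b ^ 2 := by
  wlog h : a ≤ b generalizing a b
  · rw [mul_comm a b, add_comm]; exact this b a (le_of_not_ge h)
  obtain ⟨c, rfl⟩ := exists_add_of_le h
  calc 2 * (a * (a + c)) ≤ 2 * (a * (a + c)) + c ^ 2 := le_self_add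
    _ = _ := by ring

/-- Cauchy-Schwarz for a nonnegative kernel. -/
theorem kernelOp_sq_le (k : V → V → ℝ≥0∞) (g : V → ℝ≥0∞) (x : V) :
    kernelOp k g x ^ 2 ≤ kernelOp k 1 x * kernelOp k (fun y => g y ^ 2) x := by
  have h2 : 2 * kernelOp k g x ^ 2 ≤
      2 * (kernelOp k 1 x * kernelOp k (fun y => g y ^ 2) x) := by
    have e1 : 2 * kernelOp k g x ^ 2 = ∑' y, ∑' z, k x y * k x z * (2 * (g y * g z)) := by
      rw [sq, kernelOp_apply, ← ENNReal.tsum_mul_right, ← ENNReal.tsum_mul_left]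
      refine tsum_congr fun y => ?_
      rw [← ENNReal.tsum_mul_left, ← ENNReal.tsum_mul_left]
      exact tsum_congr fun z => by ring
    have e2 : ∑' y, ∑' z, k x y * k x z * (g y ^ 2 + g z ^ 2) =
        2 * (kernelOp k 1 x * kernelOp k (fun y => g y ^ 2) x) := by
      simp only [mul_add, ENNReal.tsum_add, kernelOp_apply, Pi.one_apply, mul_one]
      rw [two_mul]
      congr 1
      · rw [mul_comm, ← ENNReal.tsum_mul_right]
        refine tsum_congr fun y => ?_
        rw [← ENNReal.tsum_mul_left]
        exact tsum_congr fun z => by ring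
      · rw [← ENNReal.tsum_mul_right]
        refine tsum_congr fun y => ?_
        rw [← ENNReal.tsum_mul_left]
        exact tsum_congr fun z => by ring
    rw [e1, ← e2]
    gcongr with y z
    exact ENNReal.two_mul_mul_le_sq_add_sq _ _
  exact (ENNReal.mul_le_mul_iff_right two_ne_zero ENNReal.ofNat_ne_top).1 h2

/-! ### Adjoint operators -/

/-- `A` and `B` are adjoint for the bilinear form `(g, h) ↦ ∑ x, w(x) g(x) h(x)`. -/
def IsAdj (w : V → ℝ≥0∞) (A B : AddMonoid.End (V → ℝ≥0∞)) : Prop :=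
  ∀ g h : V → ℝ≥0∞, ∑' x, w x * (g x * A h x) = ∑' x, w x * (B g x * h x)

namespace IsAdj

variable {w : V → ℝ≥0∞} {A B A' B' : AddMonoid.End (V → ℝ≥0∞)}

theorem one : IsAdj w (1 : AddMonoid.End (V → ℝ≥0∞)) 1 := fun _ _ => rfl

theorem zero : IsAdj w (0 : AddMonoid.End (V → ℝ≥0∞)) 0 := fun _ _ => by simp

theorem add (h : IsAdj w A B) (h' : IsAdj w A' B') : IsAdj w (A + A') (B + B') := by
  intro g f
  simp only [opAdd_apply, Pi.add_apply, mul_add, add_mul, ENNReal.tsum_add, h g f,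
    h' g f]

theorem mul (h : IsAdj w A B) (h' : IsAdj w A' B') : IsAdj w (A * A') (B' * B) := by
  intro g f
  simp only [opMul_apply]
  rw [h g, h' _ f]

theorem pow (h : IsAdj w A B) (n : ℕ) : IsAdj w (A ^ n) (B ^ n) := by
  induction n with
  | zero => simpa using one
  | succ n ih => rw [pow_succ, pow_succ']; exact ih.mul h

theorem kernelOp {k k' : V → V → ℝ≥0∞} (h : ∀ x y, w x * k x y = w y * k' y x) :
    IsAdj w (kernelOp k) (kernelOp k') := by
  intro g f
  simp only [kernelOp_apply, ← ENNReal.tsum_mul_left, ← ENNReal.tsum_mul_right]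
  rw [ENNReal.tsum_comm]
  refine tsum_congr fun y => tsum_congr fun x => ?_
  calc w x * (g x * (k x y * f y)) = (w x * k x y) * (g x * f y) := by ring
    _ = _ := by rw [h x y]; ring

theorem apply_single [DecidableEq V] (h : IsAdj w A B) (x y : V) :
    w x * A (Pi.single y 1) x = w y * B (Pi.single x 1) y := by
  have := h (Pi.single x 1) (Pi.single y 1)
  rw [tsum_eq_single x, tsum_eq_single y] at this
  · simpa using this
  · intro z hz; simp [hz]
  · intro z hz; simp [hz]

end IsAdj

/-! ### Words in two operators -/

open Polynomial in
/-- The sum of all words of length `l` in `P` and `K` in which `K` occurs exactly `j` times, encoded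
as the coefficient of `X ^ j` in the noncommutative expansion of `(P + X K) ^ l`. -/
def words (P K : AddMonoid.End (V → ℝ≥0∞)) (l j : ℕ) : AddMonoid.End (V → ℝ≥0∞) :=
  ((C P + X * C K) ^ l).coeff j

variable (P K : AddMonoid.End (V → ℝ≥0∞))

theorem words_zero_zero : words P K 0 0 = 1 := by simp [words]

theorem words_zero_succ (j : ℕ) : words P K 0 (j + 1) = 0 := by
  simp [words, Polynomial.coeff_one]

theorem words_zero_right (l : ℕ) : words P K l 0 = P ^ l := by
  unfold words
  induction l with
  | zero => simp
  | succ l ih => rw [pow_succ, Polynomial.mul_coeff_zero, ih]; simp [pow_succ]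

theorem words_succ_succ (l j : ℕ) :
    words P K (l + 1) (j + 1) = K * words P K l j + P * words P K l (j + 1) := by
  unfold words
  rw [pow_succ', add_mul, Polynomial.coeff_add, Polynomial.coeff_C_mul, mul_assoc,
    Polynomial.coeff_X_mul, Polynomial.coeff_C_mul, add_comm]

theorem words_succ_succ' (l j : ℕ) :
    words P K (l + 1) (j + 1) = words P K l j * K + words P K l (j + 1) * P := by
  unfold words
  rw [pow_succ, mul_add, Polynomial.coeff_add, Polynomial.coeff_mul_C, ← mul_assoc,
    Polynomial.coeff_mul_C, Polynomial.coeff_mul_X, add_comm]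

theorem words_add (a b j : ℕ) :
    words P K (a + b) j = ∑ q ∈ antidiagonal j, words P K a q.1 * words P K b q.2 := by
  unfold words
  rw [pow_add, Polynomial.coeff_mul]

theorem words_isAdj {w : V → ℝ≥0∞} (hP : IsAdj w P P) (hK : IsAdj w K K) (l j : ℕ) :
    IsAdj w (words P K l j) (words P K l j) := by
  induction l generalizing j with
  | zero =>
    cases j with
    | zero => rw [words_zero_zero]; exact IsAdj.one
    | succ j => rw [words_zero_succ]; exact IsAdj.zero
  | succ l ih =>
    cases j with
    | zero => rw [words_zero_right]; exact hP.pow _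
    | succ j =>
      have := (hK.mul (ih j)).add (hP.mul (ih (j + 1)))
      rwa [← words_succ_succ, ← words_succ_succ'] at this

/-- Pigeonhole for words: when a word of length `(n + 1) b + c` with `j ≤ n` letters `K` is cut
into `n + 1` blocks of length `b` and a remainder, some block consists of letters `P` only. -/
theorem words_le_sum_blocks (b c n j : ℕ) (hj : j ≤ n) (g : V → ℝ≥0∞) :
    words P K ((n + 1) * b + c) j g ≤
      (∑ p ∈ antidiagonal n, ∑ q ∈ antidiagonal j,
        words P K (p.1 * b) q.1 * (P ^ b * words P K (p.2 * b + c) q.2)) g := by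
  induction n generalizing j with
  | zero =>
    obtain rfl : j = 0 := by omega
    simp [words_zero_right, pow_add]
  | succ n ih =>
    rw [show (n + 1 + 1) * b + c = b + ((n + 1) * b + c) by ring, words_add,
      Finset.Nat.sum_antidiagonal_succ]
    -- the words whose first block is free of `K`
    have hfst : (∑ q ∈ antidiagonal j,
        words P K (0 * b) q.1 * (P ^ b * words P K ((n + 1) * b + c) q.2)) =
        P ^ b * words P K ((n + 1) * b + c) j := by
      rw [Finset.sum_eq_single (0, j)]
      · simp [words_zero_zero]
      · rintro ⟨q1, q2⟩ hq hne
        cases q1 with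
        | zero => simp at hq; simp [hq] at hne
        | succ q1 => simp [words_zero_succ]
      · simp
    cases j with
    | zero =>
      simp only [Finset.HasAntidiagonal.antidiagonal_zero, Finset.sum_singleton, words_zero_right]
      simp only [opAdd_apply]
      refine le_trans (le_of_eq ?_) le_self_add
      simp
    | succ j =>
      rw [hfst, Finset.Nat.sum_antidiagonal_succ, words_zero_right]
      simp only [opAdd_apply]
      gcongr
      -- the words with a letter `K` in the first block
      have hsplit : ∀ p : ℕ × ℕ, (∑ q ∈ antidiagonal (j + 1),
          words P K ((p.1 + 1) * b) q.1 * (P ^ b * words P K (p.2 * b + c) q.2)) =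
          (∑ s ∈ antidiagonal (j + 1), words P K b s.1 *
            ∑ q ∈ antidiagonal s.2,
              words P K (p.1 * b) q.1 * (P ^ b * words P K (p.2 * b + c) q.2)) := by
        intro p
        simp only [show (p.1 + 1) * b = b + p.1 * b by ring, words_add P K b, Finset.sum_mul,
          Finset.mul_sum]
        rw [Finset.sum_sigma', Finset.sum_sigma']
        simp only [mul_assoc]
        exact Finset.sum_nbij' (fun x => ⟨(x.2.1, x.2.2 + x.1.2), (x.2.2, x.1.2)⟩)
          (fun x => ⟨(x.1.1 + x.2.1, x.2.2), (x.1.1, x.2.1)⟩)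
          (by rintro ⟨⟨a1, a2⟩, ⟨b1, b2⟩⟩ h; simp at h ⊢; omega)
          (by rintro ⟨⟨a1, a2⟩, ⟨b1, b2⟩⟩ h; simp at h ⊢; omega)
          (by rintro ⟨⟨a1, a2⟩, ⟨b1, b2⟩⟩ h; simp at h ⊢; omega)
          (by rintro ⟨⟨a1, a2⟩, ⟨b1, b2⟩⟩ h; simp at h ⊢; omega)
          (by rintro ⟨⟨a1, a2⟩, ⟨b1, b2⟩⟩ h; rfl)
      simp only [hsplit]
      rw [Finset.sum_comm, Finset.Nat.sum_antidiagonal_succ]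
      simp only [opAdd_apply]
      refine le_trans ?_ le_add_self
      simp only [← Finset.mul_sum, opSum_apply, opMul_apply]
      refine Finset.sum_le_sum fun s hs => ?_
      refine opMono _ ?_
      have := ih s.2 (by simp at hs; omega)
      simpa only [opSum_apply, opMul_apply] using this

end Operators


/-! ### The first-step decomposition of the walk -/

section Path

variable {d : ℕ}

/-- The path after its first step. -/
def pathTail (X : ℕ → Vertex d) : ℕ → Vertex d := fun n => X (n + 1)

theorem measurable_pathTail : Measurable (pathTail (d := d)) :=
  measurable_pi_lambda _ fun n => measurable_pi_apply (n + 1)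

/-- The paths whose first `N + 1` vertices are those of `p`. -/
def prefixSet (N : ℕ) (p : ℕ → Vertex d) : Set (ℕ → Vertex d) := {X | ∀ i ≤ N, X i = p i}

theorem measurableSet_coord (i : ℕ) (A : Set (Vertex d)) :
    MeasurableSet {X : ℕ → Vertex d | X i ∈ A} :=
  (Set.to_countable A).measurableSet.preimage (measurable_pi_apply i)

theorem measurableSet_prefixSet (N : ℕ) (p : ℕ → Vertex d) : MeasurableSet (prefixSet N p) := by
  have : prefixSet N p = ⋂ i, ⋂ (_ : i ≤ N), (fun X : ℕ → Vertex d => X i) ⁻¹' {p i} := by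
    ext X; simp [prefixSet]
  rw [this]
  exact MeasurableSet.iInter fun i => MeasurableSet.iInter fun _ =>
    measurableSet_coord i {p i}

/-- Finite measures on the path space are determined by their values on prefix sets. -/
theorem measure_ext_prefixSet {μ ν : Measure (ℕ → Vertex d)} [IsFiniteMeasure μ]
    (h : ∀ N p, μ (prefixSet N p) = ν (prefixSet N p)) : μ = ν := by
  have hμ : IsProjectiveLimit μ fun I => μ.map I.restrict := fun I => rfl
  refine hμ.unique (ν := ν) fun I => ?_
  obtain ⟨N, hN⟩ : ∃ N, I ⊆ Finset.Iic N :=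
    ⟨I.sup id, fun i hi => Finset.mem_Iic.2 (Finset.le_sup (f := id) hi)⟩
  have key : ν.map (Finset.Iic N).restrict = μ.map (Finset.Iic N).restrict := by
    refine Measure.ext_of_singleton fun q => ?_
    let p : ℕ → Vertex d := fun i => if hi : i ∈ Finset.Iic N then q ⟨i, hi⟩ else 0
    have hpre : (Finset.Iic N).restrict (π := fun _ => Vertex d) ⁻¹' {q} = prefixSet N p := by
      ext X
      simp only [Set.mem_preimage, Set.mem_singleton_iff, prefixSet, Set.mem_ofPred_eq]
      constructor
      · rintro rfl i hi
        simp [p, hi]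
      · intro hX
        ext1 i
        have := hX i (Finset.mem_Iic.1 i.2)
        simp only [Finset.restrict, this, p, dif_pos i.2]
    rw [Measure.map_apply (Finset.measurable_restrict _) (measurableSet_singleton _),
      Measure.map_apply (Finset.measurable_restrict _) (measurableSet_singleton _), hpre, h]
  rw [← Finset.restrict₂_comp_restrict hN, ← Measure.map_map (Finset.measurable_restrict₂ hN)
    (Finset.measurable_restrict _), key, Measure.map_map (Finset.measurable_restrict₂ hN)
    (Finset.measurable_restrict _)]
  rfl

theorem kernelPow_eq_kernelOp_pow (k : Vertex d → Vertex d → ℝ≥0∞) (n : ℕ) (x y : Vertex d) :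
    kernelPow k n x y = (kernelOp k ^ n) (Pi.single y 1) x := by
  induction n generalizing x with
  | zero => simp [kernelPow, Pi.single_apply]
  | succ n ih =>
    rw [pow_succ', opMul_apply, kernelOp_apply, kernelPow]
    exact tsum_congr fun z => by rw [ih]

theorem kernelOp_pow_eq (k : Vertex d → Vertex d → ℝ≥0∞) (n : ℕ) :
    kernelOp k ^ n = kernelOp (kernelPow k n) := by
  induction n with
  | zero =>
    ext g x
    rw [kernelOp_apply, tsum_eq_single x]
    · simp [kernelPow]
    · intro y hy; simp [kernelPow, Ne.symm hy]
  | succ n ih => rw [pow_succ', ih, kernelOp_mul]; rfl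

variable [NeZero d] (ω : Env d)

instance (x : Vertex d) : IsProbabilityMeasure (walkLaw ω x) := by
  unfold walkLaw; infer_instance

theorem stepKernel_singleton (x y : Vertex d) : stepKernel ω x {y} = transProb ω x y :=
  PMF.toMeasure_apply_singleton _ _ (measurableSet_singleton y)

theorem walkLaw_prefixSet_zero (x : Vertex d) (p : ℕ → Vertex d) :
    walkLaw ω x (prefixSet 0 p) = if p 0 = x then 1 else 0 := by
  have h0 : prefixSet 0 p = Preorder.frestrictLe 0 ⁻¹'
      {q : (i : Finset.Iic 0) → Vertex d | q ⟨0, by simp⟩ = p 0} := by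
    ext X; simp [prefixSet]
  have hm : MeasurableSet {q : (i : Finset.Iic 0) → Vertex d | q ⟨0, by simp⟩ = p 0} :=
    (measurableSet_singleton (p 0)).preimage (measurable_pi_apply (⟨0, by simp⟩ : Finset.Iic 0))
  rw [h0, ← Measure.map_apply (Preorder.measurable_frestrictLe 0) hm, walkLaw,
    Kernel.traj_map_frestrictLe_apply, Kernel.partialTraj_self, Kernel.id_apply,
    Measure.dirac_apply' _ hm]
  simp [Set.indicator_apply, eq_comm]

/-- The Markov property of the trajectory measure, for events about finitely many steps. -/
theorem walkLaw_prefixSet_succ (x : Vertex d) (N : ℕ) (p : ℕ → Vertex d) :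
    walkLaw ω x (prefixSet (N + 1) p) =
      walkLaw ω x (prefixSet N p) * transProb ω (p N) (p (N + 1)) := by
  let κ : (n : ℕ) → Kernel ((i : Finset.Iic n) → Vertex d) (Vertex d) := fun n =>
    (stepKernel ω).comap (fun h => h ⟨n, Finset.mem_Iic.2 le_rfl⟩) (measurable_pi_apply _)
  let q : (i : Finset.Iic N) → Vertex d := fun i => p i
  have hN : prefixSet N p = Preorder.frestrictLe (π := fun _ => Vertex d) N ⁻¹' {q} := by
    ext X
    simp only [prefixSet, Set.mem_ofPred_eq, Set.mem_preimage, Set.mem_singleton_iff, funext_iff,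
      Subtype.forall, Finset.mem_Iic]
    rfl
  have hN1 : prefixSet (N + 1) p = (fun X : ℕ → Vertex d =>
      (Preorder.frestrictLe (π := fun _ => Vertex d) N X, X (N + 1)))
      ⁻¹' ({q} ×ˢ {p (N + 1)}) := by
    rw [Set.mk_preimage_prod, ← hN]
    ext X
    simp only [prefixSet, Set.mem_ofPred_eq, Set.mem_inter_iff, Set.mem_preimage,
      Set.mem_singleton_iff]
    constructor
    · exact fun h => ⟨fun i hi => h i (by omega), h _ le_rfl⟩
    · rintro ⟨h1, h2⟩ i hi
      rcases Nat.le_succ_iff.1 hi with h | rfl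
      · exact h1 i h
      · exact h2
  have hm : Measurable (fun X : ℕ → Vertex d => (Preorder.frestrictLe (π := fun _ => Vertex d) N X,
      X (N + 1))) :=
    (Preorder.measurable_frestrictLe N).prodMk (measurable_pi_apply _)
  have hκ : ∀ n, IsMarkovKernel (κ n) := fun n => by dsimp only [κ]; infer_instance
  have hw : walkLaw ω x = Kernel.traj (X := fun _ => Vertex d) κ 0 (fun _ => x) := rfl
  have e := Kernel.partialTraj_compProd_eq_map_traj (X := fun _ => Vertex d) (κ := κ)
    (Nat.zero_le N) (x₀ := fun _ => x)
  rw [← hw] at e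
  have e2 : (walkLaw ω x).map (Preorder.frestrictLe N) =
      Kernel.partialTraj (X := fun _ => Vertex d) κ 0 N (fun _ => x) := by
    rw [hw, Kernel.traj_map_frestrictLe_apply]
  rw [hN1, ← Measure.map_apply hm ((measurableSet_singleton _).prod (measurableSet_singleton _)),
    ← e, Measure.compProd_apply_prod (measurableSet_singleton _) (measurableSet_singleton _),
    lintegral_singleton, hN, ← Measure.map_apply (Preorder.measurable_frestrictLe N)
      (measurableSet_singleton _), e2, mul_comm]
  congr 1
  exact stepKernel_singleton ω _ _

/-- The walk starts afresh after its first step. -/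
theorem map_pathTail_walkLaw (x : Vertex d) :
    (walkLaw ω x).map pathTail = Measure.sum fun z => transProb ω x z • walkLaw ω z := by
  refine haveI := Measure.isFiniteMeasure_map (walkLaw ω x) pathTail
    measure_ext_prefixSet fun N p => ?_
  rw [Measure.map_apply measurable_pathTail (measurableSet_prefixSet N p),
    Measure.sum_apply _ (measurableSet_prefixSet N p)]
  simp only [Measure.smul_apply, smul_eq_mul]
  -- the walk starts at `x`
  have hx : walkLaw ω x (pathTail ⁻¹' prefixSet N p) =
      walkLaw ω x (prefixSet (N + 1) fun i => Nat.casesOn i x p) := by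
    have h0 : walkLaw ω x (prefixSet 0 fun _ => x)ᶜ = 0 := by
      rw [prob_compl_eq_zero_iff (measurableSet_prefixSet _ _), walkLaw_prefixSet_zero, if_pos rfl]
    rw [← measure_inter_add_sdiff (pathTail ⁻¹' prefixSet N p)
      (measurableSet_prefixSet 0 fun _ => x)]
    rw [measure_mono_null (Set.sdiff_subset_compl _ _) h0, add_zero]
    congr 1
    ext X
    simp only [prefixSet, pathTail, Set.mem_inter_iff, Set.mem_preimage, Set.mem_ofPred_eq]
    constructor
    · rintro ⟨h1, h2⟩ i hi
      cases i with
      | zero => exact h2 0 le_rfl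
      | succ i => exact h1 i (by omega)
    · exact fun h => ⟨fun i hi => h (i + 1) (by omega), fun i hi => by
        obtain rfl : i = 0 := by omega
        exact h 0 (by omega)⟩
  rw [hx]
  clear hx
  have key : ∀ N, walkLaw ω x (prefixSet (N + 1) fun i => Nat.casesOn i x p) =
      transProb ω x (p 0) * walkLaw ω (p 0) (prefixSet N p) := by
    intro N
    induction N with
    | zero => simp [walkLaw_prefixSet_succ, walkLaw_prefixSet_zero]
    | succ N ih => rw [walkLaw_prefixSet_succ, ih, walkLaw_prefixSet_succ ω _ N, mul_assoc]
  rw [key, tsum_eq_single (p 0)]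
  intro z hz
  have : walkLaw ω z (prefixSet N p) = 0 := by
    refine measure_mono_null (t := prefixSet 0 p) (fun X hX i hi => hX i (by omega)) ?_
    rw [walkLaw_prefixSet_zero, if_neg (Ne.symm hz)]
  rw [this, mul_zero]

theorem walkLaw_preimage_pathTail (x : Vertex d) {A : Set (ℕ → Vertex d)} (hA : MeasurableSet A) :
    walkLaw ω x (pathTail ⁻¹' A) = ∑' z, transProb ω x z * walkLaw ω z A := by
  rw [← Measure.map_apply measurable_pathTail hA, map_pathTail_walkLaw, Measure.sum_apply _ hA]
  simp

theorem walkLaw_start (x : Vertex d) (A : Set (Vertex d)) [Decidable (x ∈ A)] :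
    walkLaw ω x {X | X 0 ∈ A} = if x ∈ A then 1 else 0 := by
  have h0 : walkLaw ω x (prefixSet 0 fun _ => x)ᶜ = 0 := by
    rw [prob_compl_eq_zero_iff (measurableSet_prefixSet _ _), walkLaw_prefixSet_zero, if_pos rfl]
  split_ifs with h
  · rw [← prob_compl_eq_zero_iff (measurableSet_coord 0 A)]
    refine measure_mono_null (fun X hX (hX' : X ∈ prefixSet 0 fun _ => x) => hX ?_) h0
    simpa [hX' 0 le_rfl] using h
  · refine measure_mono_null (fun X hX (hX' : X ∈ prefixSet 0 fun _ => x) => h ?_) h0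
    have := hX' 0 le_rfl
    simpa [this] using hX

/-- First-step decomposition of an event about the first vertex and the remaining path. -/
theorem walkLaw_firstStep (x : Vertex d) (D : Set (Vertex d)) {A : Set (ℕ → Vertex d)}
    (hA : MeasurableSet A) :
    walkLaw ω x {X | X 1 ∈ D ∧ pathTail X ∈ A} =
      ∑' z, (transProb ω x z * D.indicator 1 z) * walkLaw ω z A := by
  classical
  have hD : MeasurableSet {X : ℕ → Vertex d | X 0 ∈ D} :=
    measurableSet_coord 0 D
  have : {X : ℕ → Vertex d | X 1 ∈ D ∧ pathTail X ∈ A} =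
      pathTail ⁻¹' ({X | X 0 ∈ D} ∩ A) := rfl
  rw [this, walkLaw_preimage_pathTail ω x (hD.inter hA)]
  refine tsum_congr fun z => ?_
  rw [mul_assoc]
  congr 1
  have h1 := walkLaw_start ω z D
  by_cases hz : z ∈ D
  · rw [if_pos hz, ← prob_compl_eq_zero_iff hD] at h1
    rw [Set.indicator_of_mem hz, Pi.one_apply, one_mul, Set.inter_comm]
    exact measure_inter_conull h1
  · rw [if_neg hz] at h1
    rw [Set.indicator_of_notMem hz, zero_mul]
    exact measure_mono_null Set.inter_subset_left h1

theorem walkLaw_eq_kernelPow (n : ℕ) (x y : Vertex d) :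
    walkLaw ω x {X | X n = y} = kernelPow (transProb ω) n x y := by
  induction n generalizing x with
  | zero =>
    classical
    rw [kernelPow]
    exact walkLaw_start ω x {y}
  | succ n ih =>
    have hm : MeasurableSet {X : ℕ → Vertex d | X n = y} :=
      measurableSet_coord n {y}
    have := walkLaw_preimage_pathTail ω x hm
    rw [kernelPow]
    simp only [← ih, ← this]
    rfl

end Path


/-! ### Hitting kernels and their moments -/

section Hitting

variable {V : Type*} (p : V → V → ℝ≥0∞) (C : Set V)

/-- The kernel `p` restricted to steps that end outside `C`. -/
def killed (x y : V) : ℝ≥0∞ := p x y * Cᶜ.indicator 1 y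

/-- The kernel `p` restricted to steps that end in `C`. -/
def entry (x y : V) : ℝ≥0∞ := p x y * C.indicator 1 y

/-- The probability that the chain with kernel `p` first visits `C` after time `0` at time `n + 1`,
and that it is then at `y`. The index is shifted because such a visit takes at least one step. -/
def hit : ℕ → V → V → ℝ≥0∞
  | 0, x, y => entry p C x y
  | n + 1, x, y => ∑' z, killed p C x z * hit n z y

/-- The kernel `∑ n, φ(n) P^x(T = n + 1, X_T = y)`, where `T` is the time of the first visit
to `C` after time `0`. -/
def moment (φ : ℕ → ℝ≥0∞) (x y : V) : ℝ≥0∞ := ∑' n, φ n * hit p C n x y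

theorem kernelOp_hit (n : ℕ) :
    kernelOp (hit p C n) = kernelOp (killed p C) ^ n * kernelOp (entry p C) := by
  induction n with
  | zero => rw [pow_zero, one_mul]; rfl
  | succ n ih => rw [pow_succ', mul_assoc, ← ih, kernelOp_mul]; rfl

theorem kernelOp_moment_apply (φ : ℕ → ℝ≥0∞) (g : V → ℝ≥0∞) (x : V) :
    kernelOp (moment p C φ) g x = ∑' n, φ n * kernelOp (hit p C n) g x := by
  simp only [kernelOp_apply, moment, ← ENNReal.tsum_mul_left, ← ENNReal.tsum_mul_right]
  rw [ENNReal.tsum_comm]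
  exact tsum_congr fun n => tsum_congr fun y => by ring

/-- The product of the hitting kernels of a list of gaps. -/
def gapsOp (t : List ℕ) : AddMonoid.End (V → ℝ≥0∞) :=
  (t.map fun n => kernelOp (hit p C n)).prod

theorem gapsOp_cons (n : ℕ) (t : List ℕ) :
    gapsOp p C (n :: t) = kernelOp (hit p C n) * gapsOp p C t := by simp [gapsOp]

end Hitting

/-! ### The successive visits of the walk to a set -/

section Visits

variable {d : ℕ} (C : Set (Vertex d))

/-- The paths that first visit `C` after time `0` at time `n + 1` and then continue in `A`. -/
def afterHit (A : Set (ℕ → Vertex d)) : ℕ → Set (ℕ → Vertex d)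
  | 0 => {X | X 1 ∈ C ∧ pathTail X ∈ A}
  | n + 1 => {X | X 1 ∈ Cᶜ ∧ pathTail X ∈ afterHit A n}

/-- The paths whose successive waiting times between visits to `C` are `t₁ + 1, t₂ + 1, …`, and
which are at `y` at the last of these visits. -/
def visitSet (y : Vertex d) : List ℕ → Set (ℕ → Vertex d)
  | [] => {X | X 0 ∈ ({y} : Set (Vertex d))}
  | n :: t => afterHit C (visitSet y t) n

theorem measurableSet_afterHit {A : Set (ℕ → Vertex d)} (hA : MeasurableSet A) (n : ℕ) :
    MeasurableSet (afterHit C A n) := by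
  induction n with
  | zero => exact (measurableSet_coord 1 C).inter (measurable_pathTail hA)
  | succ n ih => exact (measurableSet_coord 1 Cᶜ).inter (measurable_pathTail ih)

theorem measurableSet_visitSet (y : Vertex d) (t : List ℕ) : MeasurableSet (visitSet C y t) := by
  induction t with
  | nil => exact measurableSet_coord 0 _
  | cons n t ih => exact measurableSet_afterHit C ih n

theorem walkLaw_afterHit [NeZero d] (ω : Env d) {A : Set (ℕ → Vertex d)} (hA : MeasurableSet A)
    (n : ℕ) (x : Vertex d) :
    walkLaw ω x (afterHit C A n) =
      kernelOp (hit (transProb ω) C n) (fun z => walkLaw ω z A) x := by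
  induction n generalizing x with
  | zero => exact walkLaw_firstStep ω x C hA
  | succ n ih =>
    have h1 := walkLaw_firstStep ω x Cᶜ (measurableSet_afterHit C hA n)
    rw [kernelOp_hit, pow_succ', mul_assoc, ← kernelOp_hit, opMul_apply, kernelOp_apply]
    simp only [← ih]
    exact h1

/-- By the Markov property at the visits, the law of the gaps is a product of hitting kernels. -/
theorem walkLaw_visitSet [NeZero d] (ω : Env d) (t : List ℕ) (x y : Vertex d) :
    walkLaw ω x (visitSet C y t) = gapsOp (transProb ω) C t (Pi.single y 1) x := by
  classical
  induction t generalizing x with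
  | nil =>
    rw [visitSet, walkLaw_start]
    simp [gapsOp, Pi.single_apply]
  | cons n t ih =>
    rw [visitSet, walkLaw_afterHit C ω (measurableSet_visitSet C y t), gapsOp_cons, opMul_apply]
    simp only [ih]

theorem mem_afterHit_iff {A : Set (ℕ → Vertex d)} {n : ℕ} {X : ℕ → Vertex d} :
    X ∈ afterHit C A n ↔ (∀ i, 0 < i → i < n + 1 → X i ∉ C) ∧ X (n + 1) ∈ C ∧
      (fun k => X (n + 1 + k)) ∈ A := by
  induction n generalizing X with
  | zero =>
    have : pathTail X = fun k => X (0 + 1 + k) := by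
      ext1 k; simp [pathTail, add_comm]
    rw [← this]
    constructor
    · rintro ⟨h1, h2⟩
      exact ⟨fun i hi hi' => by omega, h1, h2⟩
    · rintro ⟨-, h1, h2⟩
      exact ⟨h1, h2⟩
  | succ n ih =>
    have h : X ∈ afterHit C A (n + 1) ↔ X 1 ∉ C ∧ pathTail X ∈ afterHit C A n := Iff.rfl
    have e : (fun k => pathTail X (n + 1 + k)) = fun k => X (n + 1 + 1 + k) := by
      ext1 k; simp only [pathTail]; congr 1; omega
    rw [h, ih, e]
    constructor
    · rintro ⟨h1, h2, h3, h4⟩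
      refine ⟨fun i hi hi' => ?_, h3, h4⟩
      obtain ⟨j, rfl⟩ := Nat.exists_eq_succ_of_ne_zero hi.ne'
      rcases Nat.eq_zero_or_pos j with rfl | hj
      · exact h1
      · exact h2 j hj (by omega)
    · rintro ⟨h2, h3, h4⟩
      exact ⟨h2 1 one_pos (by omega), fun i hi hi' => h2 (i + 1) (by omega) (by omega), h3, h4⟩

/-- The time of the `k`-th visit when the waiting times are `t₁ + 1, t₂ + 1, …`. -/
def visitSum (t : List ℕ) (k : ℕ) : ℕ := (t.take k).sum + k

theorem visitSum_zero (t : List ℕ) : visitSum t 0 = 0 := by simp [visitSum]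

theorem visitSum_cons_succ (n : ℕ) (t : List ℕ) (k : ℕ) :
    visitSum (n :: t) (k + 1) = n + 1 + visitSum t k := by simp [visitSum]; omega

theorem visitSum_succ (t : List ℕ) (k : ℕ) (hk : k < t.length) :
    visitSum t (k + 1) = visitSum t k + (t[k] + 1) := by
  simp only [visitSum, List.take_add_one, List.sum_append]
  simp [hk]
  omega

/-- On `visitSet`, the visits to `C` occur at the times `visitSum t k` and at no time in between. -/
theorem visits_of_mem_visitSet {y : Vertex d} {t : List ℕ} {X : ℕ → Vertex d}
    (hX : X ∈ visitSet C y t) : ∀ k < t.length, X (visitSum t (k + 1)) ∈ C ∧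
      ∀ i, visitSum t k < i → i < visitSum t (k + 1) → X i ∉ C := by
  induction t generalizing X with
  | nil => simp
  | cons n t ih =>
    obtain ⟨h1, h2, h3⟩ := (mem_afterHit_iff C).1 hX
    intro k hk
    cases k with
    | zero => simpa [visitSum_cons_succ, visitSum_zero] using ⟨h2, fun i hi hi' => h1 i hi (by omega)⟩
    | succ k =>
      obtain ⟨h4, h5⟩ := ih h3 k (by simpa using hk)
      rw [visitSum_cons_succ, visitSum_cons_succ]
      refine ⟨h4, fun i hi hi' => ?_⟩
      obtain ⟨j, rfl⟩ := Nat.exists_eq_add_of_le (show n + 1 ≤ i by omega)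
      exact h5 j (by omega) (by omega)

theorem visitTime_succ_eq {X : ℕ → Vertex d} {k a b : ℕ} (hk : visitTime C X k = a) (hab : a < b)
    (hb : X b ∈ C) (h : ∀ i, a < i → i < b → X i ∉ C) : visitTime C X (k + 1) = b := by
  rw [visitTime, hk]
  refine le_antisymm (iInf₂_le b ⟨by exact_mod_cast hab, hb⟩) (le_iInf₂ fun i hi => ?_)
  by_contra hlt
  exact h i (by exact_mod_cast hi.1) (by exact_mod_cast not_le.1 hlt) hi.2

theorem visitTime_of_mem_visitSet {y : Vertex d} {t : List ℕ} {X : ℕ → Vertex d}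
    (hX : X ∈ visitSet C y t) {k : ℕ} (hk : k ≤ t.length) :
    visitTime C X k = visitSum t k := by
  induction k with
  | zero => simp [visitTime, visitSum_zero]
  | succ k ih =>
    obtain ⟨h1, h2⟩ := visits_of_mem_visitSet C hX k (by omega)
    exact visitTime_succ_eq C (ih (by omega)) (by rw [visitSum_succ t k (by omega)]; omega) h1 h2

theorem gapTime_of_mem_visitSet {y : Vertex d} {t : List ℕ} {X : ℕ → Vertex d}
    (hX : X ∈ visitSet C y t) {k : ℕ} (hk : k < t.length) :
    gapTime C X (k + 1) = (t[k] + 1 : ℕ) := by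
  rw [gapTime, Nat.add_sub_cancel, visitTime_of_mem_visitSet C hX hk.le,
    visitTime_of_mem_visitSet C hX hk, visitSum_succ t k hk, ← ENat.natCast_sub]
  congr 1; omega

theorem sum_gapTime_of_mem_visitSet {y : Vertex d} {t : List ℕ} {X : ℕ → Vertex d}
    (hX : X ∈ visitSet C y t) {k : ℕ} (hk : k ≤ t.length) :
    ∑ i ∈ Finset.Icc 1 k, gapTime C X i = visitSum t k := by
  induction k with
  | zero => simp [visitSum_zero]
  | succ k ih =>
    rw [Finset.sum_Icc_succ_top (by omega), ih (by omega), gapTime_of_mem_visitSet C hX hk,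
      visitSum_succ t k hk, Nat.cast_add (visitSum t k)]

/-- If the walk is in `C` at time `2 m`, then `ell` is the number of its visits up to that time,
because partial sums of the gaps are strictly increasing. -/
theorem ell_of_mem_visitSet {y : Vertex d} {t : List ℕ} {X : ℕ → Vertex d}
    (hX : X ∈ visitSet C y t) {m : ℕ} (hm : 1 ≤ m) (ht : visitSum t t.length = 2 * m) :
    ell C X m = t.length := by
  have hpos : 1 ≤ t.length := by
    rcases t with _ | ⟨n, t⟩
    · simp [visitSum] at ht; omega
    · simp
  have hmem : t.length ∈ {j : ℕ | 1 ≤ j ∧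
      ((2 * m : ℕ) : ℕ∞) ≤ ∑ k ∈ Finset.Icc 1 j, gapTime C X k} := by
    refine ⟨hpos, ?_⟩
    rw [sum_gapTime_of_mem_visitSet C hX le_rfl, ht]
  refine le_antisymm (Nat.sInf_le hmem) (le_csInf ⟨_, hmem⟩ fun j hj => ?_)
  by_contra hlt
  have h2 := hj.2
  rw [sum_gapTime_of_mem_visitSet C hX (not_le.1 hlt).le, ← ht] at h2
  have hmono : ∀ k, j + k < t.length → visitSum t (j + k) < visitSum t (j + k + 1) := by
    intro k hk
    rw [visitSum_succ t _ hk]; omega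
  have : ∀ k, j + k + 1 ≤ t.length → visitSum t j < visitSum t (j + k + 1) := by
    intro k
    induction k with
    | zero => exact fun h => hmono 0 (by omega)
    | succ k ih => exact fun h => (ih (by omega)).trans (hmono (k + 1) (by omega))
  have h3 := this (t.length - j - 1) (by omega)
  rw [show j + (t.length - j - 1) + 1 = t.length by omega] at h3
  exact absurd h2 (not_le.2 (by exact_mod_cast h3))

/-- A path that is in `C` at time `N` has a finite list of gaps that add up to `N`. -/
theorem exists_mem_visitSet (N : ℕ) (X : ℕ → Vertex d) (hX : X N ∈ C) :
    ∃ t : List ℕ, X ∈ visitSet C (X N) t ∧ visitSum t t.length = N := by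
  induction N generalizing X with
  | zero => exact ⟨[], rfl, by simp [visitSum]⟩
  | succ N ih =>
    obtain ⟨t, ht, hs⟩ := ih (pathTail X) hX
    by_cases h1 : X 1 ∈ C
    · exact ⟨0 :: t, ⟨h1, ht⟩, by simp [visitSum] at hs ⊢; omega⟩
    · rcases t with _ | ⟨n, t⟩
      · have : N = 0 := by simpa [visitSum] using hs.symm
        subst this
        exact absurd hX h1
      · exact ⟨(n + 1) :: t, ⟨h1, ht⟩, by simp [visitSum] at hs ⊢; omega⟩

theorem visitSum_ofFn {l : ℕ} (u : Fin l → ℕ) :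
    visitSum (List.ofFn u) (List.ofFn u).length = ∑ i, (u i + 1) := by
  rw [visitSum, List.take_length, List.sum_ofFn]
  simp [Finset.sum_add_distrib]

/-- The gap sequences `u₁ + 1, …, u_l + 1` which violate the trapping condition. -/
def BadGaps (r : ℕ) (θ : ℝ) {l : ℕ} (u : Fin l → ℕ) : Prop :=
  l < r ∨ θ < l ∨ (fun i => u i + 1) ∉ trapTuples l r θ

theorem exists_badGaps {ω : Env d} {α : ℝ} {r : ℕ} {θ : ℝ} {m : ℕ} (hm : 1 ≤ m)
    (h0 : (0 : Vertex d) ∈ cluster ω α) {X : ℕ → Vertex d} (hX : X (2 * m) = 0)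
    (hE : X ∉ trapEvent ω α r θ m) :
    ∃ (l : ℕ) (u : Fin l → ℕ), (∑ i, (u i + 1) = 2 * m ∧ BadGaps r θ u) ∧
      X ∈ visitSet (cluster ω α) 0 (List.ofFn u) := by
  obtain ⟨t, ht, hs⟩ := exists_mem_visitSet (cluster ω α) (2 * m) X (by rwa [hX])
  rw [hX] at ht
  have htu : t = List.ofFn t.get := (List.ofFn_get t).symm
  refine ⟨t.length, t.get, ⟨?_, ?_⟩, htu ▸ ht⟩
  · rw [← visitSum_ofFn, ← htu, hs]
  · by_contra hbad
    simp only [BadGaps, not_or, not_lt, not_not] at hbad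
    obtain ⟨h1, h2, h3⟩ := hbad
    refine hE ?_
    have hl := ell_of_mem_visitSet (cluster ω α) ht hm hs
    have main : r ≤ t.length ∧ (t.length : ℝ) ≤ θ ∧
        ∃ u ∈ trapTuples t.length r θ, ∀ k : Fin t.length,
          gapTime (cluster ω α) X ((k : ℕ) + 1) = u k :=
      ⟨h1, h2, _, h3, fun k => gapTime_of_mem_visitSet _ ht k.2⟩
    rw [← hl] at main
    exact main

open Classical in
/-- The probability that the walk returns at time `2m` without the trapping event is bounded by
the total weight of the bad gap sequences of total length `2m`. -/
theorem walkLaw_diff_trapEvent_le [NeZero d] {ω : Env d} {α : ℝ} {r : ℕ} {θ : ℝ} {m : ℕ}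
    (hm : 1 ≤ m) (h0 : (0 : Vertex d) ∈ cluster ω α) :
    walkLaw ω 0 ({X | X (2 * m) = 0} \ trapEvent ω α r θ m) ≤
      ∑' (l : ℕ) (u : Fin l → ℕ), if ∑ i, (u i + 1) = 2 * m ∧ BadGaps r θ u then
        gapsOp (transProb ω) (cluster ω α) (List.ofFn u) (Pi.single 0 1) 0 else 0 := by
  have hsub : {X | X (2 * m) = 0} \ trapEvent ω α r θ m ⊆ ⋃ (l : ℕ) (u : Fin l → ℕ),
      if ∑ i, (u i + 1) = 2 * m ∧ BadGaps r θ u then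
        visitSet (cluster ω α) 0 (List.ofFn u) else ∅ := by
    rintro X ⟨hX, hE⟩
    obtain ⟨l, u, hu, hXu⟩ := exists_badGaps hm h0 hX hE
    simp only [Set.mem_iUnion]
    exact ⟨l, u, by rwa [if_pos hu]⟩
  refine (measure_mono hsub).trans ((measure_iUnion_le _).trans ?_)
  refine ENNReal.tsum_le_tsum fun l => (measure_iUnion_le _).trans ?_
  refine ENNReal.tsum_le_tsum fun u => ?_
  split_ifs
  · rw [walkLaw_visitSet]
  · simp

/-- The coarse-grained kernel is the sum of the hitting kernels. -/
theorem coarseProb_eq_moment [NeZero d] (ω : Env d) (α : ℝ) :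
    coarseProb ω α = moment (transProb ω) (cluster ω α) 1 := by
  ext x y
  have hgap : ∀ X n, X ∈ visitSet (cluster ω α) y [n] →
      gapTime (cluster ω α) X 1 = (n + 1 : ℕ) := fun X n hX =>
    gapTime_of_mem_visitSet (cluster ω α) hX (k := 0) (by simp)
  have hset : {X | ∃ n : ℕ, gapTime (cluster ω α) X 1 = n ∧ X n = y} =
      ⋃ n : ℕ, visitSet (cluster ω α) y [n] := by
    ext X
    simp only [Set.mem_ofPred_eq, Set.mem_iUnion]
    constructor
    · rintro ⟨n, hn, hy⟩
      by_cases hex : ∃ b, 0 < b ∧ X b ∈ cluster ω α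
      · classical
        obtain ⟨hb0, hbC⟩ := Nat.find_spec hex
        set b := Nat.find hex with hb
        have hmin : ∀ i, 0 < i → i < b → X i ∉ cluster ω α := fun i hi hib hiC =>
          Nat.find_min hex hib ⟨hi, hiC⟩
        have hv : visitTime (cluster ω α) X 1 = b :=
          visitTime_succ_eq (cluster ω α) (a := 0) (by simp [visitTime]) hb0 hbC hmin
        have hnb : n = b := by
          have : gapTime (cluster ω α) X 1 = b := by
            rw [gapTime, hv]; simp [visitTime]
          rw [this] at hn
          exact_mod_cast hn.symm
        obtain ⟨k, hk⟩ := Nat.exists_eq_succ_of_ne_zero hb0.ne'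
        refine ⟨k, (mem_afterHit_iff _).2 ⟨fun i hi hi' => hmin i hi (by omega), ?_, ?_⟩⟩
        · rwa [hk] at hbC
        · rw [hnb, hk] at hy
          exact hy
      · have : gapTime (cluster ω α) X 1 = ⊤ := by
          have : visitTime (cluster ω α) X 1 = ⊤ := by
            simp only [visitTime, iInf_eq_top]
            rintro i ⟨hi, hiC⟩
            exact absurd ⟨i, by exact_mod_cast hi, hiC⟩ hex
          rw [gapTime, this]; simp [visitTime]
        rw [this] at hn
        exact absurd hn (ENat.top_ne_natCast n)
    · rintro ⟨n, hX⟩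
      exact ⟨n + 1, hgap X n hX, ((mem_afterHit_iff _).1 hX).2.2⟩
  rw [coarseProb, hset, measure_iUnion, moment]
  · refine tsum_congr fun n => ?_
    rw [walkLaw_visitSet, gapsOp_cons, opMul_apply]
    simp [gapsOp, kernelOp_single]
  · intro n m hnm
    refine Set.disjoint_left.2 fun X hn hm => hnm ?_
    have := (hgap X n hn).symm.trans (hgap X m hm)
    exact Nat.succ_injective (by exact_mod_cast this)
  · exact fun n => measurableSet_visitSet _ y [n]

end Visits


/-! ### Summation over gap sequences -/

section Tuples

/-- The `j`-th elementary symmetric polynomial of the entries of a tuple. -/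
def tupleEsymm {l : ℕ} (j : ℕ) (t : Fin l → ℕ) : ℕ :=
  ∑ S ∈ Finset.powersetCard j Finset.univ, ∏ i ∈ S, t i

theorem tupleEsymm_eq_esymm {l : ℕ} (j : ℕ) (t : Fin l → ℕ) :
    tupleEsymm j t = (List.ofFn t : Multiset ℕ).esymm j := by
  rw [← Fin.univ_val_map, Finset.esymm_map_val, tupleEsymm]

theorem tupleEsymm_zero {l : ℕ} (t : Fin l → ℕ) : tupleEsymm 0 t = 1 := by simp [tupleEsymm]

theorem tupleEsymm_one {l : ℕ} (t : Fin l → ℕ) : tupleEsymm 1 t = ∑ i, t i := by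
  simp [tupleEsymm, Finset.powersetCard_one]

theorem tupleEsymm_fin_zero (j : ℕ) (t : Fin 0 → ℕ) : tupleEsymm (j + 1) t = 0 := by
  rw [tupleEsymm, Finset.powersetCard_eq_empty.2 (by simp), Finset.sum_empty]

theorem tupleEsymm_cons {l : ℕ} (j n : ℕ) (t : Fin l → ℕ) :
    tupleEsymm (j + 1) (Fin.cons n t : Fin (l + 1) → ℕ) =
      n * tupleEsymm j t + tupleEsymm (j + 1) t := by
  simp only [tupleEsymm_eq_esymm, List.ofFn_cons, ← Multiset.cons_coe]
  simp only [Multiset.esymm, Multiset.powersetCard_cons, Multiset.map_add, Multiset.sum_add,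
    Multiset.map_map, Function.comp_def, Multiset.prod_cons, Multiset.sum_map_mul_left]
  ring

/-- Each subset of size `j + 1` arises from `j + 1` subsets of size `j` by adding an index. -/
theorem succ_mul_tupleEsymm_succ {l : ℕ} (j : ℕ) (t : Fin l → ℕ) :
    (j + 1) * tupleEsymm (j + 1) t =
      ∑ S ∈ Finset.powersetCard j Finset.univ, (∏ i ∈ S, t i) * ∑ k ∈ Sᶜ, t k := by
  have h1 : (j + 1) * tupleEsymm (j + 1) t =
      ∑ S ∈ Finset.powersetCard (j + 1) Finset.univ, ∑ _k ∈ S, ∏ i ∈ S, t i := by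
    rw [tupleEsymm, Finset.mul_sum]
    refine Finset.sum_congr rfl fun S hS => ?_
    rw [Finset.sum_const, (Finset.mem_powersetCard.1 hS).2, smul_eq_mul]
  rw [h1]
  simp only [Finset.mul_sum]
  rw [Finset.sum_sigma', Finset.sum_sigma']
  refine Finset.sum_bij' (fun x _ => ⟨x.1.erase x.2, x.2⟩) (fun x _ => ⟨insert x.2 x.1, x.2⟩)
    ?_ ?_ ?_ ?_ ?_
  · rintro ⟨S, k⟩ h
    simp only [Finset.mem_sigma, Finset.mem_powersetCard] at h ⊢
    refine ⟨⟨Finset.subset_univ _, ?_⟩, by simp⟩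
    rw [Finset.card_erase_of_mem h.2, h.1.2]; rfl
  · rintro ⟨S, k⟩ h
    simp only [Finset.mem_sigma, Finset.mem_powersetCard, Finset.mem_compl] at h ⊢
    refine ⟨⟨Finset.subset_univ _, ?_⟩, by simp⟩
    rw [Finset.card_insert_of_notMem h.2, h.1.2]
  · rintro ⟨S, k⟩ h
    simp only [Finset.mem_sigma] at h
    simp [Finset.insert_erase h.2]
  · rintro ⟨S, k⟩ h
    simp only [Finset.mem_sigma, Finset.mem_compl] at h
    simp [Finset.erase_insert h.2]
  · rintro ⟨S, k⟩ h
    simp only [Finset.mem_sigma] at h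
    exact (Finset.prod_erase_mul S t h.2).symm

/-- If the entries of `t` outside any `r` indices add up to more than `θ`, then the elementary
symmetric polynomial of degree `r + 1` is at least of order `θ ^ r` times the total sum. -/
theorem pow_mul_sum_le_tupleEsymm {l r : ℕ} {θ : ℝ} (hθ : 0 ≤ θ) (hr : r ≤ l) (t : Fin l → ℕ)
    (ht : t ∉ trapTuples l r θ) :
    θ ^ r * (∑ i, t i : ℕ) ≤ (r + 1).factorial * tupleEsymm (r + 1) t := by
  have hS : ∀ S : Finset (Fin l), S.card ≤ r → θ ≤ (∑ k ∈ Sᶜ, t k : ℕ) := by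
    intro S hS
    obtain ⟨I, hSI, hI⟩ := Finset.exists_superset_card_eq (n := r) hS (by simpa using hr)
    by_contra hlt
    refine ht ⟨I, hI, ?_⟩
    have : (∑ k ∈ Iᶜ, t k : ℕ) ≤ ∑ k ∈ Sᶜ, t k :=
      Finset.sum_le_sum_of_subset (Finset.compl_subset_compl.2 hSI)
    have h2 : ((∑ k ∈ Iᶜ, t k : ℕ) : ℝ) ≤ (∑ k ∈ Sᶜ, t k : ℕ) := by exact_mod_cast this
    push_cast at h2 hlt ⊢
    linarith
  suffices ∀ j ≤ r, θ ^ j * (∑ i, t i : ℕ) ≤ (j + 1).factorial * tupleEsymm (j + 1) t from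
    this r le_rfl
  intro j
  induction j with
  | zero => intro _; simp [tupleEsymm_one]
  | succ j ih =>
    intro hj
    have h1 : θ * tupleEsymm (j + 1) t ≤ ((j + 1 : ℕ) + 1) * tupleEsymm (j + 1 + 1) t := by
      have h2 := succ_mul_tupleEsymm_succ (j + 1) t
      have h3 : (((j + 1 : ℕ) + 1) * tupleEsymm (j + 1 + 1) t : ℝ) =
          ∑ S ∈ Finset.powersetCard (j + 1) Finset.univ, ((∏ i ∈ S, t i : ℕ) : ℝ) *
            (∑ k ∈ Sᶜ, t k : ℕ) := by
        exact_mod_cast h2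
      rw [h3, tupleEsymm, Nat.cast_sum, Finset.mul_sum]
      refine Finset.sum_le_sum fun S hSm => ?_
      rw [mul_comm]
      exact mul_le_mul_of_nonneg_left (hS S ((Finset.mem_powersetCard.1 hSm).2.le.trans hj))
        (Nat.cast_nonneg _)
    calc θ ^ (j + 1) * (∑ i, t i : ℕ) = θ * (θ ^ j * (∑ i, t i : ℕ)) := by ring
      _ ≤ θ * ((j + 1).factorial * tupleEsymm (j + 1) t) :=
          mul_le_mul_of_nonneg_left (ih (by omega)) hθ
      _ = (j + 1).factorial * (θ * tupleEsymm (j + 1) t) := by ring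
      _ ≤ (j + 1).factorial * (((j + 1 : ℕ) + 1) * tupleEsymm (j + 1 + 1) t) :=
          mul_le_mul_of_nonneg_left h1 (Nat.cast_nonneg _)
      _ = _ := by rw [Nat.factorial_succ (j + 1)]; push_cast; ring

variable {V : Type*} (p : V → V → ℝ≥0∞) (C : Set V)

theorem tsum_fin_succ {l : ℕ} (f : (Fin (l + 1) → ℕ) → ℝ≥0∞) :
    ∑' u, f u = ∑' (n : ℕ) (u : Fin l → ℕ), f (Fin.cons n u) := by
  rw [← (Fin.consEquiv fun _ : Fin (l + 1) => ℕ).tsum_eq f, ENNReal.tsum_prod']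
  rfl

theorem mul_kernelOp_eq_tsum {ι : Type*} (k : V → V → ℝ≥0∞) (c : ℝ≥0∞) (a : ι → ℝ≥0∞)
    (G : ι → V → ℝ≥0∞) {h : V → ℝ≥0∞} (hh : ∀ y, ∑' i, a i * G i y = h y) (x : V) :
    c * kernelOp k h x = ∑' i, c * (a i * kernelOp k (G i) x) := by
  rw [← funext hh, kernelOp_tsum, ENNReal.tsum_mul_left]
  simp only [kernelOp_const_mul]

/-- Weighting gap sequences by a product over the gaps amounts to weighting each hitting kernel. -/
theorem tsum_gapsOp_prod (φ : ℕ → ℝ≥0∞) (l : ℕ) (g : V → ℝ≥0∞) (x : V) :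
    ∑' u : Fin l → ℕ, (∏ i, φ (u i)) * gapsOp p C (List.ofFn u) g x =
      (kernelOp (moment p C φ) ^ l) g x := by
  induction l generalizing x with
  | zero => simp [gapsOp]
  | succ l ih =>
    rw [tsum_fin_succ, pow_succ', opMul_apply, kernelOp_moment_apply]
    refine tsum_congr fun n => ?_
    rw [mul_kernelOp_eq_tsum _ _ _ _ ih]
    refine tsum_congr fun u => ?_
    rw [Fin.prod_univ_succ, List.ofFn_cons, gapsOp_cons, opMul_apply]
    simp [mul_assoc]

/-- Weighting gap sequences by an elementary symmetric polynomial amounts to inserting the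
first-moment kernel at the chosen positions. -/
theorem tsum_gapsOp_esymm (l j : ℕ) (g : V → ℝ≥0∞) (x : V) :
    ∑' u : Fin l → ℕ, (tupleEsymm j (fun i => u i + 1) : ℝ≥0∞) * gapsOp p C (List.ofFn u) g x =
      words (kernelOp (moment p C 1)) (kernelOp (moment p C fun n => n + 1)) l j g x := by
  induction l generalizing j x with
  | zero =>
    cases j with
    | zero => simp [gapsOp, tupleEsymm_zero, words_zero_zero]
    | succ j => simp [tupleEsymm_fin_zero, words_zero_succ]
  | succ l ih =>
    cases j with
    | zero =>
      rw [words_zero_right, ← tsum_gapsOp_prod]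
      simp [tupleEsymm_zero]
    | succ j =>
      rw [tsum_fin_succ, words_succ_succ, opAdd_apply, Pi.add_apply, opMul_apply, opMul_apply,
        kernelOp_moment_apply, kernelOp_moment_apply, ← ENNReal.tsum_add]
      refine tsum_congr fun n => ?_
      have hcons : ∀ u : Fin l → ℕ, (fun i => (Fin.cons n u : Fin (l + 1) → ℕ) i + 1) =
          (Fin.cons (n + 1) (fun i => u i + 1) : Fin (l + 1) → ℕ) := by
        intro u; ext i; refine Fin.cases ?_ (fun i => ?_) i <;> simp
      rw [mul_kernelOp_eq_tsum _ _ _ _ (ih j), mul_kernelOp_eq_tsum _ _ _ _ (ih (j + 1)),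
        ← ENNReal.tsum_add]
      refine tsum_congr fun u => ?_
      simp only [hcons, tupleEsymm_cons, List.ofFn_cons, gapsOp_cons,
        opMul_apply, Pi.one_apply, one_mul]
      push_cast
      ring

end Tuples


/-! ### Measurability and shift covariance -/

section Covariance

variable {d : ℕ}

/-- A random function on the lattice which is measurable in the environment and moves along with
it under shifts. -/
structure IsCov (u : Env d → Vertex d → ℝ≥0∞) : Prop where
  meas : ∀ x, Measurable fun ω => u ω x
  cov : ∀ z ω x, u (shift z ω) x = u ω (x + z)

/-- A random kernel on the lattice which is measurable in the environment and moves along with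
it under shifts. -/
structure IsCovKernel (k : Env d → Vertex d → Vertex d → ℝ≥0∞) : Prop where
  meas : ∀ x y, Measurable fun ω => k ω x y
  cov : ∀ z ω x y, k (shift z ω) x y = k ω (x + z) (y + z)

theorem IsCov.const (c : ℝ≥0∞) : IsCov (d := d) fun _ _ => c :=
  ⟨fun _ => measurable_const, fun _ _ _ => rfl⟩

theorem IsCov.mul {u v : Env d → Vertex d → ℝ≥0∞} (hu : IsCov u) (hv : IsCov v) :
    IsCov fun ω x => u ω x * v ω x :=
  ⟨fun x => (hu.meas x).mul (hv.meas x), fun z ω x => by rw [hu.cov, hv.cov]⟩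

theorem IsCov.add {u v : Env d → Vertex d → ℝ≥0∞} (hu : IsCov u) (hv : IsCov v) :
    IsCov fun ω x => u ω x + v ω x :=
  ⟨fun x => (hu.meas x).add (hv.meas x), fun z ω x => by rw [hu.cov, hv.cov]⟩

theorem IsCov.sub {u v : Env d → Vertex d → ℝ≥0∞} (hu : IsCov u) (hv : IsCov v) :
    IsCov fun ω x => u ω x - v ω x :=
  ⟨fun x => (hu.meas x).sub (hv.meas x), fun z ω x => by rw [hu.cov, hv.cov]⟩

theorem IsCov.pow {u : Env d → Vertex d → ℝ≥0∞} (hu : IsCov u) (n : ℕ) :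
    IsCov fun ω x => u ω x ^ n :=
  ⟨fun x => (hu.meas x).pow_const n, fun z ω x => by rw [hu.cov]⟩

theorem IsCov.iSup {ι : Type*} [Countable ι] {u : ι → Env d → Vertex d → ℝ≥0∞}
    (hu : ∀ i, IsCov (u i)) : IsCov fun ω x => ⨆ i, u i ω x :=
  ⟨fun x => Measurable.iSup fun i => (hu i).meas x,
    fun z ω x => iSup_congr fun i => (hu i).cov z ω x⟩

theorem IsCovKernel.mul {k k' : Env d → Vertex d → Vertex d → ℝ≥0∞} (hk : IsCovKernel k)
    (hk' : IsCovKernel k') : IsCovKernel fun ω x y => k ω x y * k' ω x y :=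
  ⟨fun x y => (hk.meas x y).mul (hk'.meas x y), fun z ω x y => by rw [hk.cov, hk'.cov]⟩

theorem IsCov.kernel {u : Env d → Vertex d → ℝ≥0∞} (hu : IsCov u) :
    IsCovKernel fun ω _ y => u ω y :=
  ⟨fun _ y => hu.meas y, fun z ω _ y => hu.cov z ω y⟩

theorem IsCovKernel.comp {k k' : Env d → Vertex d → Vertex d → ℝ≥0∞} (hk : IsCovKernel k)
    (hk' : IsCovKernel k') : IsCovKernel fun ω x y => ∑' z, k ω x z * k' ω z y := by
  refine ⟨fun x y => Measurable.tsum fun z => (hk.meas x z).mul (hk'.meas z y),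
    fun z ω x y => ?_⟩
  rw [← (Equiv.addRight z).tsum_eq fun a => k ω (x + z) a * k' ω a (y + z)]
  exact tsum_congr fun a => by rw [hk.cov, hk'.cov]; rfl

theorem IsCovKernel.tsum_const_mul {k : ℕ → Env d → Vertex d → Vertex d → ℝ≥0∞}
    (hk : ∀ n, IsCovKernel (k n)) (φ : ℕ → ℝ≥0∞) :
    IsCovKernel fun ω x y => ∑' n, φ n * k n ω x y :=
  ⟨fun x y => Measurable.tsum fun n => ((hk n).meas x y).const_mul _,
    fun z ω x y => tsum_congr fun n => by rw [(hk n).cov]⟩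

theorem IsCovKernel.op {k : Env d → Vertex d → Vertex d → ℝ≥0∞} (hk : IsCovKernel k)
    {u : Env d → Vertex d → ℝ≥0∞} (hu : IsCov u) : IsCov fun ω => kernelOp (k ω) (u ω) := by
  refine ⟨fun x => Measurable.tsum fun z => (hk.meas x z).mul (hu.meas z),
    fun z ω x => ?_⟩
  rw [kernelOp_apply, kernelOp_apply, ← (Equiv.addRight z).tsum_eq fun a => k ω (x + z) a * u ω a]
  exact tsum_congr fun a => by rw [hk.cov, hu.cov]; rfl

/-- The indicator function of a random set, as a random function. -/
theorem isCov_indicator {S : Env d → Set (Vertex d)} (hm : ∀ x, MeasurableSet {ω | x ∈ S ω})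
    (hc : ∀ z ω x, x ∈ S (shift z ω) ↔ x + z ∈ S ω) :
    IsCov fun ω => (S ω).indicator (1 : Vertex d → ℝ≥0∞) := by
  classical
  refine ⟨fun x => ?_, fun z ω x => ?_⟩
  · simp only [Set.indicator_apply]
    exact Measurable.ite (hm x) measurable_const measurable_const
  · simp [Set.indicator_apply, hc]

/-! ### Measurability and covariance of the conductances and the cluster -/

theorem lattice_adj_add (x y z : Vertex d) :
    (lattice d).Adj (x + z) (y + z) ↔ (lattice d).Adj x y := by simp [lattice]

theorem conductance_shift (z : Vertex d) (ω : Env d) (x y : Vertex d) :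
    conductance (shift z ω) x y = conductance ω (x + z) (y + z) := by
  unfold conductance
  by_cases h : (lattice d).Adj x y
  · rw [dif_pos h, dif_pos ((lattice_adj_add x y z).2 h)]; rfl
  · rw [dif_neg h, dif_neg (mt (lattice_adj_add x y z).1 h)]

theorem conductance_comm (ω : Env d) (x y : Vertex d) : conductance ω x y = conductance ω y x := by
  unfold conductance
  by_cases h : (lattice d).Adj x y
  · rw [dif_pos h, dif_pos h.symm]; congr 2; simp [Sym2.eq_swap]
  · rw [dif_neg h, dif_neg (mt SimpleGraph.Adj.symm h)]

theorem conductance_le_one (ω : Env d) (x y : Vertex d) : conductance ω x y ≤ 1 := by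
  unfold conductance
  split_ifs with h
  · exact (ω ⟨s(x, y), h⟩).2.2
  · exact zero_le_one

theorem conductance_pos {ω : Env d} {x y : Vertex d} (h : (lattice d).Adj x y) :
    0 < conductance ω x y := by
  rw [conductance, dif_pos h]; exact (ω ⟨s(x, y), h⟩).2.1

theorem measurable_conductance (x y : Vertex d) : Measurable fun ω : Env d => conductance ω x y := by
  unfold conductance
  by_cases h : (lattice d).Adj x y
  · simp only [dif_pos h]
    exact measurable_subtype_coe.comp (measurable_pi_apply _)
  · simp only [dif_neg h]
    exact measurable_const

theorem weight_shift (z : Vertex d) (ω : Env d) (x : Vertex d) :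
    weight (shift z ω) x = weight ω (x + z) := by
  unfold weight
  refine Finset.sum_equiv (Equiv.addRight z) (fun y => ?_) fun y _ => conductance_shift z ω x y
  simp [lattice_adj_add]

theorem measurable_weight (x : Vertex d) : Measurable fun ω : Env d => weight ω x :=
  Finset.measurable_sum _ fun y _ => measurable_conductance x y

theorem isCovKernel_transProb : IsCovKernel (transProb (d := d)) := by
  refine ⟨fun x y => ?_, fun z ω x y => ?_⟩
  · exact ((measurable_conductance x y).div (measurable_weight x)).ennreal_ofReal
  · rw [transProb, transProb, conductance_shift, weight_shift]

theorem mem_Icc_of_adj {x y : Vertex d} (h : (lattice d).Adj x y) : y ∈ Set.Icc (x - 1) (x + 1) := by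
  have hy' : ∑ i, |x i - y i| = 1 := h
  have key : ∀ i, |x i - y i| ≤ 1 := fun i => hy' ▸
    Finset.single_le_sum (f := fun i => |x i - y i|) (fun _ _ => abs_nonneg _) (Finset.mem_univ i)
  constructor <;> intro i <;> have := abs_le.mp (key i) <;> simp <;> omega

theorem card_neighborFinset_le (x : Vertex d) : ((lattice d).neighborFinset x).card ≤ 3 ^ d := by
  have h : (lattice d).neighborFinset x ⊆ Finset.Icc (x - 1) (x + 1) := by
    intro y hy
    simpa using mem_Icc_of_adj ((SimpleGraph.mem_neighborFinset _ _ _).1 hy)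
  refine (Finset.card_le_card h).trans ?_
  rw [Pi.card_Icc]
  refine (Finset.prod_le_pow_card _ _ 3 fun i _ => ?_).trans (by simp)
  simp only [Int.card_Icc, Pi.add_apply, Pi.sub_apply, Pi.one_apply]
  omega

theorem weight_le (ω : Env d) (x : Vertex d) : weight ω x ≤ 3 ^ d := by
  refine (Finset.sum_le_card_nsmul _ _ 1 fun y _ => conductance_le_one ω x y).trans ?_
  rw [nsmul_eq_mul, mul_one]
  exact_mod_cast card_neighborFinset_le x

/-- The first `n` steps of `q` form a self-avoiding path of strong edges from `x`. -/
def StrongPath (ω : Env d) (α : ℝ) (x : Vertex d) (n : ℕ) (q : ℕ → Vertex d) : Prop :=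
  q 0 = x ∧ (∀ i < n, (lattice d).Adj (q i) (q (i + 1)) ∧ α ≤ conductance ω (q i) (q (i + 1))) ∧
    ∀ i ≤ n, ∀ j ≤ n, q i = q j → i = j

theorem StrongPath.congr {ω : Env d} {α : ℝ} {x : Vertex d} {n : ℕ} {q q' : ℕ → Vertex d}
    (h : StrongPath ω α x n q) (hq : ∀ i ≤ n, q' i = q i) : StrongPath ω α x n q' := by
  obtain ⟨h1, h2, h3⟩ := h
  refine ⟨by rw [hq 0 (by omega), h1], fun i hi => ?_, fun i hi j hj => ?_⟩
  · rw [hq i hi.le, hq (i + 1) hi]; exact h2 i hi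
  · rw [hq i hi, hq j hj]; exact h3 i hi j hj

theorem StrongPath.mono {ω : Env d} {α : ℝ} {x : Vertex d} {n m : ℕ} {q : ℕ → Vertex d}
    (h : StrongPath ω α x n q) (hm : m ≤ n) : StrongPath ω α x m q :=
  ⟨h.1, fun i hi => h.2.1 i (by omega), fun i hi j hj => h.2.2 i (by omega) j (by omega)⟩

theorem StrongPath.mem_Icc {ω : Env d} {α : ℝ} {x : Vertex d} {n : ℕ} {q : ℕ → Vertex d}
    (h : StrongPath ω α x n q) (i : ℕ) (hi : i ≤ n) :
    q i ∈ Set.Icc (x - fun _ => (i : ℤ)) (x + fun _ => (i : ℤ)) := by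
  induction i with
  | zero => rw [h.1]; constructor <;> intro k <;> simp
  | succ i ih =>
    have h1 := ih (by omega)
    have h2 := mem_Icc_of_adj (h.2.1 i (by omega)).1
    constructor <;> intro k
    · have a := h1.1 k; have b := h2.1 k
      simp at a b ⊢; omega
    · have a := h1.2 k; have b := h2.2 k
      simp at a b ⊢; omega

/-- A set of paths that depends on finitely many coordinates is closed for the product of the
discrete topologies. -/
theorem isClosed_coords (n : ℕ) (s : Set (ℕ → Vertex d))
    (hs : ∀ q ∈ s, ∀ q', (∀ i ≤ n, q' i = q i) → q' ∈ s) : IsClosed s := by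
  rw [← isOpen_compl_iff, isOpen_pi_iff]
  intro q hq
  refine ⟨Finset.Iic n, fun i => {q i}, fun i _ => ⟨isOpen_discrete _, rfl⟩, ?_⟩
  intro q' hq' hmem
  exact hq (hs q' hmem q fun i hi => (hq' i (by simpa using hi)).symm)

/-- Kőnig's lemma: a vertex belongs to the strong cluster if and only if it is the start of
arbitrarily long self-avoiding paths of strong edges. -/
theorem mem_cluster_iff {ω : Env d} {α : ℝ} {x : Vertex d} :
    x ∈ cluster ω α ↔ ∀ n, ∃ q, StrongPath ω α x n q := by
  constructor
  · rintro ⟨γ, hinj, hγ, k, rfl⟩ n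
    exact ⟨fun i => γ (k + i), rfl, fun i _ => hγ (k + i),
      fun i _ j _ hij => by have := hinj hij; omega⟩
  · intro h
    -- the paths in the product `K` of finite boxes form a compact set, and the nested sets `A n` are
    -- closed and nonempty
    let K : Set (ℕ → Vertex d) :=
      Set.univ.pi fun i => Set.Icc (x - fun _ => (i : ℤ)) (x + fun _ => (i : ℤ))
    have hK : IsCompact K := isCompact_univ_pi fun i => (Set.finite_Icc _ _).isCompact
    let A : ℕ → Set (ℕ → Vertex d) := fun n => {q | q ∈ K ∧ StrongPath ω α x n q}
    have hcl : ∀ n, IsClosed (A n) := fun n =>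
      hK.isClosed.inter (isClosed_coords n {q | StrongPath ω α x n q}
        fun q hq q' hq' => StrongPath.congr hq hq')
    have hne : ∀ n, (A n).Nonempty := by
      intro n
      obtain ⟨q, hq⟩ := h n
      refine ⟨fun i => q (min i n), fun i _ => ?_, hq.congr fun i hi => by simp [hi]⟩
      have := hq.mem_Icc (min i n) (min_le_right _ _)
      have hle : ((min i n : ℕ) : ℤ) ≤ i := by exact_mod_cast min_le_left i n
      refine Set.Icc_subset_Icc (fun k => ?_) (fun k => ?_) this
      · exact sub_le_sub_left hle _
      · exact add_le_add_right hle _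
    obtain ⟨γ, hγ⟩ := IsCompact.nonempty_iInter_of_sequence_nonempty_isCompact_isClosed A
      (fun n q hq => ⟨hq.1, hq.2.mono (Nat.le_succ n)⟩) hne
      (hK.of_isClosed_subset (hcl 0) fun q hq => hq.1) hcl
    have hγ' : ∀ n, StrongPath ω α x n γ := fun n => (Set.mem_iInter.1 hγ n).2
    exact ⟨γ, fun i j hij => (hγ' (max i j)).2.2 i (le_max_left _ _) j (le_max_right _ _) hij,
      fun k => (hγ' (k + 1)).2.1 k (Nat.lt_succ_self k), 0, (hγ' 0).1⟩

theorem measurableSet_mem_cluster (α : ℝ) (x : Vertex d) :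
    MeasurableSet {ω : Env d | x ∈ cluster ω α} := by
  have hset : {ω : Env d | x ∈ cluster ω α} = ⋂ n : ℕ, ⋃ q : Fin (n + 1) → Vertex d,
      {ω | StrongPath ω α x n fun i => q (Fin.ofNat (n + 1) i)} := by
    ext ω
    simp only [Set.mem_ofPred_eq, mem_cluster_iff, Set.mem_iInter, Set.mem_iUnion]
    refine forall_congr' fun n => ⟨?_, ?_⟩
    · rintro ⟨q, hq⟩
      refine ⟨fun i => q i, hq.congr fun i hi => ?_⟩
      simp [Fin.ofNat, Nat.mod_eq_of_lt (Nat.lt_succ_of_le hi)]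
    · rintro ⟨q, hq⟩
      exact ⟨_, hq⟩
  rw [hset]
  refine MeasurableSet.iInter fun n => MeasurableSet.iUnion fun q => ?_
  have hsteps : MeasurableSet {ω : Env d | ∀ i < n,
      (lattice d).Adj (q (Fin.ofNat (n + 1) i)) (q (Fin.ofNat (n + 1) (i + 1))) ∧
      α ≤ conductance ω (q (Fin.ofNat (n + 1) i)) (q (Fin.ofNat (n + 1) (i + 1)))} := by
    simp only [Set.ofPred_forall, Set.ofPred_and]
    exact MeasurableSet.iInter fun i => MeasurableSet.iInter fun _ =>
      (MeasurableSet.const _).inter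
        (measurableSet_le measurable_const (measurable_conductance _ _))
  exact (MeasurableSet.const _).inter (hsteps.inter (MeasurableSet.const _))

theorem mem_cluster_shift (α : ℝ) (z : Vertex d) (ω : Env d) (x : Vertex d) :
    x ∈ cluster (shift z ω) α ↔ x + z ∈ cluster ω α := by
  have key : ∀ (z : Vertex d) (ω : Env d) (x : Vertex d),
      x ∈ cluster (shift z ω) α → x + z ∈ cluster ω α := by
    rintro z ω x ⟨γ, hinj, hγ, k, rfl⟩
    refine ⟨fun i => γ i + z, fun i j hij => hinj (add_right_cancel hij), fun i => ?_, k, rfl⟩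
    rw [lattice_adj_add, ← conductance_shift]
    exact hγ i
  have hinv : shift (-z) (shift z ω) = ω := by
    ext ⟨e, he⟩
    induction e with
    | h a b => simp [shift, Sym2.map_mk]
  refine ⟨key z ω x, fun h => ?_⟩
  rw [← hinv] at h
  simpa using key (-z) (shift z ω) (x + z) h

theorem isCov_indicator_cluster (α : ℝ) :
    IsCov fun ω : Env d => (cluster ω α).indicator (1 : Vertex d → ℝ≥0∞) :=
  isCov_indicator (measurableSet_mem_cluster α) (mem_cluster_shift α)

theorem isCov_indicator_compl_cluster (α : ℝ) :
    IsCov fun ω : Env d => (cluster ω α)ᶜ.indicator (1 : Vertex d → ℝ≥0∞) :=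
  isCov_indicator (fun x => (measurableSet_mem_cluster α x).compl)
    (fun z ω x => not_congr (mem_cluster_shift α z ω x))

theorem isCovKernel_killed (α : ℝ) :
    IsCovKernel fun ω : Env d => killed (transProb ω) (cluster ω α) :=
  isCovKernel_transProb.mul (isCov_indicator_compl_cluster α).kernel

theorem isCovKernel_entry (α : ℝ) :
    IsCovKernel fun ω : Env d => entry (transProb ω) (cluster ω α) :=
  isCovKernel_transProb.mul (isCov_indicator_cluster α).kernel

theorem isCovKernel_hit (α : ℝ) (n : ℕ) :
    IsCovKernel fun ω : Env d => hit (transProb ω) (cluster ω α) n := by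
  induction n with
  | zero => exact isCovKernel_entry α
  | succ n ih => exact (isCovKernel_killed α).comp ih

theorem isCovKernel_moment (α : ℝ) (φ : ℕ → ℝ≥0∞) :
    IsCovKernel fun ω : Env d => moment (transProb ω) (cluster ω α) φ :=
  IsCovKernel.tsum_const_mul (isCovKernel_hit α) φ

/-! ### The weak components -/

/-- `z` can be reached from `y` in `n` lattice steps between vertices outside `C`. -/
def Reach (C : Set (Vertex d)) : ℕ → Vertex d → Vertex d → Prop
  | 0, y, z => y = z
  | n + 1, y, z => ∃ y', ((lattice d).Adj y y' ∧ y ∉ C ∧ y' ∉ C) ∧ Reach C n y' z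

theorem mem_weakComponent_iff {ω : Env d} {α : ℝ} {y z : Vertex d} :
    z ∈ weakComponent ω α y ↔ ∃ n, Reach (cluster ω α) n y z := by
  constructor
  · rintro (rfl | ⟨hy, hz, ⟨w⟩⟩)
    · exact ⟨0, rfl⟩
    · have key : ∀ {a b : ((cluster ω α)ᶜ : Set (Vertex d))},
          ((lattice d).induce (cluster ω α)ᶜ).Walk a b →
          ∃ n, Reach (cluster ω α) n (a : Vertex d) b := by
        intro a b w
        induction w with
        | nil => exact ⟨0, rfl⟩
        | @cons u v w h _ ih =>
          obtain ⟨n, hn⟩ := ih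
          exact ⟨n + 1, v, ⟨h, u.2, v.2⟩, hn⟩
      exact key w
  · rintro ⟨n, hn⟩
    induction n generalizing y with
    | zero => exact Or.inl hn.symm
    | succ n ih =>
      obtain ⟨y', ⟨hadj, hy, hy'⟩, hr⟩ := hn
      rcases ih hr with rfl | ⟨h1, h2, h3⟩
      · exact Or.inr ⟨hy, hy', SimpleGraph.Adj.reachable (by simpa using hadj)⟩
      · refine Or.inr ⟨hy, h2, SimpleGraph.Reachable.trans (v := ⟨y', h1⟩)
          (SimpleGraph.Adj.reachable (by simpa using hadj)) h3⟩

theorem reach_shift (α : ℝ) (z : Vertex d) (ω : Env d) (n : ℕ) (x y : Vertex d) :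
    Reach (cluster (shift z ω) α) n x y ↔ Reach (cluster ω α) n (x + z) (y + z) := by
  induction n generalizing x with
  | zero => simp [Reach]
  | succ n ih =>
    simp only [Reach]
    rw [← (Equiv.addRight z).exists_congr_right (q := fun a => ((lattice d).Adj (x + z) a ∧
      x + z ∉ cluster ω α ∧ a ∉ cluster ω α) ∧ Reach (cluster ω α) n a (y + z))]
    refine exists_congr fun a => ?_
    rw [ih, mem_cluster_shift, mem_cluster_shift]
    simp [lattice_adj_add]

theorem measurableSet_reach (α : ℝ) (n : ℕ) (x y : Vertex d) :
    MeasurableSet {ω : Env d | Reach (cluster ω α) n x y} := by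
  induction n generalizing x with
  | zero => exact MeasurableSet.const _
  | succ n ih =>
    simp only [Reach, Set.ofPred_exists]
    exact MeasurableSet.iUnion fun a => ((MeasurableSet.const _).inter
      ((measurableSet_mem_cluster α x).compl.inter (measurableSet_mem_cluster α a).compl)).inter
        (ih a)

theorem mem_weakNeighborhood_iff {ω : Env d} {α : ℝ} {x z : Vertex d} :
    z ∈ weakNeighborhood ω α x ↔
      ∃ y, (lattice d).Adj x y ∧ ∃ n, Reach (cluster ω α) n y z := by
  simp [weakNeighborhood, mem_weakComponent_iff]

theorem mem_weakNeighborhood_shift (α : ℝ) (z : Vertex d) (ω : Env d) (x y : Vertex d) :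
    y ∈ weakNeighborhood (shift z ω) α x ↔ y + z ∈ weakNeighborhood ω α (x + z) := by
  rw [mem_weakNeighborhood_iff, mem_weakNeighborhood_iff,
    ← (Equiv.addRight z).exists_congr_right (q := fun a => (lattice d).Adj (x + z) a ∧
      ∃ n, Reach (cluster ω α) n a (y + z))]
  refine exists_congr fun a => ?_
  simp [lattice_adj_add, reach_shift]

theorem measurableSet_mem_weakNeighborhood (α : ℝ) (x y : Vertex d) :
    MeasurableSet {ω : Env d | y ∈ weakNeighborhood ω α x} := by
  simp only [mem_weakNeighborhood_iff, Set.ofPred_exists, Set.ofPred_and]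
  exact MeasurableSet.iUnion fun a => (MeasurableSet.const _).inter
    (MeasurableSet.iUnion fun n => measurableSet_reach α n a y)

/-- The kernel `1{y ∈ 𝒢_x}`. -/
def nbhdKernel (ω : Env d) (α : ℝ) (x y : Vertex d) : ℝ≥0∞ :=
  (weakNeighborhood ω α x).indicator 1 y

theorem isCovKernel_nbhdKernel (α : ℝ) : IsCovKernel fun ω : Env d => nbhdKernel ω α := by
  classical
  refine ⟨fun x y => ?_, fun z ω x y => ?_⟩
  · simp only [nbhdKernel, Set.indicator_apply]
    exact Measurable.ite (measurableSet_mem_weakNeighborhood α x y) measurable_const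
      measurable_const
  · simp [nbhdKernel, Set.indicator_apply, mem_weakNeighborhood_shift]

/-- The size `|𝒢_x|`. -/
def nbhdSize (ω : Env d) (α : ℝ) (x : Vertex d) : ℝ≥0∞ := (weakNeighborhood ω α x).encard

theorem nbhdSize_eq_kernelOp (ω : Env d) (α : ℝ) (x : Vertex d) :
    nbhdSize ω α x = kernelOp (nbhdKernel ω α) 1 x := by
  rw [nbhdSize, ← ENNReal.tsum_set_one, kernelOp_apply, tsum_subtype _ (fun _ => (1 : ℝ≥0∞))]
  simp [nbhdKernel, Pi.one_def]

theorem isCov_nbhdSize (α : ℝ) : IsCov fun ω : Env d => nbhdSize ω α := by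
  have := (isCovKernel_nbhdKernel (d := d) α).op (IsCov.const 1)
  have e : (fun ω : Env d => nbhdSize ω α) = fun ω => kernelOp (nbhdKernel ω α) fun _ => 1 :=
    funext fun ω => funext fun x => nbhdSize_eq_kernelOp ω α x
  rw [e]
  exact this

end Covariance


/-! ### Ergodic averages and the maximal function -/

section Maximal

variable {V : Type*}

/-- The ergodic sum `∑_{i < n} k^i u`. -/
def ergSum (k : V → V → ℝ≥0∞) (n : ℕ) (u : V → ℝ≥0∞) : V → ℝ≥0∞ :=
  (∑ i ∈ Finset.range n, kernelOp k ^ i) u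

/-- The maximal function `sup_{n ≥ 1} n⁻¹ ∑_{i < n} k^i u`. -/
def maxFn (k : V → V → ℝ≥0∞) (u : V → ℝ≥0∞) (x : V) : ℝ≥0∞ :=
  ⨆ n : ℕ, ergSum k (n + 1) u x / (n + 1 : ℕ)

theorem ergSum_zero (k : V → V → ℝ≥0∞) (u : V → ℝ≥0∞) : ergSum k 0 u = 0 := by
  simp [ergSum]

theorem ergSum_succ (k : V → V → ℝ≥0∞) (n : ℕ) (u : V → ℝ≥0∞) :
    ergSum k (n + 1) u = u + kernelOp k (ergSum k n u) := by
  simp only [ergSum, Finset.sum_range_succ', pow_succ', ← Finset.mul_sum, opAdd_apply,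
    opMul_apply]
  rw [add_comm]; rfl

theorem ergSum_le_mul_maxFn (k : V → V → ℝ≥0∞) (n : ℕ) (u : V → ℝ≥0∞) (x : V) :
    ergSum k n u x ≤ n * maxFn k u x := by
  cases n with
  | zero => simp [ergSum_zero]
  | succ n =>
    rw [mul_comm]
    refine (ENNReal.div_le_iff_le_mul (Or.inl (by simp)) (Or.inl (by simp))).1 ?_
    exact le_iSup (fun n : ℕ => ergSum k (n + 1) u x / (n + 1 : ℕ)) n

theorem le_maxFn (k : V → V → ℝ≥0∞) (u : V → ℝ≥0∞) (x : V) : u x ≤ maxFn k u x := by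
  have := ergSum_le_mul_maxFn k 1 u x
  rw [ergSum_succ, ergSum_zero, map_zero] at this
  simpa using this

variable {k : V → V → ℝ≥0∞}

theorem kernelOp_one_le (hk : ∀ x, ∑' y, k x y ≤ 1) : kernelOp k 1 ≤ 1 := by
  intro x
  simpa [kernelOp_apply] using hk x

theorem kernelOp_pow_one_le (hk : ∀ x, ∑' y, k x y ≤ 1) (n : ℕ) : (kernelOp k ^ n) 1 ≤ 1 := by
  induction n with
  | zero => exact le_rfl
  | succ n ih =>
    rw [pow_succ, opMul_apply]
    exact (opMono _ (kernelOp_one_le hk)).trans ih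

theorem exists_kernelOp_eq_pow (k : V → V → ℝ≥0∞) (n : ℕ) :
    ∃ k', kernelOp k ^ n = kernelOp k' := by
  classical
  induction n with
  | zero =>
    refine ⟨fun x y => if x = y then 1 else 0, ?_⟩
    ext g x
    rw [kernelOp_apply, tsum_eq_single x]
    · simp
    · intro y hy; simp [Ne.symm hy]
  | succ n ih =>
    obtain ⟨k', hk'⟩ := ih
    exact ⟨_, by rw [pow_succ, hk', kernelOp_mul]⟩

theorem exists_kernelOp_eq_ergSum (k : V → V → ℝ≥0∞) (n : ℕ) :
    ∃ k', ∀ u, ergSum k n u = kernelOp k' u := by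
  choose q hq using exists_kernelOp_eq_pow k
  refine ⟨fun x y => ∑ i ∈ Finset.range n, q i x y, fun u => ?_⟩
  ext x
  simp only [ergSum, opSum_apply, Finset.sum_apply, hq, kernelOp_apply, Finset.sum_mul]
  exact (Summable.tsum_finsetSum fun i _ => ENNReal.summable).symm

theorem ergSum_one_le (hk : ∀ x, ∑' y, k x y ≤ 1) (n : ℕ) (x : V) : ergSum k n 1 x ≤ n := by
  simp only [ergSum, opSum_apply, Finset.sum_apply]
  exact (Finset.sum_le_card_nsmul _ _ 1 fun i _ => kernelOp_pow_one_le hk i x).trans (by simp)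

/-- Cauchy-Schwarz for the averages, whose kernels have row sums at most one. -/
theorem maxFn_sq_le (hk : ∀ x, ∑' y, k x y ≤ 1) (u : V → ℝ≥0∞) (x : V) :
    maxFn k u x ^ 2 ≤ maxFn k (fun y => u y ^ 2) x := by
  have hle : maxFn k u x ≤ (maxFn k (fun y => u y ^ 2) x) ^ (1 / 2 : ℝ) := by
    refine iSup_le fun n => ?_
    have h2 : (ergSum k (n + 1) u x / (n + 1 : ℕ)) ^ 2 ≤ maxFn k (fun y => u y ^ 2) x := by
      refine le_trans ?_ (le_iSup _ n)
      obtain ⟨q, hq⟩ := exists_kernelOp_eq_ergSum k (n + 1)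
      have h1 := kernelOp_sq_le q u x
      rw [← hq, ← hq, ← hq] at h1
      have h3 := h1.trans (mul_le_mul_left (ergSum_one_le hk (n + 1) x) _)
      rw [div_eq_mul_inv, mul_pow, div_eq_mul_inv]
      calc _ ≤ ((n + 1 : ℕ) * ergSum k (n + 1) (fun y => u y ^ 2) x) * ((n + 1 : ℕ) : ℝ≥0∞)⁻¹ ^ 2 :=
            mul_le_mul_left h3 _
        _ = ergSum k (n + 1) (fun y => u y ^ 2) x * ((n + 1 : ℕ) : ℝ≥0∞)⁻¹ *
              ((n + 1 : ℕ) * ((n + 1 : ℕ) : ℝ≥0∞)⁻¹) := by ring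
        _ = _ := by
            rw [ENNReal.mul_inv_cancel (by simp) (by simp), mul_one]
    calc _ = ((ergSum k (n + 1) u x / (n + 1 : ℕ)) ^ (2 : ℝ)) ^ (1 / 2 : ℝ) := by
          rw [← ENNReal.rpow_mul]; norm_num
      _ ≤ _ := by
          refine ENNReal.rpow_le_rpow ?_ (by norm_num)
          rw [ENNReal.rpow_two]; exact h2
  calc maxFn k u x ^ 2 ≤ ((maxFn k (fun y => u y ^ 2) x) ^ (1 / 2 : ℝ)) ^ 2 := by gcongr
    _ = _ := by
      rw [← ENNReal.rpow_two, ← ENNReal.rpow_mul]; norm_num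

theorem maxFn_two_pow_le (hk : ∀ x, ∑' y, k x y ≤ 1) (u : V → ℝ≥0∞) (x : V) (i : ℕ) :
    maxFn k u x ^ 2 ^ i ≤ maxFn k (fun y => u y ^ 2 ^ i) x := by
  induction i generalizing u with
  | zero => simp
  | succ i ih =>
    have h1 : maxFn k u x ^ 2 ^ (i + 1) = (maxFn k u x ^ 2) ^ 2 ^ i := by
      rw [← pow_mul]; congr 1; ring
    have h2 : (fun y => u y ^ 2 ^ (i + 1)) = fun y => (u y ^ 2) ^ 2 ^ i := by
      ext y; rw [← pow_mul]; congr 1; ring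
    rw [h1, h2]
    exact (pow_le_pow_left' (maxFn_sq_le hk u x) _).trans (ih _)

/-- The successive corrections in the maximal inequality: `excess n` dominates
`ergSum k m u - m c` for all `m ≤ n`. -/
def excess (k : V → V → ℝ≥0∞) (u : V → ℝ≥0∞) (c : ℝ≥0∞) : ℕ → V → ℝ≥0∞
  | 0 => 0
  | n + 1 => fun x => u x + kernelOp k (excess k u c n) x - c

theorem excess_mono (u : V → ℝ≥0∞) (c : ℝ≥0∞) : Monotone (excess k u c) := by
  refine monotone_nat_of_le_succ fun n => ?_
  induction n with
  | zero => exact bot_le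
  | succ n ih =>
    intro x
    simp only [excess]
    gcongr
    exact opMono _ ih x

theorem ergSum_le_excess (hk : ∀ x, ∑' y, k x y ≤ 1) (u : V → ℝ≥0∞) (c : ℝ≥0∞) (n : ℕ) (x : V) :
    ergSum k n u x ≤ excess k u c n x + n * c := by
  induction n generalizing x with
  | zero => simp [ergSum_zero]
  | succ n ih =>
    rw [ergSum_succ, Pi.add_apply]
    have h1 : kernelOp k (ergSum k n u) x ≤ kernelOp k (excess k u c n) x + n * c := by
      have h2 : ergSum k n u ≤ excess k u c n + fun y => (n * c) * (1 : V → ℝ≥0∞) y :=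
        fun y => by simpa using ih y
      refine (opMono (kernelOp k) h2 x).trans ?_
      rw [map_add, Pi.add_apply, kernelOp_const_mul]
      refine add_le_add_right ?_ _
      exact (mul_le_mul_right (kernelOp_one_le hk x) _).trans (by simp)
    calc _ ≤ u x + (kernelOp k (excess k u c n) x + n * c) := by gcongr
      _ = (u x + kernelOp k (excess k u c n) x) + n * c := by ring
      _ ≤ (excess k u c (n + 1) x + c) + n * c := by
          refine add_le_add_left ?_ _
          exact le_tsub_add
      _ = _ := by push_cast; ring

/-! ### Iterated moment functions -/

/-- The functions `F₀ = 1`, `F_{j+1} = K (M F_j)`, where `M` is the maximal function of `k`. -/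
def momentFn (k q : V → V → ℝ≥0∞) : ℕ → V → ℝ≥0∞
  | 0 => 1
  | j + 1 => kernelOp q (maxFn k (momentFn k q j))

/-- The words of length `l` with `j` letters `q` have total mass of order `l ^ j`: by induction on `j`,
summing over the position of the first letter `q` produces an ergodic sum of `F_j`. -/
theorem words_one_le (hk : ∀ x, ∑' y, k x y ≤ 1) (q : V → V → ℝ≥0∞) (l j : ℕ) (x : V) :
    words (kernelOp k) (kernelOp q) l j 1 x ≤ l ^ j * maxFn k (momentFn k q j) x := by
  induction j generalizing l x with
  | zero =>
    rw [words_zero_right, pow_zero, one_mul]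
    exact (kernelOp_pow_one_le hk l x).trans (le_maxFn k (momentFn k q 0) x)
  | succ j ih =>
    have key : ∀ l x, words (kernelOp k) (kernelOp q) l (j + 1) 1 x ≤
        l ^ j * ergSum k l (momentFn k q (j + 1)) x := by
      intro l
      induction l with
      | zero => intro x; simp [words_zero_succ]
      | succ l ihl =>
        intro x
        rw [words_succ_succ, opAdd_apply, Pi.add_apply, opMul_apply, opMul_apply, ergSum_succ,
          Pi.add_apply, mul_add]
        have hl : (l : ℝ≥0∞) ^ j ≤ ((l + 1 : ℕ) : ℝ≥0∞) ^ j := by gcongr; omega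
        gcongr
        · refine (opMono (kernelOp q) (fun y => ih l y) x).trans ?_
          rw [kernelOp_const_mul]
          exact mul_le_mul_left hl _
        · refine (opMono (kernelOp k) (fun y => ihl y) x).trans ?_
          rw [kernelOp_const_mul]
          exact mul_le_mul_left hl _
    refine (key l x).trans ?_
    rw [pow_succ, mul_assoc]
    gcongr
    exact ergSum_le_mul_maxFn _ _ _ _

end Maximal

/-! ### Mass transport and moments under the environment law -/

section MassTransport

variable {d : ℕ}

/-- The mass transport principle: in mean, the mass sent out of `0` equals the mass received at `0`. -/
theorem massTransport {P : Measure (Env d)} (hP : ∀ x, MeasurePreserving (shift x) P P)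
    {m : Env d → Vertex d → Vertex d → ℝ≥0∞} (hm : IsCovKernel m) :
    ∫⁻ ω, ∑' y, m ω 0 y ∂P = ∫⁻ ω, ∑' y, m ω y 0 ∂P := by
  rw [lintegral_tsum fun y => (hm.meas 0 y).aemeasurable,
    lintegral_tsum fun y => (hm.meas y 0).aemeasurable,
    ← (Equiv.neg (Vertex d)).tsum_eq]
  refine tsum_congr fun y => ?_
  rw [← (hP (-y)).lintegral_comp (hm.meas y 0)]
  refine lintegral_congr fun ω => ?_
  rw [hm.cov]; simp

/-- The random kernel `k` is symmetric for the bilinear form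
`(u, v) ↦ ∫ u(ω, 0) v(ω, 0) dμ(ω)` on covariant functions. -/
def EnvSymm (μ : Measure (Env d)) (k : Env d → Vertex d → Vertex d → ℝ≥0∞) : Prop :=
  ∀ u v, IsCov u → IsCov v →
    ∫⁻ ω, u ω 0 * kernelOp (k ω) (v ω) 0 ∂μ = ∫⁻ ω, v ω 0 * kernelOp (k ω) (u ω) 0 ∂μ

/-- A kernel which is reversible for a covariant weight `w` is symmetric for the environment law
weighted by `w`. -/
theorem envSymm_of_reversible {P : Measure (Env d)} (hP : ∀ x, MeasurePreserving (shift x) P P)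
    {w : Env d → Vertex d → ℝ≥0∞} (hw : IsCov w) {k : Env d → Vertex d → Vertex d → ℝ≥0∞}
    (hk : IsCovKernel k) (hrev : ∀ ω x y, w ω x * k ω x y = w ω y * k ω y x) :
    EnvSymm (P.withDensity fun ω => w ω 0) k := by
  intro u v hu hv
  rw [lintegral_withDensity_eq_lintegral_mul _ (hw.meas 0) ((hu.mul (hk.op hv)).meas 0),
    lintegral_withDensity_eq_lintegral_mul _ (hw.meas 0) ((hv.mul (hk.op hu)).meas 0)]
  have hm : IsCovKernel fun ω x y => w ω x * k ω x y * (u ω x * v ω y) :=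
    ⟨fun x y => ((hw.meas x).mul (hk.meas x y)).mul ((hu.meas x).mul (hv.meas y)),
      fun z ω x y => by rw [hw.cov, hk.cov, hu.cov, hv.cov]⟩
  have := massTransport hP hm
  simp only [Pi.mul_apply, kernelOp_apply, ← ENNReal.tsum_mul_left]
  convert this using 1
  · exact lintegral_congr fun ω => tsum_congr fun y => by ring
  · refine lintegral_congr fun ω => tsum_congr fun y => ?_
    rw [hrev ω y 0]; ring

variable {μ : Measure (Env d)} {k : Env d → Vertex d → Vertex d → ℝ≥0∞}

theorem lintegral_kernelOp_le (hs : EnvSymm μ k) (hk1 : ∀ ω x, ∑' y, k ω x y ≤ 1)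
    {u : Env d → Vertex d → ℝ≥0∞} (hu : IsCov u) :
    ∫⁻ ω, kernelOp (k ω) (u ω) 0 ∂μ ≤ ∫⁻ ω, u ω 0 ∂μ := by
  have := hs (fun _ => 1) u (IsCov.const 1) hu
  simp only [Pi.one_apply, one_mul] at this
  rw [this]
  refine lintegral_mono fun ω => ?_
  exact (mul_le_mul_right (kernelOp_one_le (hk1 ω) 0) _).trans (by simp)

theorem isCov_ergSum (hk : IsCovKernel k) {u : Env d → Vertex d → ℝ≥0∞} (hu : IsCov u) (n : ℕ) :
    IsCov fun ω => ergSum (k ω) n (u ω) := by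
  induction n with
  | zero => simp only [ergSum_zero]; exact IsCov.const 0
  | succ n ih => simp only [ergSum_succ]; exact hu.add (hk.op ih)

theorem isCov_maxFn (hk : IsCovKernel k) {u : Env d → Vertex d → ℝ≥0∞} (hu : IsCov u) :
    IsCov fun ω => maxFn (k ω) (u ω) := by
  refine IsCov.iSup fun n => ?_
  simp only [div_eq_mul_inv]
  exact (isCov_ergSum hk hu (n + 1)).mul (IsCov.const _)

theorem isCov_excess (hk : IsCovKernel k) {u : Env d → Vertex d → ℝ≥0∞} (hu : IsCov u)
    (c : ℝ≥0∞) (n : ℕ) : IsCov fun ω => excess (k ω) (u ω) c n := by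
  induction n with
  | zero => exact IsCov.const 0
  | succ n ih => exact (hu.add (hk.op ih)).sub (IsCov.const c)

/-- The maximal ergodic inequality for a reversible sub-Markov kernel. -/
theorem mul_measure_maxFn_le (hk : IsCovKernel k) (hs : EnvSymm μ k)
    (hk1 : ∀ ω x, ∑' y, k ω x y ≤ 1) {u : Env d → Vertex d → ℝ≥0∞} (hu : IsCov u) (c : ℝ≥0∞) :
    c * μ {ω | c < maxFn (k ω) (u ω) 0} ≤ ∫⁻ ω, u ω 0 ∂μ := by
  rcases eq_or_ne (∫⁻ ω, u ω 0 ∂μ) ∞ with htop | hfin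
  · rw [htop]; exact le_top
  let h : ℕ → Env d → Vertex d → ℝ≥0∞ := fun n ω => excess (k ω) (u ω) c n
  have hcov : ∀ n, IsCov (h n) := fun n => isCov_excess hk hu c n
  have hint : ∀ n, ∫⁻ ω, h n ω 0 ∂μ ≠ ∞ := by
    intro n
    induction n with
    | zero => simp [h, excess]
    | succ n ih =>
      refine ne_top_of_le_ne_top (ENNReal.add_ne_top.2 ⟨hfin, ih⟩) ?_
      calc ∫⁻ ω, h (n + 1) ω 0 ∂μ ≤ ∫⁻ ω, u ω 0 + kernelOp (k ω) (h n ω) 0 ∂μ :=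
            lintegral_mono fun ω => tsub_le_self
        _ = ∫⁻ ω, u ω 0 ∂μ + ∫⁻ ω, kernelOp (k ω) (h n ω) 0 ∂μ :=
            lintegral_add_left (hu.meas 0) _
        _ ≤ _ := add_le_add_right (lintegral_kernelOp_le hs hk1 (hcov n)) _
  -- on `{h (n + 1) > 0}` one has `h (n + 1) + c = u + k (h n)`; the contributions of `h` cancel
  have hstep : ∀ n, c * μ {ω | 0 < h (n + 1) ω 0} ≤ ∫⁻ ω, u ω 0 ∂μ := by
    intro n
    have hE : MeasurableSet {ω | 0 < h (n + 1) ω 0} :=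
      measurableSet_lt measurable_const ((hcov (n + 1)).meas 0)
    have h1 : ∫⁻ ω, h (n + 1) ω 0 ∂μ + c * μ {ω | 0 < h (n + 1) ω 0} ≤
        ∫⁻ ω, u ω 0 ∂μ + ∫⁻ ω, h (n + 1) ω 0 ∂μ := by
      rw [← lintegral_indicator_const hE, ← lintegral_add_left ((hcov (n + 1)).meas 0)]
      calc _ ≤ ∫⁻ ω, u ω 0 + kernelOp (k ω) (h n ω) 0 ∂μ := by
            refine lintegral_mono fun ω => ?_
            by_cases hω : ω ∈ {ω | 0 < h (n + 1) ω 0}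
            · rw [Set.indicator_of_mem hω]
              exact (tsub_add_cancel_of_le (tsub_pos_iff_lt.1 hω).le).le
            · rw [Set.indicator_of_notMem hω, add_zero]
              exact tsub_le_self
        _ = ∫⁻ ω, u ω 0 ∂μ + ∫⁻ ω, kernelOp (k ω) (h n ω) 0 ∂μ :=
            lintegral_add_left (hu.meas 0) _
        _ ≤ ∫⁻ ω, u ω 0 ∂μ + ∫⁻ ω, h n ω 0 ∂μ :=
            add_le_add_right (lintegral_kernelOp_le hs hk1 (hcov n)) _
        _ ≤ _ := by
            gcongr with ω
            exact excess_mono (u ω) c (Nat.le_succ n) 0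
    rw [add_comm] at h1
    exact (ENNReal.add_le_add_iff_right (hint (n + 1))).1 h1
  have hsub : {ω | c < maxFn (k ω) (u ω) 0} ⊆ ⋃ n, {ω | 0 < h (n + 1) ω 0} := by
    intro ω hω
    obtain ⟨n, hn⟩ := lt_iSup_iff.1 (show c < ⨆ n : ℕ, _ from hω)
    refine Set.mem_iUnion.2 ⟨n, ?_⟩
    change 0 < h (n + 1) ω 0
    by_contra h0
    have h0' : h (n + 1) ω 0 = 0 := by simpa using h0
    have h1 := ergSum_le_excess (hk1 ω) (u ω) c (n + 1) 0
    change _ ≤ h (n + 1) ω 0 + _ at h1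
    rw [h0', zero_add, mul_comm] at h1
    exact not_le.2 hn ((ENNReal.div_le_iff_le_mul (Or.inl (by simp)) (Or.inl (by simp))).2 h1)
  have hmono : Monotone fun n => {ω | 0 < h (n + 1) ω 0} := fun m n hmn ω (hω : 0 < _) =>
    lt_of_lt_of_le hω (excess_mono (u ω) c (Nat.succ_le_succ hmn) 0)
  calc _ ≤ c * μ (⋃ n, {ω | 0 < h (n + 1) ω 0}) := by gcongr
    _ = ⨆ n, c * μ {ω | 0 < h (n + 1) ω 0} := by
        rw [hmono.measure_iUnion, ENNReal.mul_iSup]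
    _ ≤ _ := iSup_le hstep

/-- A random function all of whose moments are finite. -/
def HasMoments (μ : Measure (Env d)) (u : Env d → Vertex d → ℝ≥0∞) : Prop :=
  ∀ n : ℕ, ∫⁻ ω, u ω 0 ^ n ∂μ < ∞

/-- Integrability from a quadratic tail bound along the powers of two. -/
theorem lintegral_lt_top_of_tail [IsFiniteMeasure μ] {G : Env d → ℝ≥0∞} (hG : Measurable G)
    {c : ℝ≥0∞} (hc : c ≠ ∞) (h : ∀ i : ℕ, (2 ^ i) ^ 2 * μ {ω | 2 ^ i < G ω} ≤ c) :
    ∫⁻ ω, G ω ∂μ < ∞ := by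
  have hpt : ∀ ω, G ω ≤ 1 + ∑' i : ℕ, {ω | 2 ^ i < G ω}.indicator (fun _ => 2 ^ (i + 1)) ω := by
    intro ω
    rcases eq_or_ne (G ω) ∞ with htop | hfin
    · have : ∑' i : ℕ, {ω | 2 ^ i < G ω}.indicator (fun _ => (2 : ℝ≥0∞) ^ (i + 1)) ω = ∞ := by
        refine top_unique ?_
        calc ∞ = ∑' _i : ℕ, (1 : ℝ≥0∞) := (ENNReal.tsum_const_eq_top_of_ne_zero one_ne_zero).symm
          _ ≤ _ := by
            refine ENNReal.tsum_le_tsum fun i => ?_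
            have hmem : ω ∈ {ω | 2 ^ i < G ω} := by
              change 2 ^ i < G ω
              rw [htop]; exact ENNReal.pow_lt_top (by simp)
            rw [Set.indicator_of_mem hmem]
            exact one_le_pow₀ (by norm_num)
      rw [this]; simp
    · classical
      have hex : ∃ i : ℕ, G ω ≤ 2 ^ i := by
        obtain ⟨n, hn⟩ := ENNReal.exists_nat_gt hfin
        refine ⟨n, hn.le.trans ?_⟩
        exact_mod_cast n.lt_two_pow_self.le
      rcases Nat.eq_zero_or_pos (Nat.find hex) with h0 | hpos
      · have := Nat.find_spec hex
        rw [h0, pow_zero] at this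
        exact this.trans le_self_add
      · obtain ⟨i, hi⟩ := Nat.exists_eq_succ_of_ne_zero hpos.ne'
        have h1 := Nat.find_spec hex
        have h2 : ¬ G ω ≤ 2 ^ i := Nat.find_min hex (by omega)
        rw [hi] at h1
        refine le_trans ?_ le_add_self
        refine le_trans ?_ (ENNReal.le_tsum i)
        rw [Set.indicator_of_mem (show ω ∈ {ω | 2 ^ i < G ω} from not_le.1 h2)]
        exact h1
  have hmeas : ∀ i : ℕ, MeasurableSet {ω | 2 ^ i < G ω} := fun i =>
    measurableSet_lt measurable_const hG
  calc ∫⁻ ω, G ω ∂μ ≤ ∫⁻ ω, 1 + ∑' i : ℕ, {ω | 2 ^ i < G ω}.indicator (fun _ => 2 ^ (i + 1)) ω ∂μ :=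
        lintegral_mono hpt
    _ = μ Set.univ + ∑' i : ℕ, 2 ^ (i + 1) * μ {ω | 2 ^ i < G ω} := by
        rw [lintegral_add_left measurable_const, lintegral_one, lintegral_tsum fun i =>
          (measurable_const.indicator (hmeas i)).aemeasurable]
        congr 1
        exact tsum_congr fun i => lintegral_indicator_const (hmeas i) _
    _ ≤ μ Set.univ + ∑' i : ℕ, 2 * c * 2⁻¹ ^ i := by
        refine add_le_add_right (ENNReal.tsum_le_tsum fun i => ?_) _
        have h2 : (2 : ℝ≥0∞) ^ i * 2⁻¹ ^ i = 1 := by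
          rw [← mul_pow, ENNReal.mul_inv_cancel (by norm_num) (by norm_num), one_pow]
        calc 2 ^ (i + 1) * μ {ω | 2 ^ i < G ω} =
            2 ^ (i + 1) * μ {ω | 2 ^ i < G ω} * (2 ^ i * 2⁻¹ ^ i) := by rw [h2, mul_one]
          _ = 2 * ((2 ^ i) ^ 2 * μ {ω | 2 ^ i < G ω}) * 2⁻¹ ^ i := by ring
          _ ≤ _ := mul_le_mul_left (mul_le_mul_right (h i) _) _
    _ < ∞ := by
        rw [ENNReal.tsum_mul_left, ENNReal.tsum_geometric]
        refine ENNReal.add_lt_top.2 ⟨measure_lt_top _ _, ?_⟩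
        refine ENNReal.mul_lt_top (ENNReal.mul_lt_top (by simp) hc.lt_top) ?_
        rw [ENNReal.one_sub_inv_two, inv_inv]
        simp

theorem _root_.ENNReal.pow_le_one_add_pow (a : ℝ≥0∞) {m n : ℕ} (h : m ≤ n) : a ^ m ≤ 1 + a ^ n := by
  rcases le_total a 1 with ha | ha
  · exact (pow_le_one₀ (zero_le) ha).trans le_self_add
  · exact (pow_le_pow_right₀ ha h).trans le_add_self

theorem hasMoments_of_two_pow [IsFiniteMeasure μ] {u : Env d → Vertex d → ℝ≥0∞}
    (h : ∀ i : ℕ, ∫⁻ ω, u ω 0 ^ 2 ^ i ∂μ < ∞) : HasMoments μ u := by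
  intro n
  calc ∫⁻ ω, u ω 0 ^ n ∂μ ≤ ∫⁻ ω, 1 + u ω 0 ^ 2 ^ n ∂μ :=
        lintegral_mono fun ω => ENNReal.pow_le_one_add_pow _ n.lt_two_pow_self.le
    _ = μ Set.univ + ∫⁻ ω, u ω 0 ^ 2 ^ n ∂μ := by
        rw [lintegral_add_left measurable_const, lintegral_one]
    _ < ∞ := ENNReal.add_lt_top.2 ⟨measure_lt_top _ _, h n⟩

/-- The maximal function inherits finite moments: the maximal inequality for `u ^ (2 ^ (i + 1))`
controls the tail of `(M u) ^ (2 ^ i)`, because `(M u) ^ (2 ^ i) ≤ M (u ^ (2 ^ i))`. -/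
theorem HasMoments.maxFn [IsFiniteMeasure μ] (hk : IsCovKernel k) (hs : EnvSymm μ k)
    (hk1 : ∀ ω x, ∑' y, k ω x y ≤ 1) {u : Env d → Vertex d → ℝ≥0∞} (hu : IsCov u)
    (hm : HasMoments μ u) : HasMoments μ fun ω => maxFn (k ω) (u ω) := by
  refine hasMoments_of_two_pow fun i => ?_
  refine lintegral_lt_top_of_tail (((isCov_maxFn hk hu).pow _).meas 0) (hm (2 ^ (i + 1))).ne
    fun j => le_trans ?_ (mul_measure_maxFn_le hk hs hk1 (hu.pow (2 ^ (i + 1))) ((2 ^ j) ^ 2))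
  refine mul_le_mul_right (measure_mono ?_) _
  intro ω (hω : 2 ^ j < RandomConductance.maxFn (k ω) (u ω) 0 ^ 2 ^ i)
  refine lt_of_lt_of_le ?_ (maxFn_two_pow_le (hk1 ω) (u ω) 0 (i + 1))
  rw [pow_succ 2 i, pow_mul]
  exact ENNReal.pow_lt_pow_left two_ne_zero hω

/-- Jensen's inequality for dyadic powers, by iterating Cauchy-Schwarz. -/
theorem kernelOp_two_pow_le {V : Type*} (q : V → V → ℝ≥0∞) (g : V → ℝ≥0∞) (x : V) (i : ℕ) :
    kernelOp q g x ^ 2 ^ i ≤ kernelOp q 1 x ^ (2 ^ i - 1) * kernelOp q (fun y => g y ^ 2 ^ i) x := by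
  induction i generalizing g with
  | zero => simp
  | succ i ih =>
    have h1 : kernelOp q g x ^ 2 ^ (i + 1) = (kernelOp q g x ^ 2) ^ 2 ^ i := by
      rw [← pow_mul]; congr 1; ring
    have h2 : (fun y => g y ^ 2 ^ (i + 1)) = fun y => (g y ^ 2) ^ 2 ^ i := by
      ext y; rw [← pow_mul]; congr 1; ring
    have hpos : 1 ≤ 2 ^ i := Nat.one_le_two_pow
    rw [h1, h2]
    calc _ ≤ (kernelOp q 1 x * kernelOp q (fun y => g y ^ 2) x) ^ 2 ^ i :=
          pow_le_pow_left' (kernelOp_sq_le q g x) _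
      _ = kernelOp q 1 x ^ 2 ^ i * kernelOp q (fun y => g y ^ 2) x ^ 2 ^ i := mul_pow _ _ _
      _ ≤ kernelOp q 1 x ^ 2 ^ i * (kernelOp q 1 x ^ (2 ^ i - 1) *
            kernelOp q (fun y => (g y ^ 2) ^ 2 ^ i) x) := mul_le_mul_right (ih _) _
      _ = _ := by
          rw [← mul_assoc, ← pow_add]
          congr 2
          rw [pow_succ]; omega

theorem mul_kernelOp_le {V : Type*} (q : V → V → ℝ≥0∞) (b : ℝ≥0∞) (g : V → ℝ≥0∞) (x : V) :
    b * kernelOp q g x ≤ b ^ 2 * kernelOp q 1 x + kernelOp q (fun y => g y ^ 2) x := by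
  rw [← kernelOp_const_mul, ← kernelOp_const_mul]
  have : (fun y => b * g y) ≤ (fun y => b ^ 2 * (1 : V → ℝ≥0∞) y) + fun y => g y ^ 2 := by
    intro y
    simp only [Pi.add_apply, Pi.one_apply, mul_one]
    refine le_trans ?_ (ENNReal.two_mul_mul_le_sq_add_sq b (g y))
    rw [two_mul]; exact le_self_add
  refine (opMono (kernelOp q) this x).trans ?_
  rw [map_add]; rfl

/-- A symmetric random kernel preserves finiteness of all moments if its row sums have all
moments: Cauchy-Schwarz separates the row sums from `q (u ^ (2 ^ (i + 1)))`, whose integral is moved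
onto the row sums by symmetry. -/
theorem HasMoments.kernelOp [IsFiniteMeasure μ] {q : Env d → Vertex d → Vertex d → ℝ≥0∞}
    (hq : IsCovKernel q) (hs : EnvSymm μ q) {u : Env d → Vertex d → ℝ≥0∞} (hu : IsCov u)
    (h1 : HasMoments μ fun ω => kernelOp (q ω) 1) (hm : HasMoments μ u) :
    HasMoments μ fun ω => kernelOp (q ω) (u ω) := by
  refine hasMoments_of_two_pow fun i => ?_
  have hf : IsCov fun ω => RandomConductance.kernelOp (q ω) 1 := hq.op (IsCov.const 1)
  have hv : IsCov fun ω y => u ω y ^ 2 ^ (i + 1) := hu.pow _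
  have hpt : ∀ ω, RandomConductance.kernelOp (q ω) (u ω) 0 ^ 2 ^ i ≤
      RandomConductance.kernelOp (q ω) 1 0 ^ (2 * (2 ^ i - 1) + 1) +
        RandomConductance.kernelOp (q ω) (fun y => u ω y ^ 2 ^ (i + 1)) 0 := by
    intro ω
    refine (kernelOp_two_pow_le (q ω) (u ω) 0 i).trans ((mul_kernelOp_le _ _ _ _).trans ?_)
    refine le_of_eq ?_
    congr 1
    · ring
    · have : (fun y => (u ω y ^ 2 ^ i) ^ 2) = fun y => u ω y ^ 2 ^ (i + 1) := by
        ext y; rw [← pow_mul, ← pow_succ]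
      rw [this]
  have hsymm := hs (fun _ _ => 1) _ (IsCov.const 1) hv
  simp only [one_mul] at hsymm
  calc _ ≤ ∫⁻ ω, RandomConductance.kernelOp (q ω) 1 0 ^ (2 * (2 ^ i - 1) + 1) +
        RandomConductance.kernelOp (q ω) (fun y => u ω y ^ 2 ^ (i + 1)) 0 ∂μ := lintegral_mono hpt
    _ = ∫⁻ ω, RandomConductance.kernelOp (q ω) 1 0 ^ (2 * (2 ^ i - 1) + 1) ∂μ +
        ∫⁻ ω, u ω 0 ^ 2 ^ (i + 1) * RandomConductance.kernelOp (q ω) 1 0 ∂μ := by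
        rw [lintegral_add_left ((hf.pow _).meas 0)]
        exact congrArg _ hsymm
    _ ≤ ∫⁻ ω, RandomConductance.kernelOp (q ω) 1 0 ^ (2 * (2 ^ i - 1) + 1) ∂μ +
        ∫⁻ ω, u ω 0 ^ (2 ^ (i + 1) * 2) + RandomConductance.kernelOp (q ω) 1 0 ^ 2 ∂μ := by
        refine add_le_add_right (lintegral_mono fun ω => ?_) _
        rw [pow_mul]
        refine le_trans ?_ (ENNReal.two_mul_mul_le_sq_add_sq _ _)
        rw [two_mul]; exact le_self_add
    _ < ∞ := by
        rw [lintegral_add_left ((hu.pow _).meas 0)]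
        exact ENNReal.add_lt_top.2 ⟨h1 _, ENNReal.add_lt_top.2 ⟨hm _, h1 _⟩⟩

theorem isCov_momentFn {q : Env d → Vertex d → Vertex d → ℝ≥0∞} (hk : IsCovKernel k)
    (hq : IsCovKernel q) (j : ℕ) : IsCov fun ω => momentFn (k ω) (q ω) j := by
  induction j with
  | zero => exact IsCov.const 1
  | succ j ih => exact hq.op (isCov_maxFn hk ih)

theorem hasMoments_momentFn [IsFiniteMeasure μ] {q : Env d → Vertex d → Vertex d → ℝ≥0∞}
    (hk : IsCovKernel k) (hks : EnvSymm μ k) (hk1 : ∀ ω x, ∑' y, k ω x y ≤ 1)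
    (hq : IsCovKernel q) (hqs : EnvSymm μ q) (h1 : HasMoments μ fun ω => kernelOp (q ω) 1) (j : ℕ) :
    HasMoments μ fun ω => momentFn (k ω) (q ω) j := by
  induction j with
  | zero => intro n; simp [momentFn]
  | succ j ih =>
    exact HasMoments.kernelOp hq hqs (isCov_maxFn hk (isCov_momentFn hk hq j)) h1
      (ih.maxFn hk hks hk1 (isCov_momentFn hk hq j))

/-- The maximal functions of the iterated moment functions are almost surely finite. -/
theorem ae_maxFn_momentFn_lt_top [IsFiniteMeasure μ] {q : Env d → Vertex d → Vertex d → ℝ≥0∞}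
    (hk : IsCovKernel k) (hks : EnvSymm μ k) (hk1 : ∀ ω x, ∑' y, k ω x y ≤ 1)
    (hq : IsCovKernel q) (hqs : EnvSymm μ q) (h1 : HasMoments μ fun ω => kernelOp (q ω) 1) (j : ℕ) :
    ∀ᵐ ω ∂μ, maxFn (k ω) (momentFn (k ω) (q ω) j) 0 < ∞ := by
  have hcov := isCov_momentFn hk hq j
  have := (hasMoments_momentFn hk hks hk1 hq hqs h1 j).maxFn hk hks hk1 hcov 1
  simp only [pow_one] at this
  exact ae_lt_top ((isCov_maxFn hk hcov).meas 0) this.ne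

end MassTransport


/-! ### Excursions away from a set -/

section Excursions

variable {V : Type*}

/-- Multiplication by a function. -/
def mulOp (a : V → ℝ≥0∞) : AddMonoid.End (V → ℝ≥0∞) where
  toFun g := a * g
  map_zero' := mul_zero a
  map_add' g h := mul_add a g h

theorem mulOp_apply (a g : V → ℝ≥0∞) (x : V) : mulOp a g x = a x * g x := rfl

theorem isAdj_mulOp (w a : V → ℝ≥0∞) : IsAdj w (mulOp a) (mulOp a) := by
  intro g h
  exact tsum_congr fun x => by rw [mulOp_apply, mulOp_apply]; ring

theorem kernelOp_mul_mulOp (k : V → V → ℝ≥0∞) (a : V → ℝ≥0∞) :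
    kernelOp k * mulOp a = kernelOp fun x y => k x y * a y := by
  ext g x
  exact tsum_congr fun y => (mul_assoc _ _ _).symm

theorem mul_pow_mul_eq {R : Type*} [Monoid R] (a b : R) (n : ℕ) :
    (a * b) ^ n * a = a * (b * a) ^ n := by
  induction n with
  | zero => simp
  | succ n ih => rw [pow_succ', mul_assoc, ih, pow_succ' (b * a)]; simp only [mul_assoc]

variable (p : V → V → ℝ≥0∞) (C : Set V)

theorem kernelOp_killed : kernelOp (killed p C) = kernelOp p * mulOp (Cᶜ.indicator 1) :=
  (kernelOp_mul_mulOp _ _).symm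

theorem kernelOp_entry : kernelOp (entry p C) = kernelOp p * mulOp (C.indicator 1) :=
  (kernelOp_mul_mulOp _ _).symm

variable {p} {w : V → ℝ≥0∞}

/-- Reversibility of the chain passes to the hitting kernels of `C`, for starting points in `C`. -/
theorem hit_reversible (hrev : ∀ x y, w x * p x y = w y * p y x) (n : ℕ) (x y : V) :
    w x * C.indicator 1 x * hit p C n x y = w y * C.indicator 1 y * hit p C n y x := by
  classical
  have hP : IsAdj w (kernelOp p) (kernelOp p) := IsAdj.kernelOp hrev
  have hC := isAdj_mulOp w (C.indicator 1)
  have hN := isAdj_mulOp w (Cᶜ.indicator 1)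
  have e : mulOp (C.indicator 1) * kernelOp (hit p C n) = mulOp (C.indicator 1) *
      ((kernelOp p * mulOp (Cᶜ.indicator 1)) ^ n * kernelOp p) * mulOp (C.indicator 1) := by
    rw [kernelOp_hit, kernelOp_killed, kernelOp_entry]
    simp only [← mul_assoc]
  rw [← mul_assoc] at e
  have hadj : IsAdj w (mulOp (C.indicator 1) * kernelOp (hit p C n))
      (mulOp (C.indicator 1) * kernelOp (hit p C n)) := by
    have h := (hC.mul (((hP.mul hN).pow n).mul hP)).mul hC
    rwa [← mul_pow_mul_eq, ← mul_assoc, ← mul_assoc (mulOp (C.indicator 1)), ← mul_assoc, ← e] at h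
  have := hadj.apply_single x y
  simpa only [opMul_apply, mulOp_apply, kernelOp_single, ← mul_assoc] using this

theorem moment_reversible (hrev : ∀ x y, w x * p x y = w y * p y x) (φ : ℕ → ℝ≥0∞) (x y : V) :
    w x * C.indicator 1 x * moment p C φ x y = w y * C.indicator 1 y * moment p C φ y x := by
  simp only [moment, ← ENNReal.tsum_mul_left]
  refine tsum_congr fun n => ?_
  rw [mul_left_comm, hit_reversible C hrev, mul_left_comm]

/-- The last-exit form of reversibility: excursions from `x ∈ C` to `z` are reversed into paths
from `z` that first visit `C` at `x`. -/
theorem killed_pow_le [DecidableEq V] (hrev : ∀ x y, w x * p x y = w y * p y x) {x : V}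
    (hx : x ∈ C) (m : ℕ) (z : V) :
    w x * (kernelOp (killed p C) ^ (m + 1)) (Pi.single z 1) x ≤ w z * hit p C m z x := by
  have hP : IsAdj w (kernelOp p) (kernelOp p) := IsAdj.kernelOp hrev
  have hN := isAdj_mulOp w (Cᶜ.indicator 1)
  have h := ((hP.mul hN).pow (m + 1)).apply_single x z
  rw [kernelOp_killed, h]
  gcongr
  have hsing : (Pi.single x 1 : V → ℝ≥0∞) = mulOp (C.indicator 1) (Pi.single x 1) := by
    ext y
    rw [mulOp_apply]
    rcases eq_or_ne y x with rfl | hy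
    · simp [hx]
    · simp [hy]
  rw [pow_succ', mul_assoc, ← mul_pow_mul_eq, opMul_apply, mulOp_apply]
  conv_lhs => rw [hsing, ← opMul_apply, mul_assoc, ← kernelOp_entry p C, ← kernelOp_killed p C,
    ← kernelOp_hit, kernelOp_single]
  refine (mul_le_mul_left ?_ _).trans (one_mul _).le
  exact Set.indicator_le_self' (fun _ _ => zero_le) z

variable (p)

theorem killed_add_entry : kernelOp (killed p C) + kernelOp (entry p C) = kernelOp p := by
  ext g x
  rw [opAdd_apply, Pi.add_apply, kernelOp_apply, kernelOp_apply, kernelOp_apply,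
    ← ENNReal.tsum_add]
  refine tsum_congr fun y => ?_
  by_cases hy : y ∈ C <;> simp [killed, entry, hy]

variable {p}

theorem killed_pow_one_eq (hp : ∀ x, ∑' y, p x y = 1) (n : ℕ) :
    (kernelOp (killed p C) ^ n) 1 =
      (kernelOp (killed p C) ^ (n + 1)) 1 + kernelOp (hit p C n) 1 := by
  have h1 : kernelOp p 1 = 1 := by ext x; simpa [kernelOp_apply] using hp x
  conv_lhs => rw [← h1]
  rw [← killed_add_entry p C, opAdd_apply, map_add, kernelOp_hit, pow_succ]
  rfl

theorem sum_hit_add_killed (hp : ∀ x, ∑' y, p x y = 1) (N : ℕ) :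
    (∑ n ∈ Finset.range N, kernelOp (hit p C n) 1) + (kernelOp (killed p C) ^ N) 1 = 1 := by
  induction N with
  | zero => simp
  | succ N ih =>
    rw [Finset.sum_range_succ, add_assoc, add_comm (kernelOp (hit p C N) 1),
      ← killed_pow_one_eq C hp, ih]

theorem tsum_hit_add_le (hp : ∀ x, ∑' y, p x y = 1) (k : ℕ) (x : V) :
    ∑' n, kernelOp (hit p C (n + k)) 1 x ≤ (kernelOp (killed p C) ^ k) 1 x := by
  rw [ENNReal.tsum_eq_iSup_nat]
  refine iSup_le fun N => ?_
  have h : ∑ n ∈ Finset.range N, kernelOp (hit p C (n + k)) 1 =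
      (kernelOp (killed p C) ^ k) (∑ n ∈ Finset.range N, kernelOp (hit p C n) 1) := by
    rw [map_sum]
    refine Finset.sum_congr rfl fun n _ => ?_
    rw [kernelOp_hit, kernelOp_hit, add_comm, pow_add, mul_assoc]; rfl
  have h2 := congrFun h x
  rw [Finset.sum_apply] at h2
  rw [h2]
  refine opMono (kernelOp (killed p C) ^ k) (le_of_le_of_eq ?_ (sum_hit_add_killed C hp N)) x
  exact fun y => le_self_add

/-- The coarse-grained kernel is sub-Markov. -/
theorem tsum_moment_one_le (hp : ∀ x, ∑' y, p x y = 1) (x : V) :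
    ∑' y, moment p C 1 x y ≤ 1 := by
  have h := kernelOp_moment_apply p C 1 1 x
  rw [kernelOp_apply] at h
  simp only [Pi.one_apply, mul_one, one_mul] at h
  rw [h]
  simpa using tsum_hit_add_le C hp 0 x

/-- The mean duration of an excursion is at most the total occupation mass of the killed chain. -/
theorem kernelOp_moment_id_one_le (hp : ∀ x, ∑' y, p x y = 1) (x : V) :
    kernelOp (moment p C fun n => n + 1) 1 x ≤ ∑' k, (kernelOp (killed p C) ^ k) 1 x := by
  rw [kernelOp_moment_apply]
  have h1 : ∀ n : ℕ, ((n : ℝ≥0∞) + 1) * kernelOp (hit p C n) 1 x =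
      ∑' k, if k ≤ n then kernelOp (hit p C n) 1 x else 0 := by
    intro n
    rw [tsum_eq_sum (s := Finset.range (n + 1))]
    · rw [Finset.sum_congr rfl fun k hk => if_pos (by simpa [Nat.lt_succ_iff] using hk)]
      simp
    · intro k hk
      rw [if_neg (by simpa [Nat.lt_succ_iff] using hk)]
  simp only [h1]
  rw [ENNReal.tsum_comm]
  refine ENNReal.tsum_le_tsum fun k => le_trans ?_ (tsum_hit_add_le C hp k x)
  have h2 := (Summable.sum_add_tsum_nat_add' (k := k)
    (f := fun n => if k ≤ n then kernelOp (hit p C n) 1 x else 0) ENNReal.summable)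
  rw [← h2, Finset.sum_eq_zero, zero_add]
  · simp
  · intro n hn
    rw [if_neg (by simpa using hn)]

end Excursions

section WalkExcursions

variable {d : ℕ} [NeZero d] (ω : Env d)

theorem tsum_transProb (x : Vertex d) : ∑' y, transProb ω x y = 1 := (hasSum_transProb ω x).tsum_eq

/-- The reversing measure `π_ω`, with values in `[0, ∞]`. -/
def revWeight (x : Vertex d) : ℝ≥0∞ := ENNReal.ofReal (weight ω x)

omit [NeZero d] in
theorem revWeight_le (x : Vertex d) : revWeight ω x ≤ 3 ^ d := by
  refine (ENNReal.ofReal_le_ofReal (weight_le ω x)).trans ?_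
  rw [ENNReal.ofReal_pow (by norm_num)]; simp

theorem revWeight_mul_transProb (x y : Vertex d) :
    revWeight ω x * transProb ω x y = ENNReal.ofReal (conductance ω x y) := by
  rw [revWeight, transProb, ← ENNReal.ofReal_mul (weight_pos ω x).le,
    mul_div_cancel₀ _ (weight_pos ω x).ne']

theorem transProb_reversible (x y : Vertex d) :
    revWeight ω x * transProb ω x y = revWeight ω y * transProb ω y x := by
  rw [revWeight_mul_transProb, revWeight_mul_transProb, conductance_comm]

theorem transProb_pos {x y : Vertex d} (h : (lattice d).Adj x y) : 0 < transProb ω x y :=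
  ENNReal.ofReal_pos.2 (div_pos (conductance_pos h) (weight_pos ω x))

omit [NeZero d] in
theorem adj_of_transProb_ne_zero {x y : Vertex d} (h : transProb ω x y ≠ 0) :
    (lattice d).Adj x y := by
  by_contra hxy
  exact h (by simp [transProb, conductance, hxy])

omit [NeZero d] in
theorem le_weight_of_mem_cluster {ω : Env d} {α : ℝ} {x : Vertex d} (hx : x ∈ cluster ω α) :
    α ≤ weight ω x := by
  obtain ⟨γ, -, hγ, k, rfl⟩ := hx
  refine (hγ k).2.trans ?_
  exact Finset.single_le_sum (f := fun z => conductance ω (γ k) z)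
    (fun z _ => conductance_nonneg ω _ z) (by simpa using (hγ k).1)

variable {ω} {α : ℝ}

omit [NeZero d] in
/-- The killed walk started in `x` only visits `𝒢_x`. -/
theorem killed_pow_support {m : ℕ} {x z : Vertex d}
    (h : (kernelOp (killed (transProb ω) (cluster ω α)) ^ (m + 1)) (Pi.single z 1) x ≠ 0) :
    z ∈ weakNeighborhood ω α x := by
  have key : ∀ m x, (kernelOp (killed (transProb ω) (cluster ω α)) ^ (m + 1))
      (Pi.single z 1) x ≠ 0 → ∃ y, (lattice d).Adj x y ∧ y ∉ cluster ω α ∧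
        Reach (cluster ω α) m y z := by
    intro m
    induction m with
    | zero =>
      intro x h
      rw [zero_add, pow_one, kernelOp_single, killed, mul_ne_zero_iff] at h
      exact ⟨z, adj_of_transProb_ne_zero ω h.1, fun hz => h.2 (by simp [hz]), rfl⟩
    | succ m ih =>
      intro x h
      rw [pow_succ', opMul_apply, kernelOp_apply] at h
      obtain ⟨y, hy⟩ := ENNReal.summable.tsum_ne_zero_iff.1 h
      rw [mul_ne_zero_iff, killed, mul_ne_zero_iff] at hy
      have hyC : y ∉ cluster ω α := fun hz => hy.1.2 (by simp [hz])
      obtain ⟨y', h1, h2, h3⟩ := ih y hy.2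
      exact ⟨y, adj_of_transProb_ne_zero ω hy.1.1, hyC, y', ⟨h1, hyC, h2⟩, h3⟩
  obtain ⟨y, h1, -, h3⟩ := key m x h
  exact mem_weakNeighborhood_iff.2 ⟨y, h1, m, h3⟩

theorem kernelOp_pow_eq_tsum {V : Type*} [DecidableEq V] (k : V → V → ℝ≥0∞) (n : ℕ)
    (g : V → ℝ≥0∞) (x : V) :
    (kernelOp k ^ n) g x = ∑' z, (kernelOp k ^ n) (Pi.single z 1) x * g z := by
  obtain ⟨q, hq⟩ := exists_kernelOp_eq_pow k n
  simp only [hq, kernelOp_single]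
  rfl

/-- The occupation mass of the walk killed on the cluster is controlled by the size of `𝒢_x`. -/
theorem tsum_killed_pow_one_le (hα : 0 < α) {x : Vertex d} (hx : x ∈ cluster ω α) :
    ∑' k, (kernelOp (killed (transProb ω) (cluster ω α)) ^ k) 1 x ≤
      1 + 3 ^ d / ENNReal.ofReal α * nbhdSize ω α x := by
  have hαx : ENNReal.ofReal α ≤ revWeight ω x :=
    ENNReal.ofReal_le_ofReal (le_weight_of_mem_cluster hx)
  have hα0 : ENNReal.ofReal α ≠ 0 := (ENNReal.ofReal_pos.2 hα).ne'
  rw [tsum_eq_zero_add' ENNReal.summable, pow_zero]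
  refine add_le_add le_rfl ?_
  rw [nbhdSize_eq_kernelOp, kernelOp_apply, ← ENNReal.tsum_mul_left]
  calc _ = ∑' m, ∑' z, (kernelOp (killed (transProb ω) (cluster ω α)) ^ (m + 1))
        (Pi.single z 1) x := by
        refine tsum_congr fun m => ?_
        rw [kernelOp_pow_eq_tsum]; simp
    _ = ∑' z, ∑' m, (kernelOp (killed (transProb ω) (cluster ω α)) ^ (m + 1))
        (Pi.single z 1) x := ENNReal.tsum_comm
    _ ≤ _ := by
        refine ENNReal.tsum_le_tsum fun z => ?_
        by_cases hz : z ∈ weakNeighborhood ω α x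
        · simp only [nbhdKernel, Set.indicator_of_mem hz, Pi.one_apply, mul_one]
          rw [ENNReal.le_div_iff_mul_le (Or.inl hα0) (Or.inl ENNReal.ofReal_ne_top), mul_comm]
          calc _ ≤ revWeight ω x * ∑' m, (kernelOp (killed (transProb ω) (cluster ω α)) ^ (m + 1))
                  (Pi.single z 1) x := by gcongr
            _ ≤ revWeight ω z * ∑' m, hit (transProb ω) (cluster ω α) m z x := by
                rw [← ENNReal.tsum_mul_left, ← ENNReal.tsum_mul_left]
                exact ENNReal.tsum_le_tsum fun m =>
                  killed_pow_le (cluster ω α) (transProb_reversible ω) hx m z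
            _ ≤ revWeight ω z * 1 := by
                gcongr
                have h1 := tsum_moment_one_le (cluster ω α) (tsum_transProb ω) z
                refine le_trans ?_ ((ENNReal.le_tsum x).trans h1)
                simp [moment]
            _ ≤ _ := by rw [mul_one]; exact revWeight_le ω z
        · have : ∀ m, (kernelOp (killed (transProb ω) (cluster ω α)) ^ (m + 1))
              (Pi.single z 1) x = 0 := fun m => by
            by_contra h
            exact hz (killed_pow_support h)
          simp [this]

/-- The mean duration of an excursion from the cluster is controlled by the size of `𝒢_x`. -/
theorem kernelOp_moment_id_le (hα : 0 < α) {x : Vertex d} (hx : x ∈ cluster ω α) :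
    kernelOp (moment (transProb ω) (cluster ω α) fun n => n + 1) 1 x ≤
      1 + 3 ^ d / ENNReal.ofReal α * nbhdSize ω α x :=
  (kernelOp_moment_id_one_le _ (tsum_transProb ω) x).trans (tsum_killed_pow_one_le hα hx)

/-! ### Polynomial moments of excursions into finite components -/

variable (ω α) in
/-- The starting point `x` together with the vertices of `𝒢_x` outside the cluster. -/
def excursionSet (x : Vertex d) : Set (Vertex d) :=
  {z | z = x ∨ (z ∉ cluster ω α ∧ ∃ y, (lattice d).Adj x y ∧ y ∉ cluster ω α ∧
    ∃ n, Reach (cluster ω α) n y z)}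

omit [NeZero d] in
theorem Reach.snoc {C : Set (Vertex d)} {n : ℕ} {y z z' : Vertex d} (h : Reach C n y z)
    (hzz : (lattice d).Adj z z') (hz : z ∉ C) (hz' : z' ∉ C) : Reach C (n + 1) y z' := by
  induction n generalizing y with
  | zero => obtain rfl : y = z := h; exact ⟨z', ⟨hzz, hz, hz'⟩, rfl⟩
  | succ n ih =>
    obtain ⟨a, h1, h2⟩ := h
    exact ⟨a, h1, ih h2⟩

omit [NeZero d] in
theorem mem_excursionSet_of_adj {x z z' : Vertex d} (hz : z ∈ excursionSet ω α x)
    (hadj : (lattice d).Adj z z') (hz' : z' ∉ cluster ω α) : z' ∈ excursionSet ω α x := by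
  rcases hz with rfl | ⟨h1, y, h2, h3, n, h4⟩
  · exact Or.inr ⟨hz', z', hadj, hz', 0, rfl⟩
  · exact Or.inr ⟨hz', y, h2, h3, n + 1, h4.snoc hadj h1 hz'⟩

omit [NeZero d] in
theorem finite_excursionSet {x : Vertex d} (hfin : (weakNeighborhood ω α x).Finite) :
    (excursionSet ω α x).Finite := by
  refine (hfin.insert x).subset ?_
  rintro z (rfl | ⟨-, y, h1, -, n, h2⟩)
  · exact Or.inl rfl
  · exact Or.inr (mem_weakNeighborhood_iff.2 ⟨y, h1, n, h2⟩)

omit [NeZero d] in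
/-- The killed walk started in the excursion set of `x` stays there. -/
theorem killed_pow_mono_on {x : Vertex d} {g h : Vertex d → ℝ≥0∞}
    (hgh : ∀ z ∈ excursionSet ω α x, g z ≤ h z) (n : ℕ) :
    ∀ z ∈ excursionSet ω α x, (kernelOp (killed (transProb ω) (cluster ω α)) ^ n) g z ≤
      (kernelOp (killed (transProb ω) (cluster ω α)) ^ n) h z := by
  induction n with
  | zero => exact hgh
  | succ n ih =>
    intro z hz
    simp only [pow_succ', opMul_apply, kernelOp_apply]
    refine ENNReal.tsum_le_tsum fun z' => ?_
    rcases eq_or_ne (killed (transProb ω) (cluster ω α) z z') 0 with h0 | h0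
    · simp [h0]
    · rw [killed, mul_ne_zero_iff] at h0
      gcongr
      exact ih z' (mem_excursionSet_of_adj hz (adj_of_transProb_ne_zero ω h0.1)
        fun hz' => h0.2 (by simp [hz']))

theorem killed_pow_pos_of_reach {n : ℕ} {y z : Vertex d} (h : Reach (cluster ω α) n y z) :
    0 < (kernelOp (killed (transProb ω) (cluster ω α)) ^ n) (Pi.single z 1) y := by
  induction n generalizing y with
  | zero => obtain rfl : y = z := h; simp
  | succ n ih =>
    obtain ⟨a, ⟨h1, -, h3⟩, h4⟩ := h
    rw [pow_succ', opMul_apply, kernelOp_apply]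
    refine lt_of_lt_of_le ?_ (ENNReal.le_tsum a)
    refine ENNReal.mul_pos ?_ (ih h4).ne'
    simpa [killed, h3] using (transProb_pos ω h1).ne'

theorem kernelOp_pow_tsum {V ι : Type*} (k : V → V → ℝ≥0∞) (n : ℕ) (g : ι → V → ℝ≥0∞) (x : V) :
    (kernelOp k ^ n) (fun y => ∑' i, g i y) x = ∑' i, (kernelOp k ^ n) (g i) x := by
  obtain ⟨q, hq⟩ := exists_kernelOp_eq_pow k n
  rw [hq]; exact kernelOp_tsum q g x

/-- The Green function of the walk killed on the cluster is finite on finite components: it is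
finite at the starting point `x` in the cluster, from which every vertex of the component is reached
with positive probability. -/
theorem tsum_killed_pow_lt_top (hα : 0 < α) {x : Vertex d} (hx : x ∈ cluster ω α)
    (hfin : (weakNeighborhood ω α x).Finite) {z : Vertex d} (hz : z ∈ excursionSet ω α x) :
    ∑' k, (kernelOp (killed (transProb ω) (cluster ω α)) ^ k) 1 z < ∞ := by
  have hx' : ∑' k, (kernelOp (killed (transProb ω) (cluster ω α)) ^ k) 1 x < ∞ := by
    refine (tsum_killed_pow_one_le hα hx).trans_lt ?_
    refine ENNReal.add_lt_top.2 ⟨ENNReal.one_lt_top, ENNReal.mul_lt_top ?_ ?_⟩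
    · exact ENNReal.div_lt_top (by simp) (ENNReal.ofReal_pos.2 hα).ne'
    · rw [nbhdSize, hfin.encard_eq_coe]; simp
  rcases hz with rfl | ⟨-, y, h1, h2, n, h3⟩
  · exact hx'
  · set k := killed (transProb ω) (cluster ω α) with hk
    have hpos : 0 < (kernelOp k ^ (n + 1)) (Pi.single z 1) x := by
      rw [pow_succ', opMul_apply, kernelOp_apply]
      refine lt_of_lt_of_le ?_ (ENNReal.le_tsum y)
      refine ENNReal.mul_pos ?_ (killed_pow_pos_of_reach h3).ne'
      simpa [hk, killed, h2] using (transProb_pos ω h1).ne'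
    have hle : (kernelOp k ^ (n + 1)) (Pi.single z 1) x * ∑' i, (kernelOp k ^ i) 1 z ≤
        ∑' i, (kernelOp k ^ i) 1 x := by
      calc _ ≤ ∑' y, (kernelOp k ^ (n + 1)) (Pi.single y 1) x * ∑' i, (kernelOp k ^ i) 1 y :=
            ENNReal.le_tsum (f := fun y => (kernelOp k ^ (n + 1)) (Pi.single y 1) x *
              ∑' i, (kernelOp k ^ i) 1 y) z
        _ = (kernelOp k ^ (n + 1)) (fun y => ∑' i, (kernelOp k ^ i) 1 y) x :=
            (kernelOp_pow_eq_tsum _ _ _ _).symm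
        _ = ∑' i, (kernelOp k ^ (n + 1 + i)) 1 x := by
            rw [kernelOp_pow_tsum]
            exact tsum_congr fun i => by rw [pow_add _ (n + 1) i]; rfl
        _ ≤ _ := by
            have := ENNReal.tsum_comp_le_tsum_of_injective (f := fun i => n + 1 + i)
              (add_right_injective (n + 1)) fun i => (kernelOp k ^ i) 1 x
            exact this
    by_contra htop
    rw [not_lt_top_iff] at htop
    rw [htop, ENNReal.mul_top hpos.ne'] at hle
    exact absurd hx' (not_lt.2 hle)

theorem succ_pow_le_sum (q k : ℕ) :
    (k + 1) ^ (q + 1) ≤ (q + 1) * ∑ i ∈ Finset.range (k + 1), (i + 1) ^ q := by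
  induction k with
  | zero => simp
  | succ k ih =>
    rw [Finset.sum_range_succ, mul_add]
    refine le_trans ?_ (Nat.add_le_add_right ih _)
    -- Bernoulli's inequality in the form `(a + 1)^(q + 1) ≤ a^(q + 1) + (q + 1) (a + 1)^q`
    have hb : ∀ a q : ℕ, (a + 1) ^ (q + 1) ≤ a ^ (q + 1) + (q + 1) * (a + 1) ^ q := by
      intro a q
      induction q with
      | zero => simp
      | succ q ihq =>
        calc (a + 1) ^ (q + 1 + 1) = a * (a + 1) ^ (q + 1) + (a + 1) ^ (q + 1) := by ring
          _ ≤ a * (a ^ (q + 1) + (q + 1) * (a + 1) ^ q) + (a + 1) ^ (q + 1) := by gcongr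
          _ ≤ (a * a ^ (q + 1) + (q + 1) * ((a + 1) * (a + 1) ^ q)) + (a + 1) ^ (q + 1) := by
              have : a * ((q + 1) * (a + 1) ^ q) ≤ (q + 1) * ((a + 1) * (a + 1) ^ q) := by
                nlinarith [Nat.zero_le ((q + 1) * (a + 1) ^ q)]
              nlinarith
          _ = _ := by ring
    exact hb (k + 1) q

/-- Finiteness of polynomially weighted occupation masses, by induction on the degree: a uniform
bound on the Green function bounds the mass of the times after `i` by the mass at time `i`. -/
theorem tsum_pow_mul_killed_lt_top (hα : 0 < α) {x : Vertex d} (hx : x ∈ cluster ω α)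
    (hfin : (weakNeighborhood ω α x).Finite) (q : ℕ) :
    ∀ z ∈ excursionSet ω α x,
      ∑' k : ℕ, ((k : ℝ≥0∞) + 1) ^ q * (kernelOp (killed (transProb ω) (cluster ω α)) ^ k) 1 z
        < ∞ := by
  set K := kernelOp (killed (transProb ω) (cluster ω α)) with hK
  have hT := finite_excursionSet hfin
  -- a uniform bound on the occupation mass
  obtain ⟨M, hM, hMz⟩ : ∃ M : ℝ≥0∞, M < ∞ ∧
      ∀ z ∈ excursionSet ω α x, ∑' k, (K ^ k) 1 z ≤ M := by
    refine ⟨∑ z ∈ hT.toFinset, ∑' k, (K ^ k) 1 z, ?_, fun z hz => ?_⟩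
    · exact ENNReal.sum_lt_top.2 fun z hz =>
        tsum_killed_pow_lt_top hα hx hfin (hT.mem_toFinset.1 hz)
    · exact Finset.single_le_sum (f := fun z => ∑' k, (K ^ k) 1 z) (fun _ _ => zero_le)
        (hT.mem_toFinset.2 hz)
  induction q with
  | zero =>
    intro z hz
    simpa using tsum_killed_pow_lt_top hα hx hfin hz
  | succ q ih =>
    intro z hz
    have h1 : ∀ k : ℕ, ((k : ℝ≥0∞) + 1) ^ (q + 1) ≤
        (q + 1) * ∑' i : ℕ, if i ≤ k then ((i : ℝ≥0∞) + 1) ^ q else 0 := by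
      intro k
      have := succ_pow_le_sum q k
      rw [tsum_eq_sum (s := Finset.range (k + 1))
        fun i hi => if_neg (by simpa [Nat.lt_succ_iff] using hi),
        Finset.sum_congr rfl fun i hi => if_pos (by simpa [Nat.lt_succ_iff] using hi)]
      exact_mod_cast this
    calc _ ≤ ∑' k : ℕ, ((q + 1) * ∑' i : ℕ, if i ≤ k then ((i : ℝ≥0∞) + 1) ^ q else 0) *
          (K ^ k) 1 z := ENNReal.tsum_le_tsum fun k => mul_le_mul_left (h1 k) _
      _ = (q + 1) * ∑' i : ℕ, ((i : ℝ≥0∞) + 1) ^ q * ∑' k : ℕ, if i ≤ k then (K ^ k) 1 z else 0 := by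
          simp only [mul_assoc]
          rw [ENNReal.tsum_mul_left]
          congr 1
          simp only [← ENNReal.tsum_mul_left, ← ENNReal.tsum_mul_right]
          rw [ENNReal.tsum_comm]
          exact tsum_congr fun i => tsum_congr fun k => by split_ifs <;> simp
      _ ≤ (q + 1) * ∑' i : ℕ, ((i : ℝ≥0∞) + 1) ^ q * (M * (K ^ i) 1 z) := by
          gcongr with i
          have h2 := (Summable.sum_add_tsum_nat_add' (k := i)
            (f := fun k => if i ≤ k then (K ^ k) 1 z else 0) ENNReal.summable)
          rw [← h2, Finset.sum_eq_zero fun n hn => if_neg (by simpa using hn), zero_add]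
          simp only [le_add_iff_nonneg_left, zero_le, if_true]
          calc ∑' n, (K ^ (n + i)) 1 z = (K ^ i) (fun y => ∑' n, (K ^ n) 1 y) z := by
                rw [hK, kernelOp_pow_tsum]
                exact tsum_congr fun n => by rw [add_comm, pow_add]; rfl
            _ ≤ (K ^ i) (fun y => M * (1 : Vertex d → ℝ≥0∞) y) z :=
                killed_pow_mono_on (fun y hy => by simpa using hMz y hy) i z hz
            _ = M * (K ^ i) 1 z := kernelOp_pow_const_mul _ _ _ _ _
      _ = (q + 1) * (M * ∑' i : ℕ, ((i : ℝ≥0∞) + 1) ^ q * (K ^ i) 1 z) := by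
          rw [← ENNReal.tsum_mul_left (a := M)]
          congr 1
          exact tsum_congr fun i => by ring
      _ < ∞ := by
          refine ENNReal.mul_lt_top ?_ (ENNReal.mul_lt_top hM (ih z hz))
          exact ENNReal.add_lt_top.2 ⟨ENNReal.natCast_lt_top q, ENNReal.one_lt_top⟩

omit [NeZero d] in
theorem hit_support {x : Vertex d} {n : ℕ} : ∀ {z : Vertex d} {y : Vertex d},
    z ∈ excursionSet ω α x → hit (transProb ω) (cluster ω α) n z y ≠ 0 →
      y ∈ cluster ω α ∧ ∃ z' ∈ excursionSet ω α x, (lattice d).Adj z' y := by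
  induction n with
  | zero =>
    intro z y hz h
    rw [hit, entry, mul_ne_zero_iff] at h
    refine ⟨?_, z, hz, adj_of_transProb_ne_zero ω h.1⟩
    by_contra hy
    exact h.2 (by simp [hy])
  | succ n ih =>
    intro z y hz h
    obtain ⟨a, ha⟩ := ENNReal.summable.tsum_ne_zero_iff.1 h
    rw [mul_ne_zero_iff, killed, mul_ne_zero_iff] at ha
    exact ih (mem_excursionSet_of_adj hz (adj_of_transProb_ne_zero ω ha.1.1)
      fun hz' => ha.1.2 (by simp [hz'])) ha.2

omit [NeZero d] in
theorem moment_support {φ : ℕ → ℝ≥0∞} {x y : Vertex d}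
    (h : moment (transProb ω) (cluster ω α) φ x y ≠ 0) :
    y ∈ cluster ω α ∧ ∃ z' ∈ excursionSet ω α x, (lattice d).Adj z' y := by
  obtain ⟨n, hn⟩ := ENNReal.summable.tsum_ne_zero_iff.1 h
  exact hit_support (Or.inl rfl) (right_ne_zero_of_mul hn)

/-- If all components are finite, then polynomial moments of a bounded number of excursions are
finite. -/
theorem kernelOp_moment_pow_lt_top (hα : 0 < α)
    (hfin : ∀ x ∈ cluster ω α, (weakNeighborhood ω α x).Finite) (q l : ℕ) :
    ∀ x ∈ cluster ω α, (kernelOp (moment (transProb ω) (cluster ω α)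
      fun n => ((n : ℝ≥0∞) + 2) ^ q) ^ l) 1 x < ∞ := by
  have h1 : ∀ x ∈ cluster ω α, kernelOp (moment (transProb ω) (cluster ω α)
      fun n => ((n : ℝ≥0∞) + 2) ^ q) 1 x < ∞ := by
    intro x hx
    have h2 := tsum_pow_mul_killed_lt_top hα hx (hfin x hx) q x (Or.inl rfl)
    rw [kernelOp_moment_apply]
    calc _ ≤ ∑' k : ℕ, 2 ^ q * (((k : ℝ≥0∞) + 1) ^ q *
          (kernelOp (killed (transProb ω) (cluster ω α)) ^ k) 1 x) := by
          refine ENNReal.tsum_le_tsum fun k => ?_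
          rw [← mul_assoc, ← mul_pow]
          gcongr
          · calc (k : ℝ≥0∞) + 2 ≤ (k : ℝ≥0∞) + 2 + k := le_self_add
              _ = _ := by ring
          · rw [killed_pow_one_eq _ (tsum_transProb ω), Pi.add_apply]
            exact le_add_self
      _ < ∞ := by
          rw [ENNReal.tsum_mul_left]
          exact ENNReal.mul_lt_top (by simp) h2
  induction l with
  | zero => intro x _; simp
  | succ l ih =>
    intro x hx
    rw [pow_succ', opMul_apply, kernelOp_apply]
    have hB : (⋃ z ∈ excursionSet ω α x, (lattice d).neighborSet z).Finite :=
      (finite_excursionSet (hfin x hx)).biUnion fun z _ => finite_neighborSet z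
    rw [tsum_eq_sum (s := hB.toFinset)]
    · refine ENNReal.sum_lt_top.2 fun y _ => ?_
      by_cases hy : y ∈ cluster ω α
      · refine ENNReal.mul_lt_top (lt_of_le_of_lt ?_ (h1 x hx)) (ih y hy)
        rw [kernelOp_apply]
        refine le_trans ?_ (ENNReal.le_tsum y)
        simp
      · have : moment (transProb ω) (cluster ω α) (fun n => ((n : ℝ≥0∞) + 2) ^ q) x y = 0 := by
          by_contra h
          exact hy (moment_support h).1
        simp [this]
    · intro y hy
      have : moment (transProb ω) (cluster ω α) (fun n => ((n : ℝ≥0∞) + 2) ^ q) x y = 0 := by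
        by_contra h
        obtain ⟨-, z, hz, hzy⟩ := moment_support h
        exact hy (hB.mem_toFinset.2 (Set.mem_biUnion hz hzy))
      simp [this]

end WalkExcursions


/-! ### Comparison of the clusters at two levels -/

section Comparison

variable {d : ℕ}

theorem cluster_anti (ω : Env d) {α α' : ℝ} (h : α ≤ α') : cluster ω α' ⊆ cluster ω α := by
  rintro x ⟨γ, h1, h2, h3⟩
  exact ⟨γ, h1, fun k => ⟨(h2 k).1, h.trans (h2 k).2⟩, h3⟩

theorem Reach.trans {C : Set (Vertex d)} {m n : ℕ} {x y z : Vertex d} (h : Reach C m x y)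
    (h' : Reach C n y z) : ∃ k, Reach C k x z := by
  induction m generalizing x with
  | zero => obtain rfl : x = y := h; exact ⟨n, h'⟩
  | succ m ih =>
    obtain ⟨a, h1, h2⟩ := h
    obtain ⟨k, hk⟩ := ih h2
    exact ⟨k + 1, a, h1, hk⟩

theorem Reach.mono {C C' : Set (Vertex d)} (hC : C' ⊆ C) {n : ℕ} {x y : Vertex d}
    (h : Reach C n x y) : Reach C' n x y := by
  induction n generalizing x with
  | zero => exact h
  | succ n ih =>
    obtain ⟨a, ⟨h1, h2, h3⟩, h4⟩ := h
    exact ⟨a, ⟨h1, fun hx => h2 (hC hx), fun ha => h3 (hC ha)⟩, ih h4⟩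

theorem weakNeighborhood_anti (ω : Env d) {α α' : ℝ} (h : α ≤ α') (x : Vertex d) :
    weakNeighborhood ω α x ⊆ weakNeighborhood ω α' x := by
  intro z hz
  obtain ⟨y, h1, n, h2⟩ := mem_weakNeighborhood_iff.1 hz
  exact mem_weakNeighborhood_iff.2 ⟨y, h1, n, h2.mono (cluster_anti ω h)⟩

theorem lattice_connected (x y : Vertex d) :
    Relation.ReflTransGen (lattice d).Adj x y := by
  let S : AddSubgroup (Vertex d) :=
    { carrier := {v | ∀ x, Relation.ReflTransGen (lattice d).Adj x (x + v)}
      zero_mem' := fun x => by rw [add_zero]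
      add_mem' := fun {a b} ha hb x => by
        rw [← add_assoc]; exact (ha x).trans (hb (x + a))
      neg_mem' := fun {a} ha x => by
        have := ha (x + -a)
        rw [neg_add_cancel_right] at this
        have : Std.Symm (lattice d).Adj := (lattice d).symm
        exact Relation.ReflTransGen.stdSymm.symm _ _ ‹_› }
  have hsingle : ∀ i, Pi.single i 1 ∈ S := by
    intro i x
    refine Relation.ReflTransGen.single ?_
    have h : ∀ j, |x j - (x + Pi.single i 1 : Vertex d) j| = if j = i then 1 else 0 := by
      intro j
      by_cases hj : j = i
      · subst hj; simp
      · simp [hj]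
    change ∑ j, |x j - (x + Pi.single i 1 : Vertex d) j| = 1
    simp only [h, Finset.sum_ite_eq', Finset.mem_univ, if_true]
  have hall : ∀ v, v ∈ S := by
    intro v
    rw [← Finset.univ_sum_single v]
    refine AddSubgroup.sum_mem S fun i _ => ?_
    have : (Pi.single i (v i) : Vertex d) = v i • Pi.single i 1 := by
      rw [← Pi.single_smul]; simp
    rw [this]
    exact S.zsmul_mem (hsingle i) _
  have := hall (y - x) x
  rwa [add_sub_cancel] at this

/-- A vertex outside a nonempty set `C` is connected, outside `C`, to a neighbour of `C`. -/
theorem exists_adj_reach {C : Set (Vertex d)} (hC : C.Nonempty) {x : Vertex d} (hx : x ∉ C) :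
    ∃ z ∈ C, ∃ y, (lattice d).Adj z y ∧ ∃ n, Reach C n y x := by
  obtain ⟨c, hc⟩ := hC
  have key : ∀ y, Relation.ReflTransGen (lattice d).Adj x y →
      (y ∉ C ∧ ∃ n, Reach C n y x) ∨
        ∃ z ∈ C, ∃ y, (lattice d).Adj z y ∧ ∃ n, Reach C n y x := by
    intro y h
    induction h with
    | refl => exact Or.inl ⟨hx, 0, rfl⟩
    | @tail y z _ hyz ih =>
      rcases ih with ⟨h1, n, h2⟩ | h
      · by_cases hz : z ∈ C
        · exact Or.inr ⟨z, hz, y, hyz.symm, n, h2⟩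
        · exact Or.inl ⟨hz, n + 1, y, ⟨hyz.symm, hz, h1⟩, h2⟩
      · exact Or.inr h
  rcases key c (lattice_connected x c) with ⟨h, -⟩ | h
  · exact absurd hc h
  · exact h

/-- Outside the stronger cluster, `𝒢_x` is contained, up to the neighbours of `x`, in the
neighbourhood `𝒢_z` of some vertex `z` of the stronger cluster with `x ∈ 𝒢_z`. -/
theorem exists_nbhdSize_le {ω : Env d} {α α' : ℝ} (h : α ≤ α') (hne : (cluster ω α').Nonempty)
    {x : Vertex d} (hx : x ∉ cluster ω α') :
    ∃ z ∈ cluster ω α', x ∈ weakNeighborhood ω α' z ∧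
      nbhdSize ω α x ≤ nbhdSize ω α' z + 3 ^ d := by
  obtain ⟨z, hz, y, hzy, n, hyx⟩ := exists_adj_reach hne hx
  refine ⟨z, hz, mem_weakNeighborhood_iff.2 ⟨y, hzy, n, hyx⟩, ?_⟩
  have hsub : weakNeighborhood ω α x ⊆
      weakNeighborhood ω α' z ∪ ((lattice d).neighborFinset x : Set (Vertex d)) := by
    intro v hv
    obtain ⟨a, hxa, m, hav⟩ := mem_weakNeighborhood_iff.1 (weakNeighborhood_anti ω h x hv)
    by_cases ha : a ∈ cluster ω α'
    · have : a = v := by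
        cases m with
        | zero => exact hav
        | succ m => obtain ⟨_, ⟨-, h2, -⟩, -⟩ := hav; exact absurd ha h2
      subst this
      exact Or.inr (by simpa using hxa)
    · obtain ⟨k, hk⟩ := (hyx.snoc hxa hx ha).trans hav
      exact Or.inl (mem_weakNeighborhood_iff.2 ⟨y, hzy, k, hk⟩)
  have h1 := (Set.encard_le_encard hsub).trans (Set.encard_union_le _ _)
  have h2 : ((((lattice d).neighborFinset x : Set (Vertex d)).encard : ℕ∞) : ℝ≥0∞) ≤ 3 ^ d := by
    rw [Set.encard_coe_eq_coe_finsetCard]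
    exact_mod_cast card_neighborFinset_le x
  calc nbhdSize ω α x ≤ ((weakNeighborhood ω α' z).encard +
        ((lattice d).neighborFinset x : Set (Vertex d)).encard : ℕ∞) := by
        exact ENat.toENNReal_mono h1
    _ ≤ _ := by
        rw [ENat.toENNReal_add]
        exact add_le_add le_rfl h2

end Comparison

/-! ### Moments of the weak components -/

section ComponentMoments

variable {d : ℕ} {P : Measure (Env d)}

theorem add_pow_le_two_pow (a b : ℝ≥0∞) (n : ℕ) : (a + b) ^ n ≤ 2 ^ n * (a ^ n + b ^ n) := by
  wlog h : a ≤ b generalizing a b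
  · rw [add_comm a b, add_comm (a ^ n)]; exact this b a (le_of_not_ge h)
  calc (a + b) ^ n ≤ (2 * b) ^ n := by
        refine pow_le_pow_left' ?_ n
        rw [two_mul]; exact add_le_add_left h b
    _ = 2 ^ n * b ^ n := mul_pow _ _ _
    _ ≤ _ := mul_le_mul_right le_add_self _

theorem IsCovKernel.swap {k : Env d → Vertex d → Vertex d → ℝ≥0∞} (hk : IsCovKernel k) :
    IsCovKernel fun ω x y => k ω y x := ⟨fun x y => hk.meas y x, fun z ω x y => hk.cov z ω y x⟩

theorem lintegral_affine_pow_lt_top [IsProbabilityMeasure P] {s g : Env d → ℝ≥0∞}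
    (hs : ∀ ω, s ω ≤ 1) (hsm : Measurable s)
    (hg : ∀ n : ℕ, ∫⁻ ω, s ω * g ω ^ n ∂P < ∞) {a b : ℝ≥0∞} (ha : a ≠ ∞) (hb : b ≠ ∞) (n : ℕ) :
    ∫⁻ ω, s ω * (a + b * g ω) ^ n ∂P < ∞ := by
  calc _ ≤ ∫⁻ ω, 2 ^ n * a ^ n * s ω + 2 ^ n * b ^ n * (s ω * g ω ^ n) ∂P := by
        refine lintegral_mono fun ω => ?_
        calc s ω * (a + b * g ω) ^ n ≤ s ω * (2 ^ n * (a ^ n + (b * g ω) ^ n)) := by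
              gcongr; exact add_pow_le_two_pow _ _ _
          _ = _ := by rw [mul_pow]; ring
    _ = 2 ^ n * a ^ n * ∫⁻ ω, s ω ∂P + 2 ^ n * b ^ n * ∫⁻ ω, s ω * g ω ^ n ∂P := by
        rw [lintegral_add_left (hsm.const_mul _), lintegral_const_mul _ hsm,
          lintegral_const_mul' _ _ (ENNReal.mul_ne_top (by simp) (ENNReal.pow_ne_top hb))]
    _ < ∞ := by
        refine ENNReal.add_lt_top.2 ⟨ENNReal.mul_lt_top ?_ ?_, ENNReal.mul_lt_top ?_ (hg n)⟩
        · exact ENNReal.mul_lt_top (by simp) (ENNReal.pow_lt_top ha.lt_top)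
        · calc ∫⁻ ω, s ω ∂P ≤ ∫⁻ _, 1 ∂P := lintegral_mono hs
            _ < ∞ := by simp
        · exact ENNReal.mul_lt_top (by simp) (ENNReal.pow_lt_top hb.lt_top)

theorem indicator_one_le (s : Set (Vertex d)) (x : Vertex d) :
    s.indicator (1 : Vertex d → ℝ≥0∞) x ≤ 1 := Set.indicator_le_self' (fun _ _ => zero_le) x

/-- Moments of `|𝒢₀|` on the event that `0` belongs to the cluster pass from a level to all
smaller levels. If `0` lies in the larger cluster but not in the smaller one, then `0 ∈ 𝒢_z` for some
`z` in the smaller cluster with `|𝒢₀| ≤ |𝒢_z| + 3 ^ d`, and mass transport moves the expectation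
to `z`. -/
theorem lintegral_nbhdSize_pow_lt_top [IsProbabilityMeasure P]
    (hP : ∀ x, MeasurePreserving (shift x) P P) {α α' : ℝ} (hle : α ≤ α')
    (hne : ∀ᵐ ω ∂P, (cluster ω α').Nonempty)
    (hM : ∀ n : ℕ, ∫⁻ ω, (cluster ω α').indicator 1 0 * nbhdSize ω α' 0 ^ n ∂P < ∞) (n : ℕ) :
    ∫⁻ ω, (cluster ω α).indicator 1 0 * nbhdSize ω α 0 ^ n ∂P < ∞ := by
  let v : Env d → Vertex d → ℝ≥0∞ := fun ω x =>
    (cluster ω α').indicator 1 x * (3 ^ d + 1 * nbhdSize ω α' x) ^ n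
  have hv : IsCov v := (isCov_indicator_cluster α').mul
    (((IsCov.const _).add ((IsCov.const 1).mul (isCov_nbhdSize α'))).pow n)
  -- the mass sent from `x` to `y` when `x ∈ 𝒢_y`
  let m : Env d → Vertex d → Vertex d → ℝ≥0∞ := fun ω x y => nbhdKernel ω α' y x * v ω y
  have hm : IsCovKernel m := (isCovKernel_nbhdKernel α').swap.mul hv.kernel
  have hpt : ∀ᵐ ω ∂P, (cluster ω α).indicator 1 0 * nbhdSize ω α 0 ^ n ≤
      (cluster ω α').indicator 1 0 * nbhdSize ω α' 0 ^ n + ∑' y, m ω 0 y := by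
    filter_upwards [hne] with ω hω
    refine (mul_le_mul_left (indicator_one_le _ _) _).trans ?_
    rw [one_mul]
    by_cases h0 : (0 : Vertex d) ∈ cluster ω α'
    · rw [Set.indicator_of_mem h0, Pi.one_apply, one_mul]
      refine le_trans (pow_le_pow_left' ?_ n) le_self_add
      exact ENat.toENNReal_mono (Set.encard_le_encard (weakNeighborhood_anti ω hle 0))
    · obtain ⟨z, hz, hz0, hsz⟩ := exists_nbhdSize_le hle hω h0
      refine le_trans ?_ (le_trans (ENNReal.le_tsum z) le_add_self)
      simp only [m, v, nbhdKernel, Set.indicator_of_mem hz0, Set.indicator_of_mem hz, Pi.one_apply,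
        one_mul]
      refine pow_le_pow_left' ?_ n
      rwa [add_comm]
  have hmass : ∫⁻ ω, ∑' y, m ω 0 y ∂P < ∞ := by
    rw [massTransport hP hm]
    calc _ = ∫⁻ ω, nbhdSize ω α' 0 * v ω 0 ∂P := by
          refine lintegral_congr fun ω => ?_
          simp only [m, ENNReal.tsum_mul_right]
          rw [nbhdSize_eq_kernelOp, kernelOp_apply]; simp
      _ ≤ ∫⁻ ω, (cluster ω α').indicator 1 0 * (3 ^ d + 1 * nbhdSize ω α' 0) ^ (n + 1) ∂P := by
          refine lintegral_mono fun ω => ?_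
          change nbhdSize ω α' 0 * ((cluster ω α').indicator 1 0 *
            (3 ^ d + 1 * nbhdSize ω α' 0) ^ n) ≤ _
          rw [pow_succ, mul_left_comm, mul_comm (nbhdSize ω α' 0)]
          gcongr
          rw [one_mul]; exact le_add_self
      _ < ∞ := lintegral_affine_pow_lt_top (fun ω => indicator_one_le _ _)
          ((isCov_indicator_cluster α').meas 0) hM (by simp) (by simp) _
  calc _ ≤ ∫⁻ ω, (cluster ω α').indicator 1 0 * nbhdSize ω α' 0 ^ n + ∑' y, m ω 0 y ∂P :=
        lintegral_mono_ae hpt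
    _ = _ := lintegral_add_left
        (((isCov_indicator_cluster α').mul ((isCov_nbhdSize α').pow n)).meas 0) _
    _ < ∞ := ENNReal.add_lt_top.2 ⟨hM n, hmass⟩

/-- Conditioning on `0 ∈ 𝒞_{∞,α}` multiplies the moments by a factor at least one. -/
theorem lintegral_nbhdSize_of_allMoments [IsProbabilityMeasure P] {α : ℝ} (h : AllMoments P α)
    (n : ℕ) : ∫⁻ ω, (cluster ω α).indicator 1 0 * nbhdSize ω α 0 ^ n ∂P < ∞ := by
  have hmeas := measurableSet_mem_cluster (d := d) α 0
  rcases Nat.eq_zero_or_pos n with rfl | hn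
  · calc _ ≤ ∫⁻ _ω : Env d, 1 ∂P := lintegral_mono fun ω => by
          simpa using indicator_one_le (cluster ω α) 0
      _ < ∞ := by simp
  · have h1 := h n (by exact_mod_cast hn)
    simp only [ENNReal.rpow_natCast] at h1
    rw [condLaw, ProbabilityTheory.cond, lintegral_smul_measure] at h1
    have h2 : ∫⁻ ω, (cluster ω α).indicator 1 0 * nbhdSize ω α 0 ^ n ∂P =
        ∫⁻ ω in {ω | (0 : Vertex d) ∈ cluster ω α}, nbhdSize ω α 0 ^ n ∂P := by
      rw [← lintegral_indicator hmeas]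
      refine lintegral_congr fun ω => ?_
      by_cases hω : (0 : Vertex d) ∈ cluster ω α
      · rw [Set.indicator_of_mem hω, Set.indicator_of_mem
          (show ω ∈ {ω : Env d | (0 : Vertex d) ∈ cluster ω α} from hω)]; simp
      · rw [Set.indicator_of_notMem hω, Set.indicator_of_notMem
          (show ω ∉ {ω : Env d | (0 : Vertex d) ∈ cluster ω α} from hω)]; simp
    rw [h2]
    refine lt_of_le_of_lt ?_ h1
    have : (1 : ℝ≥0∞) ≤ (P {ω | (0 : Vertex d) ∈ cluster ω α})⁻¹ :=
      ENNReal.one_le_inv.2 prob_le_one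
    calc _ = 1 * ∫⁻ ω in {ω | (0 : Vertex d) ∈ cluster ω α}, nbhdSize ω α 0 ^ n ∂P :=
          (one_mul _).symm
      _ ≤ _ := mul_le_mul_left this _

/-- Below `α₁` the cluster is almost surely nonempty, by ergodicity. -/
theorem ae_nonempty_cluster [IsProbabilityMeasure P] (herg : ShiftErgodic P) {α : ℝ}
    (hα : α ∈ Set.Ioo 0 (alphaOne P)) : ∀ᵐ ω ∂P, (cluster ω α).Nonempty := by
  have hset : {ω : Env d | (cluster ω α).Nonempty} = ⋃ x, {ω | x ∈ cluster ω α} := by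
    ext ω; simp [Set.Nonempty]
  have hmeas : MeasurableSet {ω : Env d | (cluster ω α).Nonempty} := by
    rw [hset]; exact MeasurableSet.iUnion fun x => measurableSet_mem_cluster α x
  have hinv : ∀ x, shift x ⁻¹' {ω : Env d | (cluster ω α).Nonempty} =
      {ω | (cluster ω α).Nonempty} := by
    intro x
    ext ω
    simp only [Set.mem_preimage, Set.mem_ofPred_eq, Set.Nonempty, mem_cluster_shift]
    exact ⟨fun ⟨y, hy⟩ => ⟨_, hy⟩, fun ⟨y, hy⟩ => ⟨y - x, by simpa using hy⟩⟩
  rcases herg.2 _ hmeas hinv with h0 | h1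
  · exfalso
    have h2 : P {ω | (0 : Vertex d) ∈ cluster ω α} = 0 :=
      measure_mono_null (fun ω (hω : (0 : Vertex d) ∈ cluster ω α) =>
        (⟨0, hω⟩ : (cluster ω α).Nonempty)) h0
    have h3 : alphaOne P ≤ α := csInf_le ⟨0, fun a ha => ha.1.le⟩ ⟨hα.1, h2⟩
    exact absurd hα.2 (not_lt.2 h3)
  · rwa [← prob_compl_eq_zero_iff hmeas] at h1

/-- Below `α₂`, all moments of `|𝒢₀|` on `{0 ∈ 𝒞_{∞,α}}` are finite. -/
theorem lintegral_nbhdSize_of_lt_alphaTwo [IsProbabilityMeasure P] (herg : ShiftErgodic P) {α : ℝ}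
    (hα0 : 0 < α) (hα : α < alphaTwo P) (n : ℕ) :
    ∫⁻ ω, (cluster ω α).indicator 1 0 * nbhdSize ω α 0 ^ n ∂P < ∞ := by
  have hne : {α : ℝ | α ∈ Set.Ioo 0 (alphaOne P) ∧ AllMoments P α}.Nonempty := by
    by_contra h
    rw [Set.not_nonempty_iff_eq_empty] at h
    rw [alphaTwo, h, Real.sSup_empty] at hα
    exact absurd hα0 (not_lt.2 hα.le)
  obtain ⟨α', ⟨h1, h2⟩, h3⟩ := exists_lt_of_lt_csSup hne hα
  exact lintegral_nbhdSize_pow_lt_top herg.1 h3.le (ae_nonempty_cluster herg h1)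
    (lintegral_nbhdSize_of_allMoments h2) n

end ComponentMoments

/-! ### Almost sure finiteness of the random constants -/

section RandomConstants

variable {d : ℕ} [NeZero d] {P : Measure (Env d)}

/-- The coarse-grained kernel `P̂_ω`. -/
abbrev coarseKernel (ω : Env d) (α : ℝ) : Vertex d → Vertex d → ℝ≥0∞ :=
  moment (transProb ω) (cluster ω α) 1

/-- The kernel `E_ω^x[T_1; X_{T_1} = y]`. -/
abbrev durationKernel (ω : Env d) (α : ℝ) : Vertex d → Vertex d → ℝ≥0∞ :=
  moment (transProb ω) (cluster ω α) fun n => n + 1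

/-- The reversing measure of the coarse-grained walk. -/
def clusterWeight (α : ℝ) (ω : Env d) (x : Vertex d) : ℝ≥0∞ :=
  revWeight ω x * (cluster ω α).indicator 1 x

omit [NeZero d] in
theorem isCov_clusterWeight (α : ℝ) : IsCov (d := d) (clusterWeight α) := by
  have h : IsCov fun (ω : Env d) x => revWeight ω x :=
    ⟨fun x => (measurable_weight x).ennreal_ofReal, fun z ω x => by
      rw [revWeight, weight_shift]; rfl⟩
  exact h.mul (isCov_indicator_cluster α)

variable (P) in
/-- The environment law weighted by the reversing measure at the origin. -/
def envMeasure (α : ℝ) : Measure (Env d) := P.withDensity fun ω => clusterWeight α ω 0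

omit [NeZero d] in
theorem clusterWeight_le (α : ℝ) (ω : Env d) (x : Vertex d) :
    clusterWeight α ω x ≤ 3 ^ d * (cluster ω α).indicator 1 x :=
  mul_le_mul_left (revWeight_le ω x) _

omit [NeZero d] in
theorem isFiniteMeasure_envMeasure [IsProbabilityMeasure P] (α : ℝ) :
    IsFiniteMeasure (envMeasure P α) := by
  refine isFiniteMeasure_withDensity ?_
  refine ne_top_of_le_ne_top (b := (3 : ℝ≥0∞) ^ d) (by simp) ?_
  calc _ ≤ ∫⁻ _ω : Env d, (3 : ℝ≥0∞) ^ d ∂P := lintegral_mono fun ω =>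
        (clusterWeight_le α ω 0).trans
          ((mul_le_mul_right (indicator_one_le _ _) _).trans (mul_one _).le)
    _ = _ := by simp

theorem envSymm_moment (hP : ∀ x, MeasurePreserving (shift x) P P) (α : ℝ) (φ : ℕ → ℝ≥0∞) :
    EnvSymm (envMeasure P α) fun ω => moment (transProb ω) (cluster ω α) φ :=
  envSymm_of_reversible hP (isCov_clusterWeight α) (isCovKernel_moment α φ) fun ω x y =>
    moment_reversible (cluster ω α) (transProb_reversible ω) φ x y

theorem hasMoments_duration [IsProbabilityMeasure P] (herg : ShiftErgodic P) {α : ℝ} (hα0 : 0 < α)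
    (hα : α < alphaTwo P) :
    HasMoments (envMeasure P α) fun ω => kernelOp (durationKernel ω α) 1 := by
  intro n
  have hcov : IsCov fun ω : Env d => kernelOp (durationKernel ω α) 1 :=
    (isCovKernel_moment α _).op (IsCov.const 1)
  rw [envMeasure, lintegral_withDensity_eq_lintegral_mul _ ((isCov_clusterWeight α).meas 0)
    ((hcov.pow n).meas 0)]
  have h1 := lintegral_affine_pow_lt_top (P := P) (fun ω => indicator_one_le (cluster ω α) 0)
    ((isCov_indicator_cluster α).meas 0) (lintegral_nbhdSize_of_lt_alphaTwo herg hα0 hα)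
    (a := 1) (b := 3 ^ d / ENNReal.ofReal α) (by simp)
    (ENNReal.div_lt_top (by simp) (ENNReal.ofReal_pos.2 hα0).ne').ne n
  calc _ ≤ ∫⁻ ω, 3 ^ d * ((cluster ω α).indicator 1 0 *
        (1 + 3 ^ d / ENNReal.ofReal α * nbhdSize ω α 0) ^ n) ∂P := by
        refine lintegral_mono fun ω => ?_
        simp only [Pi.mul_apply]
        rw [← mul_assoc]
        by_cases h0 : (0 : Vertex d) ∈ cluster ω α
        · exact mul_le_mul' (clusterWeight_le α ω 0)
            (pow_le_pow_left' (kernelOp_moment_id_le hα0 h0) n)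
        · simp [clusterWeight, h0]
    _ < ∞ := by
        rw [lintegral_const_mul' _ _ (by simp)]
        exact ENNReal.mul_lt_top (by simp) h1

omit [NeZero d] in
theorem ae_condLaw_of_ae {α : ℝ} {p : Env d → Prop}
    (h : ∀ᵐ ω ∂P, (0 : Vertex d) ∈ cluster ω α → p ω) : ∀ᵐ ω ∂(condLaw P α), p ω := by
  rw [condLaw, ProbabilityTheory.cond]
  exact Measure.ae_smul_measure ((ae_restrict_iff' (measurableSet_mem_cluster α 0)).2 h) _

theorem ae_condLaw_of_ae_envMeasure {α : ℝ} {p : Env d → Prop}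
    (h : ∀ᵐ ω ∂(envMeasure P α), p ω) : ∀ᵐ ω ∂(condLaw P α), p ω := by
  refine ae_condLaw_of_ae ?_
  rw [envMeasure, ae_withDensity_iff ((isCov_clusterWeight α).meas 0)] at h
  filter_upwards [h] with ω hω h0
  refine hω ?_
  simp only [clusterWeight, Set.indicator_of_mem h0, Pi.one_apply, mul_one]
  exact (ENNReal.ofReal_pos.2 (weight_pos ω 0)).ne'

theorem ae_maxFn_duration_lt_top [IsProbabilityMeasure P] (herg : ShiftErgodic P) {α : ℝ}
    (hα0 : 0 < α) (hα : α < alphaTwo P) (j : ℕ) : ∀ᵐ ω ∂(condLaw P α),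
      maxFn (coarseKernel ω α) (momentFn (coarseKernel ω α) (durationKernel ω α) j) 0 < ∞ := by
  have := isFiniteMeasure_envMeasure (P := P) α
  exact ae_condLaw_of_ae_envMeasure (ae_maxFn_momentFn_lt_top (isCovKernel_moment α 1)
    (envSymm_moment herg.1 α 1) (fun ω x => tsum_moment_one_le _ (tsum_transProb ω) x)
    (isCovKernel_moment α _) (envSymm_moment herg.1 α _) (hasMoments_duration herg hα0 hα) j)

omit [NeZero d] in
theorem ae_finite_weakNeighborhood [IsProbabilityMeasure P] (herg : ShiftErgodic P) {α : ℝ}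
    (hα0 : 0 < α) (hα : α < alphaTwo P) :
    ∀ᵐ ω ∂P, ∀ x ∈ cluster ω α, (weakNeighborhood ω α x).Finite := by
  have h1 := lintegral_nbhdSize_of_lt_alphaTwo herg hα0 hα 1
  have h2 := ae_lt_top (((isCov_indicator_cluster α).mul ((isCov_nbhdSize α).pow 1)).meas 0) h1.ne
  rw [ae_all_iff]
  intro x
  filter_upwards [(herg.1 x).quasiMeasurePreserving.ae h2] with ω hω hx
  have h3 := ((isCov_indicator_cluster (d := d) α).mul ((isCov_nbhdSize α).pow 1)).cov x ω 0
  rw [h3, zero_add, Set.indicator_of_mem hx, Pi.one_apply, one_mul, pow_one, nbhdSize] at hω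
  rw [← Set.encard_lt_top_iff]
  exact_mod_cast hω

omit [NeZero d] in
theorem kernelPow_coarseKernel_eq_zero {ω : Env d} {α : ℝ} {y : Vertex d} (hy : y ∉ cluster ω α)
    (n : ℕ) (x : Vertex d) : kernelPow (coarseKernel ω α) (n + 1) x y = 0 := by
  have h0 : kernelOp (coarseKernel ω α) (Pi.single y 1) = 0 := by
    ext z
    rw [kernelOp_single]
    by_contra h
    exact hy (moment_support h).1
  rw [kernelPow_eq_kernelOp_pow, pow_succ, opMul_apply, h0, map_zero]; rfl

open Classical in
/-- The optimal constant in the diffusive upper bound, over starting points that the coarse-grained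
walk reaches from `0` within `R n` steps. It is written as a supremum to make it measurable in the
environment. -/
def diffConst (α : ℝ) (R : ℕ) (ω : Env d) : ℝ≥0∞ :=
  ⨆ (n : ℕ) (a : ℕ) (x : Vertex d) (y : Vertex d),
    if (1 ≤ n ∧ a ≤ R * n) ∧ 0 < kernelPow (coarseKernel ω α) a 0 x then
      kernelPow (coarseKernel ω α) n x y * (n : ℝ≥0∞) ^ ((d : ℝ) / 2) else 0

omit [NeZero d] in
theorem isCovKernel_kernelPow {k : Env d → Vertex d → Vertex d → ℝ≥0∞} (hk : IsCovKernel k)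
    (n : ℕ) : IsCovKernel fun ω => kernelPow (k ω) n := by
  induction n with
  | zero =>
    refine ⟨fun x y => measurable_const, fun z ω x y => ?_⟩
    simp [kernelPow]
  | succ n ih => exact hk.comp ih

omit [NeZero d] in
theorem measurable_diffConst (α : ℝ) (R : ℕ) : Measurable (diffConst (d := d) α R) := by
  classical
  have hm := isCovKernel_kernelPow (isCovKernel_moment (d := d) α 1)
  refine Measurable.iSup fun n => Measurable.iSup fun a => Measurable.iSup fun x =>
    Measurable.iSup fun y => ?_
  refine Measurable.ite ?_ (((hm n).meas x y).mul_const _) measurable_const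
  exact (MeasurableSet.const _).inter (measurableSet_lt measurable_const ((hm a).meas 0 x))

omit [NeZero d] in
theorem kernelPow_le_diffConst {α : ℝ} {R : ℕ} {ω : Env d} {n a : ℕ} (hn : 1 ≤ n)
    (ha : a ≤ R * n) {x : Vertex d} (hx : 0 < kernelPow (coarseKernel ω α) a 0 x) (y : Vertex d) :
    kernelPow (coarseKernel ω α) n x y ≤
      diffConst α R ω * ((n : ℝ≥0∞) ^ ((d : ℝ) / 2))⁻¹ := by
  have hpos : (0 : ℝ) ≤ (d : ℝ) / 2 := by positivity
  rw [← div_eq_mul_inv, ENNReal.le_div_iff_mul_le]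
  · unfold diffConst
    refine le_iSup_of_le n (le_iSup_of_le a (le_iSup_of_le x (le_iSup_of_le y ?_)))
    rw [if_pos ⟨⟨hn, ha⟩, hx⟩]
  · left
    have : (0 : ℝ≥0∞) < n := by exact_mod_cast hn
    exact (ENNReal.rpow_pos this (by simp)).ne'
  · left; exact ENNReal.rpow_ne_top_of_nonneg hpos (by simp)

theorem ae_diffConst_lt_top {α₀ : ℝ} (hd : DiffusiveBound P α₀) {α : ℝ}
    (hα : α ∈ Set.Ioo 0 α₀) {R : ℕ} (hR : 0 < R) :
    ∀ᵐ ω ∂(condLaw P α), diffConst α R ω < ∞ := by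
  have h0 : ∀ᵐ ω ∂(condLaw P α), (0 : Vertex d) ∈ cluster ω α :=
    ae_condLaw_of_ae (Filter.Eventually.of_forall fun ω h => h)
  filter_upwards [hd.2 α hα R (by exact_mod_cast hR), h0] with ω ⟨C, hC⟩ h0
  rw [coarseProb_eq_moment] at hC
  refine lt_of_le_of_lt ?_ (ENNReal.ofReal_lt_top (r := C))
  refine iSup_le fun n => iSup_le fun a => iSup_le fun x => iSup_le fun y => ?_
  split_ifs with h
  · obtain ⟨⟨hn, ha⟩, hx⟩ := h
    obtain ⟨m, rfl⟩ := Nat.exists_eq_succ_of_ne_zero (by omega : n ≠ 0)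
    by_cases hy : y ∈ cluster ω α
    · have hxC : x ∈ cluster ω α := by
        by_contra hxC
        rcases a with _ | a
        · rw [kernelPow] at hx
          split_ifs at hx with h
          · exact hxC (h ▸ h0)
          · exact lt_irrefl _ hx
        · rw [kernelPow_coarseKernel_eq_zero hxC] at hx
          exact lt_irrefl _ hx
      have hdist : (markovDist ω α 0 x : ℝ≥0∞) ≤ ENNReal.ofReal ((R : ℝ) * (m + 1 : ℕ)) := by
        have h1 : markovDist ω α 0 x ≤ a := by
          rw [markovDist, coarseProb_eq_moment]
          exact iInf₂_le a hx
        calc (markovDist ω α 0 x : ℝ≥0∞) ≤ ((a : ℕ∞) : ℝ≥0∞) := ENat.toENNReal_mono h1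
          _ = (a : ℝ≥0∞) := by simp
          _ ≤ ((R * (m + 1) : ℕ) : ℝ≥0∞) := by exact_mod_cast ha
          _ = _ := by rw [← ENNReal.ofReal_natCast]; push_cast; rfl
      have h2 := hC (m + 1) hn x hxC hdist y hy
      have hp : (0 : ℝ) < ((m + 1 : ℕ) : ℝ) ^ ((d : ℝ) / 2) := by positivity
      calc _ ≤ ENNReal.ofReal (C / ((m + 1 : ℕ) : ℝ) ^ ((d : ℝ) / 2)) *
            ((m + 1 : ℕ) : ℝ≥0∞) ^ ((d : ℝ) / 2) := mul_le_mul_left h2 _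
        _ = ENNReal.ofReal (C / ((m + 1 : ℕ) : ℝ) ^ ((d : ℝ) / 2)) *
            ENNReal.ofReal (((m + 1 : ℕ) : ℝ) ^ ((d : ℝ) / 2)) := by
            rw [← ENNReal.ofReal_rpow_of_pos (by positivity), ENNReal.ofReal_natCast]
        _ = ENNReal.ofReal C := by
            rw [← ENNReal.ofReal_mul' hp.le, div_mul_cancel₀ _ hp.ne']
    · rw [kernelPow_coarseKernel_eq_zero hy]; simp
  · exact zero_le

end RandomConstants


/-! ### Return probabilities of words -/

section WordsReturn

open Finset.HasAntidiagonal

section Support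

variable {d : ℕ} {k q : Vertex d → Vertex d → ℝ≥0∞}

/-- A word of length `n` only sees the vertices that the chain `k` reaches in exactly `n` steps. -/
theorem words_mono_of_support (hkq : ∀ x y, q x y ≠ 0 → k x y ≠ 0) (n j : ℕ) (x : Vertex d)
    {g h : Vertex d → ℝ≥0∞} (hgh : ∀ y, kernelPow k n x y ≠ 0 → g y ≤ h y) :
    words (kernelOp k) (kernelOp q) n j g x ≤ words (kernelOp k) (kernelOp q) n j h x := by
  induction n generalizing x j with
  | zero =>
    cases j with
    | zero => rw [words_zero_zero]; exact hgh x (by simp [kernelPow])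
    | succ j => rw [words_zero_succ]; exact le_rfl
  | succ n ih =>
    have step : ∀ (q' : Vertex d → Vertex d → ℝ≥0∞), (∀ y, q' x y ≠ 0 → k x y ≠ 0) → ∀ i,
        kernelOp q' (words (kernelOp k) (kernelOp q) n i g) x ≤
          kernelOp q' (words (kernelOp k) (kernelOp q) n i h) x := by
      intro q' hq' i
      rw [kernelOp_apply, kernelOp_apply]
      refine ENNReal.tsum_le_tsum fun y => ?_
      by_cases hy : q' x y = 0
      · simp [hy]
      · refine mul_le_mul_right (ih i y fun z hz => hgh z ?_) _
        refine (lt_of_lt_of_le (pos_iff_ne_zero.2 (mul_ne_zero (hq' y hy) hz))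
          (ENNReal.le_tsum (f := fun y => k x y * kernelPow k n y z) y)).ne'
    cases j with
    | zero =>
      have := step k (fun _ h => h) 0
      rw [words_zero_right] at this
      rw [words_zero_right, pow_succ']; exact this
    | succ j =>
      rw [words_succ_succ]
      exact add_le_add (step q (hkq x) j) (step k (fun _ h => h) (j + 1))

theorem words_const (n j : ℕ) (c : ℝ≥0∞) (x : Vertex d) :
    words (kernelOp k) (kernelOp q) n j (fun _ => c) x =
      c * words (kernelOp k) (kernelOp q) n j 1 x := by
  induction n generalizing x j with
  | zero =>
    cases j with
    | zero => simp [words_zero_zero]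
    | succ j => simp [words_zero_succ]
  | succ n ih =>
    have step : ∀ (q' : Vertex d → Vertex d → ℝ≥0∞) i,
        kernelOp q' (words (kernelOp k) (kernelOp q) n i (fun _ => c)) x =
          c * kernelOp q' (words (kernelOp k) (kernelOp q) n i 1) x := by
      intro q' i
      rw [← kernelOp_const_mul]
      exact congrArg (fun h => kernelOp q' h x) (funext fun y => ih i y)
    cases j with
    | zero =>
      have := step k 0
      rw [words_zero_right] at this
      rw [words_zero_right, pow_succ']; exact this
    | succ j =>
      rw [words_succ_succ]
      exact (congrArg₂ (· + ·) (step q j) (step k (j + 1))).trans (mul_add _ _ _).symm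

end Support

variable {d : ℕ} [NeZero d]

/-- The maximal function at `0` of the `j`-th iterated moment of the durations. -/
def momentMax (α : ℝ) (j : ℕ) (ω : Env d) : ℝ≥0∞ :=
  maxFn (coarseKernel ω α) (momentFn (coarseKernel ω α) (durationKernel ω α) j) 0

/-- The random constant in the bound on the words with `j` durations that return to `0`. -/
def wordConst (α : ℝ) (j : ℕ) (ω : Env d) : ℝ≥0∞ :=
  (2 * (j + 1 : ℕ) : ℝ≥0∞) ^ ((d : ℝ) / 2) * (momentMax α j ω +
    (j + 1 : ℕ) * (3 ^ d / ENNReal.ofReal α * diffConst α (j + 1) ω *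
      ∑ q ∈ antidiagonal j, momentMax α q.1 ω * momentMax α q.2 ω))

omit [NeZero d] in
theorem measurable_momentMax (α : ℝ) (j : ℕ) : Measurable (momentMax (d := d) α j) :=
  (isCov_maxFn (isCovKernel_moment α 1)
    (isCov_momentFn (isCovKernel_moment α 1) (isCovKernel_moment α _) j)).meas 0

omit [NeZero d] in
theorem measurable_wordConst (α : ℝ) (j : ℕ) : Measurable (wordConst (d := d) α j) := by
  refine Measurable.const_mul ((measurable_momentMax α j).add (Measurable.const_mul ?_ _)) _
  exact ((measurable_diffConst α _).const_mul _).mul (Finset.measurable_sum _ fun q _ =>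
    (measurable_momentMax α q.1).mul (measurable_momentMax α q.2))

theorem ae_wordConst_lt_top {P : Measure (Env d)} [IsProbabilityMeasure P] (herg : ShiftErgodic P)
    {α₀ α : ℝ} (hd : DiffusiveBound P α₀) (hα : α ∈ Set.Ioo 0 α₀) (j : ℕ) :
    ∀ᵐ ω ∂(condLaw P α), wordConst α j ω < ∞ := by
  have h1 : ∀ᵐ ω ∂(condLaw P α), ∀ j, momentMax α j ω < ∞ :=
    ae_all_iff.2 fun j => ae_maxFn_duration_lt_top herg hα.1 (hα.2.trans_le hd.1.2) j
  filter_upwards [h1, ae_diffConst_lt_top hd hα (R := j + 1) (by omega)] with ω h1 h2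
  have h3 : ∑ q ∈ antidiagonal j, momentMax α q.1 ω * momentMax α q.2 ω < ∞ :=
    ENNReal.sum_lt_top.2 fun q _ => ENNReal.mul_lt_top (h1 _) (h1 _)
  have h4 : (3 : ℝ≥0∞) ^ d / ENNReal.ofReal α < ∞ :=
    ENNReal.div_lt_top (by simp) (ENNReal.ofReal_pos.2 hα.1).ne'
  refine ENNReal.mul_lt_top ?_ (ENNReal.add_lt_top.2 ⟨h1 j, ENNReal.mul_lt_top (by simp)
    (ENNReal.mul_lt_top (ENNReal.mul_lt_top h4 h2) h3)⟩)
  refine ENNReal.rpow_lt_top_of_nonneg (by positivity) ?_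
  exact ENNReal.mul_ne_top (by simp) (by simp)

variable {ω : Env d} {α : ℝ}

omit [NeZero d] in
theorem coarseKernel_ne_zero_of_durationKernel {x y : Vertex d}
    (h : durationKernel ω α x y ≠ 0) : coarseKernel ω α x y ≠ 0 := by
  intro h0
  refine h (ENNReal.tsum_eq_zero.2 fun n => ?_)
  have := ENNReal.tsum_eq_zero.1 h0 n
  rw [Pi.one_apply, one_mul] at this
  rw [this, mul_zero]

/-- The mass of the words that end at `0`, over all starting points in the cluster. -/
theorem tsum_cluster_words_le (hα : 0 < α) (n j : ℕ) :
    ∑' y, (cluster ω α).indicator 1 y *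
        words (kernelOp (coarseKernel ω α)) (kernelOp (durationKernel ω α)) n j
          (Pi.single 0 1) y ≤
      3 ^ d / ENNReal.ofReal α * (n ^ j * momentMax α j ω) := by
  have hα0 : ENNReal.ofReal α ≠ 0 := (ENNReal.ofReal_pos.2 hα).ne'
  set W := words (kernelOp (coarseKernel ω α)) (kernelOp (durationKernel ω α)) n j with hW
  have hadj : IsAdj (clusterWeight α ω) W W :=
    words_isAdj _ _ (IsAdj.kernelOp (moment_reversible _ (transProb_reversible ω) _))
      (IsAdj.kernelOp (moment_reversible _ (transProb_reversible ω) _)) n j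
  have h1 : ∑' y, clusterWeight α ω y * W (Pi.single 0 1) y = clusterWeight α ω 0 * W 1 0 := by
    have := hadj 1 (Pi.single 0 1)
    simp only [Pi.one_apply, one_mul] at this
    rw [this, tsum_eq_single 0]
    · simp
    · intro y hy; simp [hy]
  calc _ ≤ ∑' y, (ENNReal.ofReal α)⁻¹ * (clusterWeight α ω y * W (Pi.single 0 1) y) := by
        refine ENNReal.tsum_le_tsum fun y => ?_
        by_cases hy : y ∈ cluster ω α
        · rw [clusterWeight, Set.indicator_of_mem hy, Pi.one_apply, one_mul, mul_one, ← mul_assoc]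
          refine le_mul_of_one_le_left zero_le ?_
          rw [← ENNReal.inv_mul_cancel hα0 (by simp)]
          exact mul_le_mul_right (ENNReal.ofReal_le_ofReal (le_weight_of_mem_cluster hy)) _
        · simp [hy]
    _ = (ENNReal.ofReal α)⁻¹ * (clusterWeight α ω 0 * W 1 0) := by rw [ENNReal.tsum_mul_left, h1]
    _ ≤ (ENNReal.ofReal α)⁻¹ * (3 ^ d * (n ^ j * momentMax α j ω)) := by
        refine mul_le_mul_right (mul_le_mul' ?_ (words_one_le
          (fun x => tsum_moment_one_le _ (tsum_transProb ω) x) _ n j 0)) _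
        exact (clusterWeight_le α ω 0).trans
          ((mul_le_mul_right (indicator_one_le _ _) _).trans (mul_one _).le)
    _ = _ := by rw [div_eq_mul_inv]; ring

/-- A word that contains a block of `b` letters `P̂` between two arbitrary words inherits the
diffusive decay of this block. -/
theorem words_block_le (hα : 0 < α) {R a b c i j : ℕ} (hb : 1 ≤ b) (ha : a ≤ R * b) :
    (words (kernelOp (coarseKernel ω α)) (kernelOp (durationKernel ω α)) a i *
      (kernelOp (coarseKernel ω α) ^ b *
        words (kernelOp (coarseKernel ω α)) (kernelOp (durationKernel ω α)) c j))
        (Pi.single 0 1) 0 ≤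
      3 ^ d / ENNReal.ofReal α * diffConst α R ω * (momentMax α i ω * momentMax α j ω) *
        (a ^ i * c ^ j * ((b : ℝ≥0∞) ^ ((d : ℝ) / 2))⁻¹) := by
  set g := words (kernelOp (coarseKernel ω α)) (kernelOp (durationKernel ω α)) c j
    (Pi.single 0 1) with hg
  set D := diffConst α R ω * ((b : ℝ≥0∞) ^ ((d : ℝ) / 2))⁻¹ with hD
  have hmid : ∀ x, kernelPow (coarseKernel ω α) a 0 x ≠ 0 →
      (kernelOp (coarseKernel ω α) ^ b) g x ≤
        D * (3 ^ d / ENNReal.ofReal α * (c ^ j * momentMax α j ω)) := by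
    intro x hx
    rw [kernelOp_pow_eq, kernelOp_apply]
    calc _ ≤ ∑' y, D * ((cluster ω α).indicator 1 y * g y) := by
          refine ENNReal.tsum_le_tsum fun y => ?_
          by_cases hy : y ∈ cluster ω α
          · rw [Set.indicator_of_mem hy, Pi.one_apply, one_mul]
            exact mul_le_mul_left (kernelPow_le_diffConst hb ha (pos_iff_ne_zero.2 hx) y) _
          · obtain ⟨b', rfl⟩ := Nat.exists_eq_succ_of_ne_zero (by omega : b ≠ 0)
            rw [kernelPow_coarseKernel_eq_zero hy]; simp
      _ ≤ _ := by
          rw [ENNReal.tsum_mul_left]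
          exact mul_le_mul_right (tsum_cluster_words_le hα c j) _
  rw [opMul_apply, opMul_apply]
  refine (words_mono_of_support (fun x y => coarseKernel_ne_zero_of_durationKernel) a i 0
    hmid).trans ?_
  rw [words_const]
  refine (mul_le_mul_right (words_one_le
    (fun x => tsum_moment_one_le _ (tsum_transProb ω) x) _ a i 0) _).trans (le_of_eq ?_)
  rw [hD, momentMax, momentMax]
  ring

/-- The words of length `l` with `j` durations that return to `0` have mass of order
`l ^ (j - d / 2)`: one of `j + 1` consecutive blocks contains no duration, and the coarse-grained
walk spreads out during that block. -/
theorem words_return_le (hα : 0 < α) {l : ℕ} (hl : 1 ≤ l) (j : ℕ) :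
    words (kernelOp (coarseKernel ω α)) (kernelOp (durationKernel ω α)) l j (Pi.single 0 1) 0 ≤
      wordConst α j ω * (l ^ j * ((l : ℝ≥0∞) ^ ((d : ℝ) / 2))⁻¹) := by
  have hd : (0 : ℝ) ≤ (d : ℝ) / 2 := by positivity
  have hl0 : (l : ℝ≥0∞) ^ ((d : ℝ) / 2) ≠ 0 :=
    (ENNReal.rpow_pos (by exact_mod_cast hl) (by simp)).ne'
  have hl1 : (l : ℝ≥0∞) ^ ((d : ℝ) / 2) ≠ ∞ := ENNReal.rpow_ne_top_of_nonneg hd (by simp)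
  rcases Nat.lt_or_ge j l with hjl | hjl
  · -- `b` is the length of the blocks
    obtain ⟨b, c, hb, hbc, hc⟩ : ∃ b c, 1 ≤ b ∧ l = (j + 1) * b + c ∧ l ≤ 2 * (j + 1) * b := by
      have hb : 1 ≤ l / (j + 1) := (Nat.one_le_div_iff (by omega)).2 hjl
      refine ⟨l / (j + 1), l % (j + 1), hb, (Nat.div_add_mod _ _).symm, ?_⟩
      have h1 := Nat.div_add_mod l (j + 1)
      have h2 := Nat.mod_lt l (by omega : 0 < j + 1)
      nlinarith
    have hbl : ((b : ℝ≥0∞) ^ ((d : ℝ) / 2))⁻¹ ≤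
        (2 * (j + 1 : ℕ) : ℝ≥0∞) ^ ((d : ℝ) / 2) * ((l : ℝ≥0∞) ^ ((d : ℝ) / 2))⁻¹ := by
      have hb0 : (b : ℝ≥0∞) ^ ((d : ℝ) / 2) ≠ 0 :=
        (ENNReal.rpow_pos (by exact_mod_cast hb) (by simp)).ne'
      have hb1 : (b : ℝ≥0∞) ^ ((d : ℝ) / 2) ≠ ∞ := ENNReal.rpow_ne_top_of_nonneg hd (by simp)
      rw [← div_eq_mul_inv, ENNReal.le_div_iff_mul_le (Or.inl hl0) (Or.inl hl1), mul_comm,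
        ← div_eq_mul_inv, ENNReal.div_le_iff hb0 hb1, ← ENNReal.mul_rpow_of_nonneg _ _ hd]
      refine ENNReal.rpow_le_rpow ?_ hd
      exact_mod_cast hc
    have hterm : ∀ p ∈ antidiagonal j, ∀ q ∈ antidiagonal j,
        (words (kernelOp (coarseKernel ω α)) (kernelOp (durationKernel ω α)) (p.1 * b) q.1 *
          (kernelOp (coarseKernel ω α) ^ b * words (kernelOp (coarseKernel ω α))
            (kernelOp (durationKernel ω α)) (p.2 * b + c) q.2)) (Pi.single 0 1) 0 ≤
        3 ^ d / ENNReal.ofReal α * diffConst α (j + 1) ω *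
          (momentMax α q.1 ω * momentMax α q.2 ω) *
          (l ^ j * ((2 * (j + 1 : ℕ) : ℝ≥0∞) ^ ((d : ℝ) / 2) *
            ((l : ℝ≥0∞) ^ ((d : ℝ) / 2))⁻¹)) := by
      intro p hp q hq
      have hp' : p.1 + p.2 = j := Finset.HasAntidiagonal.mem_antidiagonal.1 hp
      have hq' : q.1 + q.2 = j := Finset.HasAntidiagonal.mem_antidiagonal.1 hq
      refine (words_block_le hα hb (R := j + 1) (Nat.mul_le_mul_right b (by omega))).trans ?_
      refine mul_le_mul_right (mul_le_mul' ?_ hbl) _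
      rw [← hq', pow_add]
      have e1 : p.1 * b ≤ l := by nlinarith
      have e2 : p.2 * b + c ≤ l := by nlinarith
      exact mul_le_mul' (pow_le_pow_left' (by exact_mod_cast e1) _)
        (pow_le_pow_left' (by exact_mod_cast e2) _)
    have hsum := words_le_sum_blocks (kernelOp (coarseKernel ω α)) (kernelOp (durationKernel ω α))
      b c j j le_rfl (Pi.single 0 1) 0
    rw [← hbc] at hsum
    refine hsum.trans ?_
    simp only [opSum_apply, Finset.sum_apply]
    refine (Finset.sum_le_sum fun p hp => Finset.sum_le_sum fun q hq => hterm p hp q hq).trans ?_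
    rw [Finset.sum_const, Finset.Nat.card_antidiagonal, ← Finset.sum_mul, ← Finset.mul_sum,
      nsmul_eq_mul]
    calc _ = (2 * (j + 1 : ℕ) : ℝ≥0∞) ^ ((d : ℝ) / 2) * ((j + 1 : ℕ) *
          (3 ^ d / ENNReal.ofReal α * diffConst α (j + 1) ω *
            ∑ q ∈ antidiagonal j, momentMax α q.1 ω * momentMax α q.2 ω)) *
          (l ^ j * ((l : ℝ≥0∞) ^ ((d : ℝ) / 2))⁻¹) := by ring
      _ ≤ _ := mul_le_mul_left (mul_le_mul_right le_add_self _) _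
  · have h1 : (Pi.single 0 1 : Vertex d → ℝ≥0∞) ≤ 1 := by
      intro y
      by_cases hy : y = 0
      · subst hy; simp
      · simp [hy]
    calc _ ≤ words (kernelOp (coarseKernel ω α)) (kernelOp (durationKernel ω α)) l j 1 0 :=
          opMono _ h1 0
      _ ≤ l ^ j * momentMax α j ω :=
          words_one_le (fun x => tsum_moment_one_le _ (tsum_transProb ω) x) _ l j 0
      _ = (l : ℝ≥0∞) ^ ((d : ℝ) / 2) * ((l : ℝ≥0∞) ^ ((d : ℝ) / 2))⁻¹ *
            (l ^ j * momentMax α j ω) := by rw [ENNReal.mul_inv_cancel hl0 hl1, one_mul]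
      _ = (l : ℝ≥0∞) ^ ((d : ℝ) / 2) * momentMax α j ω *
            (l ^ j * ((l : ℝ≥0∞) ^ ((d : ℝ) / 2))⁻¹) := by ring
      _ ≤ _ := by
          refine mul_le_mul_left (mul_le_mul' (ENNReal.rpow_le_rpow ?_ hd) le_self_add) _
          exact_mod_cast (by omega : l ≤ 2 * (j + 1))

end WordsReturn


/-! ### Return probabilities of the walk -/

section Return

variable {d : ℕ} [NeZero d] (ω : Env d)

/-- By reversibility, the return probability at time `2 m` is an `ℓ²` norm of the heat kernel. -/
theorem revWeight_mul_kernelPow_two_mul (m : ℕ) :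
    revWeight ω 0 * kernelPow (transProb ω) (2 * m) 0 0 =
      ∑' x, revWeight ω x * kernelPow (transProb ω) m x 0 ^ 2 := by
  have hadj : IsAdj (revWeight ω) (kernelOp (transProb ω) ^ m) (kernelOp (transProb ω) ^ m) :=
    (IsAdj.kernelOp (transProb_reversible ω)).pow m
  have h := hadj (Pi.single 0 1) ((kernelOp (transProb ω) ^ m) (Pi.single 0 1))
  rw [tsum_eq_single 0 (fun x hx => by simp [hx]), Pi.single_eq_same, one_mul, ← opMul_apply,
    ← pow_add, ← two_mul, ← kernelPow_eq_kernelOp_pow] at h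
  rw [h]
  exact tsum_congr fun x => by rw [kernelPow_eq_kernelOp_pow, sq]

/-- The return probabilities at even times decrease, by reversibility. -/
theorem kernelPow_two_mul_antitone :
    Antitone fun m => kernelPow (transProb ω) (2 * m) 0 0 := by
  refine antitone_nat_of_succ_le fun m => ?_
  have hw0 : revWeight ω 0 ≠ 0 := (ENNReal.ofReal_pos.2 (weight_pos ω 0)).ne'
  have hw1 : revWeight ω 0 ≠ ∞ := ENNReal.ofReal_ne_top
  rw [← ENNReal.mul_le_mul_iff_right hw0 hw1, revWeight_mul_kernelPow_two_mul,
    revWeight_mul_kernelPow_two_mul]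
  have hone : kernelOp (transProb ω) 1 = 1 := by
    ext x; simpa [kernelOp_apply] using tsum_transProb ω x
  set u : Vertex d → ℝ≥0∞ := fun x => kernelPow (transProb ω) m x 0 with hu
  have hadj : IsAdj (revWeight ω) (kernelOp (transProb ω)) (kernelOp (transProb ω)) :=
    IsAdj.kernelOp (transProb_reversible ω)
  calc _ ≤ ∑' x, revWeight ω x * kernelOp (transProb ω) (fun y => u y ^ 2) x := by
        refine ENNReal.tsum_le_tsum fun x => mul_le_mul_right ?_ _
        have := kernelOp_sq_le (transProb ω) u x
        rw [hone, Pi.one_apply, one_mul] at this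
        exact this
    _ = ∑' x, revWeight ω x * u x ^ 2 := by
        have := hadj 1 (fun y => u y ^ 2)
        rw [hone] at this
        simpa using this

theorem kernelPow_two_mul_pos (m : ℕ) : 0 < kernelPow (transProb ω) (2 * m) 0 0 := by
  obtain ⟨z, hz⟩ : ∃ z, transProb ω 0 z ≠ 0 := by
    by_contra h
    push Not at h
    have := tsum_transProb ω 0
    simp [h] at this
  have hz' : transProb ω z 0 ≠ 0 :=
    (transProb_pos ω (adj_of_transProb_ne_zero ω hz).symm).ne'
  induction m with
  | zero => simp [kernelPow]
  | succ m ih =>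
    refine lt_of_lt_of_le (ENNReal.mul_pos hz (ENNReal.mul_pos hz' ih.ne').ne') ?_
    refine le_trans (mul_le_mul_right ?_ _)
      (ENNReal.le_tsum (f := fun z => transProb ω 0 z * kernelPow (transProb ω) (2 * m + 1) z 0) z)
    exact ENNReal.le_tsum (f := fun y => transProb ω z y * kernelPow (transProb ω) (2 * m) y 0) 0

theorem kernelPow_transProb_ne_top (n : ℕ) (x y : Vertex d) :
    kernelPow (transProb ω) n x y ≠ ∞ := by
  rw [← walkLaw_eq_kernelPow]; exact measure_ne_top _ _

end Return

/-! ### Sums of powers -/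

section PowerSums

/-- `∑_{l ≤ N} l ^ (-β)` is of order `N ^ (1 - β)` when `β < 1`. -/
theorem sum_rpow_neg_le {β : ℝ} (h0 : 0 ≤ β) (h1 : β < 1) (N : ℕ) :
    (1 - β) * ∑ l ∈ Finset.Icc 1 N, (l : ℝ) ^ (-β) ≤ (N : ℝ) ^ (1 - β) := by
  induction N with
  | zero => simp [Real.zero_rpow (sub_pos.2 h1).ne']
  | succ N ih =>
    rw [Finset.sum_Icc_succ_top (by omega), mul_add]
    have hN : (0 : ℝ) < ((N + 1 : ℕ) : ℝ) := by positivity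
    have hB := rpow_one_add_le_one_add_mul_self (s := -((N + 1 : ℕ) : ℝ)⁻¹)
      (by
        have : (1 : ℝ) ≤ ((N + 1 : ℕ) : ℝ) := by exact_mod_cast Nat.succ_le_succ (Nat.zero_le N)
        have := inv_le_one_of_one_le₀ this
        linarith) (p := 1 - β) (by linarith) (by linarith)
    have e1 : (N : ℝ) = ((N + 1 : ℕ) : ℝ) * (1 + -((N + 1 : ℕ) : ℝ)⁻¹) := by
      rw [mul_add, mul_neg, mul_inv_cancel₀ hN.ne']; push_cast; ring
    have e2 : (N : ℝ) ^ (1 - β) ≤ ((N + 1 : ℕ) : ℝ) ^ (1 - β) *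
        (1 + (1 - β) * -((N + 1 : ℕ) : ℝ)⁻¹) := by
      have h2 : (0 : ℝ) ≤ 1 + -((N + 1 : ℕ) : ℝ)⁻¹ := by
        have : (1 : ℝ) ≤ ((N + 1 : ℕ) : ℝ) := by exact_mod_cast Nat.succ_le_succ (Nat.zero_le N)
        have := inv_le_one_of_one_le₀ this
        linarith
      calc (N : ℝ) ^ (1 - β) = (((N + 1 : ℕ) : ℝ) * (1 + -((N + 1 : ℕ) : ℝ)⁻¹)) ^ (1 - β) := by
            rw [← e1]
        _ = ((N + 1 : ℕ) : ℝ) ^ (1 - β) * (1 + -((N + 1 : ℕ) : ℝ)⁻¹) ^ (1 - β) :=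
            Real.mul_rpow hN.le h2
        _ ≤ _ := mul_le_mul_of_nonneg_left hB (by positivity)
    have e3 : ((N + 1 : ℕ) : ℝ) ^ (1 - β) * ((N + 1 : ℕ) : ℝ)⁻¹ = ((N + 1 : ℕ) : ℝ) ^ (-β) := by
      rw [← Real.rpow_neg_one, ← Real.rpow_add hN]; congr 1; ring
    linear_combination ih + e2 - (1 - β) * e3

/-- `∑_{l > N} l ^ (-s)` is of order `N ^ (1 - s)` when `s > 1`. -/
theorem sum_rpow_neg_tail_le {s : ℝ} (hs : 1 < s) {N : ℕ} (hN : 1 ≤ N) (M : ℕ) :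
    (s - 1) * ∑ l ∈ Finset.Ioc N M, (l : ℝ) ^ (-s) ≤ (N : ℝ) ^ (1 - s) := by
  have key : ∀ l : ℕ, 1 ≤ l → (s - 1) * ((l + 1 : ℕ) : ℝ) ^ (-s) ≤
      (l : ℝ) ^ (1 - s) - ((l + 1 : ℕ) : ℝ) ^ (1 - s) := by
    intro l hl
    have hl0 : (0 : ℝ) < l := by exact_mod_cast hl
    have hl1 : (0 : ℝ) < ((l + 1 : ℕ) : ℝ) := by positivity
    -- the Bernoulli inequality bounds `((l + 1) / l) ^ s` from below
    have hB := one_add_mul_self_le_rpow_one_add (s := (l : ℝ)⁻¹)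
      (by have := inv_pos.2 hl0; linarith) hs.le
    have e1 : (1 : ℝ) + (l : ℝ)⁻¹ = ((l + 1 : ℕ) : ℝ) / l := by
      push_cast; field_simp
    have e2 : (l : ℝ) ^ (1 - s) =
        l * (((l + 1 : ℕ) : ℝ) ^ (-s) * (((l + 1 : ℕ) : ℝ) / l) ^ s) := by
      rw [Real.div_rpow hl1.le hl0.le, ← mul_div_assoc, ← Real.rpow_add hl1, neg_add_cancel,
        Real.rpow_zero, Real.rpow_sub hl0, Real.rpow_one, mul_one_div]
    have e3 : ((l + 1 : ℕ) : ℝ) ^ (1 - s) = ((l + 1 : ℕ) : ℝ) * ((l + 1 : ℕ) : ℝ) ^ (-s) := by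
      rw [sub_eq_add_neg, Real.rpow_add hl1, Real.rpow_one]
    have e4 : (l : ℝ) * (((l + 1 : ℕ) : ℝ) ^ (-s) * (1 + s * (l : ℝ)⁻¹)) =
        ((l + 1 : ℕ) : ℝ) ^ (-s) * (l + s) := by
      field_simp
    rw [e1] at hB
    have h5 := mul_le_mul_of_nonneg_left (mul_le_mul_of_nonneg_left hB
      (by positivity : 0 ≤ ((l + 1 : ℕ) : ℝ) ^ (-s))) hl0.le
    rw [e4, ← e2] at h5
    have e6 : ((l + 1 : ℕ) : ℝ) * ((l + 1 : ℕ) : ℝ) ^ (-s) =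
        (l + 1) * ((l + 1 : ℕ) : ℝ) ^ (-s) := by push_cast; ring
    rw [e3, e6]
    linear_combination h5
  have hstep : ∀ M, N ≤ M → (s - 1) * ∑ l ∈ Finset.Ioc N M, (l : ℝ) ^ (-s) ≤
      (N : ℝ) ^ (1 - s) - (M : ℝ) ^ (1 - s) := by
    intro M hM
    induction M, hM using Nat.le_induction with
    | base => simp
    | succ M hM ih =>
      rw [Finset.sum_Ioc_succ_top (by omega), mul_add]
      have := key M (hN.trans hM)
      linarith
  rcases Nat.le_total N M with h | h
  · have : (0 : ℝ) ≤ (M : ℝ) ^ (1 - s) := by positivity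
    linarith [hstep M h]
  · rw [Finset.Ioc_eq_empty (by omega)]; simp; positivity

theorem sum_inv_le_log {N : ℕ} (hN : 1 ≤ N) {M : ℕ} (hM : N ≤ M) :
    ∑ l ∈ Finset.Ioc N M, (l : ℝ)⁻¹ ≤ Real.log M - Real.log N := by
  induction M, hM using Nat.le_induction with
  | base => simp
  | succ M hM ih =>
    rw [Finset.sum_Ioc_succ_top (by omega)]
    have hM0 : (0 : ℝ) < M := by exact_mod_cast hN.trans hM
    have h := Real.one_sub_inv_le_log_of_pos (x := ((M + 1 : ℕ) : ℝ) / M) (by positivity)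
    rw [Real.log_div (by positivity) hM0.ne'] at h
    have e : (1 : ℝ) - (((M + 1 : ℕ) : ℝ) / M)⁻¹ = ((M + 1 : ℕ) : ℝ)⁻¹ := by
      push_cast; field_simp; ring
    linarith

end PowerSums


/-! ### The rate of the trapping estimate -/

section Rate

/-- The rate `x log x` in dimension four and `x ^ (d / 2 - 1)` in higher dimensions. -/
def trapRate (d : ℕ) (x : ℝ) : ℝ :=
  if d = 4 then x * Real.log x else x ^ ((d : ℝ) / 2 - 1)

variable {d : ℕ}

theorem rpow_le_trapRate {x : ℝ} (hx : 2 ≤ x) : x ^ ((d : ℝ) / 2 - 1) ≤ 2 * trapRate d x := by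
  unfold trapRate
  split_ifs with h
  · subst h
    have h1 : (1 : ℝ) / 2 ≤ Real.log x := by
      have := Real.log_two_gt_d9
      have := Real.log_le_log (by norm_num) hx
      linarith
    have e : ((4 : ℕ) : ℝ) / 2 - 1 = 1 := by norm_num
    rw [e, Real.rpow_one]
    nlinarith
  · have : 0 ≤ x ^ ((d : ℝ) / 2 - 1) := by positivity
    linarith

theorem one_le_rpow_of_dim (hd : 4 ≤ d) {x : ℝ} (hx : 2 ≤ x) : 1 ≤ x ^ ((d : ℝ) / 2 - 1) := by
  have hd' : (4 : ℝ) ≤ d := by exact_mod_cast hd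
  exact Real.one_le_rpow (by linarith) (by linarith)

theorem trapRate_nonneg {x : ℝ} (hx : 2 ≤ x) : 0 ≤ trapRate d x := by
  have := rpow_le_trapRate (d := d) hx
  have : 0 ≤ x ^ ((d : ℝ) / 2 - 1) := by positivity
  linarith

theorem two_le_div {n : ℕ} {θ : ℝ} (h1 : 1 ≤ θ) (h2 : θ ≤ (n : ℝ) / 2) : 2 ≤ (n : ℝ) / θ := by
  rw [le_div_iff₀ (by linarith)]; linarith

/-- The contribution of the paths with few visits to the cluster. -/
theorem rate_few_visits (hd : 4 ≤ d) {n : ℕ} (hn : 1 ≤ n) {θ : ℝ} (h1 : 1 ≤ θ)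
    (h2 : θ ≤ (n : ℝ) / 2) :
    ((n : ℝ) ^ d)⁻¹ ≤ 2 * (θ * (n : ℝ) ^ (-((d : ℝ) / 2)) * trapRate d (n / θ)) := by
  have hx := two_le_div h1 h2
  have hn0 : (1 : ℝ) ≤ n := by exact_mod_cast hn
  have h3 := (one_le_rpow_of_dim hd hx).trans (rpow_le_trapRate (d := d) hx)
  have h4 : ((n : ℝ) ^ d)⁻¹ ≤ (n : ℝ) ^ (-((d : ℝ) / 2)) := by
    rw [← Real.rpow_natCast, ← Real.rpow_neg (by linarith)]
    refine Real.rpow_le_rpow_of_exponent_le hn0 ?_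
    have : (0 : ℝ) ≤ d := by positivity
    linarith
  have h5 : 0 ≤ (n : ℝ) ^ (-((d : ℝ) / 2)) := by positivity
  calc ((n : ℝ) ^ d)⁻¹ ≤ (n : ℝ) ^ (-((d : ℝ) / 2)) := h4
    _ ≤ θ * (n : ℝ) ^ (-((d : ℝ) / 2)) := le_mul_of_one_le_left h5 h1
    _ ≤ θ * (n : ℝ) ^ (-((d : ℝ) / 2)) * (2 * trapRate d (n / θ)) :=
        le_mul_of_one_le_right (by positivity) h3
    _ = _ := by ring

/-- The exponent `d / 2 - 1 - ⌊d / 2 - 1⌋`. -/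
def fracExponent (d : ℕ) : ℝ := (d : ℝ) / 2 - 1 - ⌊(d : ℝ) / 2 - 1⌋₊

theorem fracExponent_nonneg (hd : 4 ≤ d) : 0 ≤ fracExponent d := by
  have hd' : (4 : ℝ) ≤ d := by exact_mod_cast hd
  exact sub_nonneg.2 (Nat.floor_le (by linarith))

theorem fracExponent_lt_one (d : ℕ) : fracExponent d < 1 := by
  have := Nat.lt_floor_add_one ((d : ℝ) / 2 - 1)
  unfold fracExponent
  linarith

/-- The contribution of the paths with a moderate number of visits to the cluster, of which more
than `r` are followed by a long excursion. -/
theorem rate_many_excursions (hd : 4 ≤ d) {n : ℕ} (hn : 1 ≤ n) {θ : ℝ} (h1 : 1 ≤ θ)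
    (h2 : θ ≤ (n : ℝ) / 2) :
    (θ ^ ⌊(d : ℝ) / 2 - 1⌋₊ * n)⁻¹ * ∑ l ∈ Finset.Icc 1 ⌊θ⌋₊,
        (l : ℝ) ^ (((⌊(d : ℝ) / 2 - 1⌋₊ + 1 : ℕ) : ℝ) - (d : ℝ) / 2) ≤
      2 / (1 - fracExponent d) * (θ * (n : ℝ) ^ (-((d : ℝ) / 2)) * trapRate d (n / θ)) := by
  have hx := two_le_div h1 h2
  have hn0 : (0 : ℝ) < n := by exact_mod_cast hn
  have hθ : 0 < θ := by linarith
  set r := ⌊(d : ℝ) / 2 - 1⌋₊ with hr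
  have hβ0 := fracExponent_nonneg hd
  have hβ1 := sub_pos.2 (fracExponent_lt_one d)
  have e : ((r + 1 : ℕ) : ℝ) - (d : ℝ) / 2 = -fracExponent d := by
    rw [fracExponent, ← hr]; push_cast; ring
  rw [e]
  have hS := sum_rpow_neg_le hβ0 (fracExponent_lt_one d) ⌊θ⌋₊
  have hS' : ∑ l ∈ Finset.Icc 1 ⌊θ⌋₊, (l : ℝ) ^ (-fracExponent d) ≤
      θ ^ (1 - fracExponent d) / (1 - fracExponent d) := by
    rw [le_div_iff₀ hβ1, mul_comm]
    exact hS.trans (Real.rpow_le_rpow (by positivity) (Nat.floor_le hθ.le) hβ1.le)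
  have e2 : (θ ^ r * n)⁻¹ * θ ^ (1 - fracExponent d) =
      θ * (n : ℝ) ^ (-((d : ℝ) / 2)) * ((n : ℝ) / θ) ^ ((d : ℝ) / 2 - 1) := by
    rw [Real.div_rpow hn0.le hθ.le, mul_inv, ← Real.rpow_natCast, ← Real.rpow_neg hθ.le,
      div_eq_mul_inv ((n : ℝ) ^ _), ← Real.rpow_neg hθ.le]
    calc _ = (θ ^ (-(r : ℝ)) * θ ^ (1 - fracExponent d)) * (n : ℝ)⁻¹ := by ring
      _ = (θ ^ (1 : ℝ) * θ ^ (-((d : ℝ) / 2 - 1))) *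
          ((n : ℝ) ^ (-((d : ℝ) / 2)) * (n : ℝ) ^ ((d : ℝ) / 2 - 1)) := by
          rw [← Real.rpow_add hθ, ← Real.rpow_add hθ, ← Real.rpow_add hn0, ← Real.rpow_neg_one]
          congr 2
          · rw [fracExponent, ← hr]; ring
          · ring
      _ = _ := by rw [Real.rpow_one]; ring
  calc _ ≤ (θ ^ r * n)⁻¹ * (θ ^ (1 - fracExponent d) / (1 - fracExponent d)) :=
        mul_le_mul_of_nonneg_left hS' (by positivity)
    _ = (1 - fracExponent d)⁻¹ * (θ * (n : ℝ) ^ (-((d : ℝ) / 2)) *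
          ((n : ℝ) / θ) ^ ((d : ℝ) / 2 - 1)) := by rw [← e2]; ring
    _ ≤ (1 - fracExponent d)⁻¹ * (θ * (n : ℝ) ^ (-((d : ℝ) / 2)) *
          (2 * trapRate d (n / θ))) := by
        refine mul_le_mul_of_nonneg_left (mul_le_mul_of_nonneg_left (rpow_le_trapRate hx) ?_) ?_
        · positivity
        · exact (inv_pos.2 hβ1).le
    _ = _ := by ring

/-- The contribution of the paths with many visits to the cluster. -/
theorem rate_many_visits (hd : 4 ≤ d) {n : ℕ} (hn : 1 ≤ n) {θ : ℝ} (h1 : 1 ≤ θ)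
    (h2 : θ ≤ (n : ℝ) / 2) :
    (n : ℝ)⁻¹ * ∑ l ∈ Finset.Ioc ⌊θ⌋₊ (2 * n), (l : ℝ) ^ (((1 : ℕ) : ℝ) - (d : ℝ) / 2) ≤
      (3 + 2 ^ ((d : ℝ) / 2 - 2) / ((d : ℝ) / 2 - 2)) *
        (θ * (n : ℝ) ^ (-((d : ℝ) / 2)) * trapRate d (n / θ)) := by
  have hx := two_le_div h1 h2
  have hn0 : (0 : ℝ) < n := by exact_mod_cast hn
  have hθ : 0 < θ := by linarith
  have hN : 1 ≤ ⌊θ⌋₊ := Nat.one_le_floor_iff _ |>.2 h1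
  have hN0 : (0 : ℝ) < ⌊θ⌋₊ := by exact_mod_cast hN
  have hNθ : θ / 2 ≤ ⌊θ⌋₊ := by
    have h3 := Nat.lt_floor_add_one θ
    have h4 : (1 : ℝ) ≤ ⌊θ⌋₊ := by exact_mod_cast hN
    linarith
  rcases Nat.eq_or_lt_of_le hd with h | h
  · obtain rfl : d = 4 := h.symm
    have hlog := sum_inv_le_log hN (M := 2 * n) (by
      have h3 : (⌊θ⌋₊ : ℝ) ≤ n := (Nat.floor_le hθ.le).trans (by linarith)
      have h4 : ⌊θ⌋₊ ≤ n := by exact_mod_cast h3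
      omega)
    have h3 : Real.log ((2 * n : ℕ) : ℝ) - Real.log ⌊θ⌋₊ ≤ 3 * Real.log (n / θ) := by
      rw [← Real.log_div (by positivity) hN0.ne']
      have h4 : ((2 * n : ℕ) : ℝ) / ⌊θ⌋₊ ≤ (n / θ) ^ 3 := by
        calc ((2 * n : ℕ) : ℝ) / ⌊θ⌋₊ ≤ (2 * n) / (θ / 2) := by push_cast; gcongr
          _ = 4 * (n / θ) := by field_simp; ring
          _ ≤ (n / θ) ^ 3 := by
            have h5 : (4 : ℝ) ≤ (n / θ) ^ 2 := by nlinarith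
            calc 4 * ((n : ℝ) / θ) ≤ (n / θ) ^ 2 * (n / θ) :=
                  mul_le_mul_of_nonneg_right h5 (by positivity)
              _ = _ := by ring
      have := Real.log_le_log (by positivity) h4
      rwa [Real.log_pow] at this
    have e1 : ((1 : ℕ) : ℝ) - ((4 : ℕ) : ℝ) / 2 = -1 := by norm_num
    have e2 : -(((4 : ℕ) : ℝ) / 2) = ((-2 : ℤ) : ℝ) := by norm_num
    have e3 : ((4 : ℕ) : ℝ) / 2 - 2 = 0 := by norm_num
    rw [e1, e2, e3, Real.rpow_intCast]
    simp only [Real.rpow_neg_one, trapRate, if_true, div_zero, add_zero]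
    calc _ ≤ (n : ℝ)⁻¹ * (3 * Real.log (n / θ)) :=
          mul_le_mul_of_nonneg_left (hlog.trans h3) (by positivity)
      _ = _ := by
          rw [zpow_neg, show (2 : ℤ) = ((2 : ℕ) : ℤ) from rfl, zpow_natCast]
          field_simp
  · have hd' : (5 : ℝ) ≤ d := by exact_mod_cast h
    have hs : 1 < (d : ℝ) / 2 - 1 := by linarith
    have hs' : 0 < (d : ℝ) / 2 - 2 := by linarith
    have hS := sum_rpow_neg_tail_le hs hN (2 * n)
    have e1 : ((1 : ℕ) : ℝ) - (d : ℝ) / 2 = -((d : ℝ) / 2 - 1) := by push_cast; ring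
    have e2 : (d : ℝ) / 2 - 1 - 1 = (d : ℝ) / 2 - 2 := by ring
    have e3 : 1 - ((d : ℝ) / 2 - 1) = -((d : ℝ) / 2 - 2) := by ring
    rw [e2, e3] at hS
    rw [e1]
    have h3 : ∑ l ∈ Finset.Ioc ⌊θ⌋₊ (2 * n), (l : ℝ) ^ (-((d : ℝ) / 2 - 1)) ≤
        2 ^ ((d : ℝ) / 2 - 2) / ((d : ℝ) / 2 - 2) * θ ^ (-((d : ℝ) / 2 - 2)) := by
      rw [div_mul_eq_mul_div, le_div_iff₀ hs', mul_comm]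
      refine hS.trans ((Real.rpow_le_rpow_of_nonpos (by positivity) hNθ (by linarith)).trans ?_)
      rw [Real.div_rpow hθ.le (by norm_num), Real.rpow_neg (by norm_num : (0 : ℝ) ≤ 2),
        div_inv_eq_mul, mul_comm]
    have e4 : (n : ℝ)⁻¹ * θ ^ (-((d : ℝ) / 2 - 2)) =
        θ * (n : ℝ) ^ (-((d : ℝ) / 2)) * ((n : ℝ) / θ) ^ ((d : ℝ) / 2 - 1) := by
      rw [Real.div_rpow hn0.le hθ.le, div_eq_mul_inv ((n : ℝ) ^ _),
        ← Real.rpow_neg hθ.le]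
      calc _ = ((n : ℝ) ^ (-((d : ℝ) / 2)) * (n : ℝ) ^ ((d : ℝ) / 2 - 1)) *
            (θ ^ (1 : ℝ) * θ ^ (-((d : ℝ) / 2 - 1))) := by
            rw [← Real.rpow_add hθ, ← Real.rpow_add hn0, ← Real.rpow_neg_one]
            congr 2 <;> ring
        _ = _ := by rw [Real.rpow_one]; ring
    have hΨ : trapRate d (n / θ) = ((n : ℝ) / θ) ^ ((d : ℝ) / 2 - 1) := if_neg (by omega)
    rw [hΨ]
    calc _ ≤ (n : ℝ)⁻¹ * (2 ^ ((d : ℝ) / 2 - 2) / ((d : ℝ) / 2 - 2) *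
            θ ^ (-((d : ℝ) / 2 - 2))) := mul_le_mul_of_nonneg_left h3 (by positivity)
      _ = 2 ^ ((d : ℝ) / 2 - 2) / ((d : ℝ) / 2 - 2) *
            (θ * (n : ℝ) ^ (-((d : ℝ) / 2)) * ((n : ℝ) / θ) ^ ((d : ℝ) / 2 - 1)) := by
          rw [← e4]; ring
      _ ≤ _ := mul_le_mul_of_nonneg_right (by linarith) (by positivity)

end Rate


/-! ### Summation over the sequences of gaps -/

section GapSums

variable {d : ℕ}

open Classical in
/-- The total mass of the excursion sequences with `l` excursions, of total duration between `n`
and `2 n`, that violate the trapping condition. -/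
def badMass (ω : Env d) (α : ℝ) (r : ℕ) (θ : ℝ) (n l : ℕ) : ℝ≥0∞ :=
  ∑' u : Fin l → ℕ, if (n ≤ ∑ i, (u i + 1) ∧ ∑ i, (u i + 1) ≤ 2 * n) ∧ BadGaps r θ u then
    gapsOp (transProb ω) (cluster ω α) (List.ofFn u) (Pi.single 0 1) 0 else 0

theorem mem_Icc_ceil {n m : ℕ} {θ : ℝ} (h2 : θ ≤ (n : ℝ) / 2)
    (hm : m ∈ Finset.Icc ⌈(n : ℝ) - θ⌉₊ n) : (n : ℝ) - θ ≤ m ∧ m ≤ n ∧ n ≤ 2 * m := by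
  rw [Finset.mem_Icc, Nat.ceil_le] at hm
  refine ⟨hm.1, hm.2, ?_⟩
  have : (n : ℝ) ≤ 2 * m := by linarith [hm.1]
  exact_mod_cast this

/-- Each sequence of gaps belongs to at most one final time, so that the sum over the final times in
`[n - θ, n]` is bounded by a single sum over the sequences of total duration between `n` and `2 n`. -/
theorem sum_walkLaw_diff_le [NeZero d] {ω : Env d} {α : ℝ} (h0 : (0 : Vertex d) ∈ cluster ω α)
    (r : ℕ) {n : ℕ} (hn : 1 ≤ n) {θ : ℝ} (h2 : θ ≤ (n : ℝ) / 2) :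
    ∑ m ∈ Finset.Icc ⌈(n : ℝ) - θ⌉₊ n,
        walkLaw ω 0 ({X | X (2 * m) = 0} \ trapEvent ω α r θ m) ≤
      ∑' l, badMass ω α r θ n l := by
  classical
  calc _ ≤ ∑ m ∈ Finset.Icc ⌈(n : ℝ) - θ⌉₊ n, ∑' (l : ℕ) (u : Fin l → ℕ),
        if ∑ i, (u i + 1) = 2 * m ∧ BadGaps r θ u then
          gapsOp (transProb ω) (cluster ω α) (List.ofFn u) (Pi.single 0 1) 0 else 0 := by
        refine Finset.sum_le_sum fun m hm => ?_
        have hm' := mem_Icc_ceil h2 hm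
        exact walkLaw_diff_trapEvent_le (by omega) h0
    _ = ∑' (l : ℕ) (u : Fin l → ℕ), ∑ m ∈ Finset.Icc ⌈(n : ℝ) - θ⌉₊ n,
        if ∑ i, (u i + 1) = 2 * m ∧ BadGaps r θ u then
          gapsOp (transProb ω) (cluster ω α) (List.ofFn u) (Pi.single 0 1) 0 else 0 := by
        rw [← Summable.tsum_finsetSum fun _ _ => ENNReal.summable]
        exact tsum_congr fun l => (Summable.tsum_finsetSum fun _ _ => ENNReal.summable).symm
    _ ≤ _ := by
        refine ENNReal.tsum_le_tsum fun l => ENNReal.tsum_le_tsum fun u => ?_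
        by_cases h : ∃ m ∈ Finset.Icc ⌈(n : ℝ) - θ⌉₊ n, ∑ i, (u i + 1) = 2 * m ∧ BadGaps r θ u
        · obtain ⟨m, hm, hs, hb⟩ := h
          have hm' := mem_Icc_ceil h2 hm
          rw [Finset.sum_eq_single m, if_pos ⟨hs, hb⟩, if_pos ⟨⟨by omega, by omega⟩, hb⟩]
          · intro m' _ hne
            exact if_neg fun h => hne (by omega)
          · exact fun h => absurd hm h
        · push Not at h
          rw [Finset.sum_eq_zero fun m hm => if_neg fun hc => h m hm hc.1 hc.2]
          exact zero_le

/-- Markov's inequality for a weight `y` on the sequences of gaps. -/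
theorem badMass_le_of_le (ω : Env d) (α : ℝ) {r : ℕ} {θ : ℝ} {n l : ℕ} {c : ℝ≥0∞} (hc : c ≠ 0)
    (hc' : c ≠ ∞) (y : (Fin l → ℕ) → ℝ≥0∞)
    (h : ∀ u : Fin l → ℕ, n ≤ ∑ i, (u i + 1) → BadGaps r θ u → c ≤ y u) :
    badMass ω α r θ n l ≤ c⁻¹ * ∑' u : Fin l → ℕ, y u *
      gapsOp (transProb ω) (cluster ω α) (List.ofFn u) (Pi.single 0 1) 0 := by
  rw [badMass, ← ENNReal.tsum_mul_left]
  refine ENNReal.tsum_le_tsum fun u => ?_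
  split_ifs with hu
  · rw [← mul_assoc]
    refine le_mul_of_one_le_left zero_le ?_
    rw [← ENNReal.inv_mul_cancel hc hc']
    exact mul_le_mul_right (h u hu.1.1 hu.2) _
  · exact zero_le

theorem sum_succ_lt_prod {l : ℕ} (u : Fin l → ℕ) : ∑ i, (u i + 1) < ∏ i, (u i + 2) := by
  induction l with
  | zero => simp
  | succ l ih =>
    rw [Fin.sum_univ_succ, Fin.prod_univ_succ]
    refine lt_of_lt_of_le ?_ (Nat.mul_le_mul_left (u 0 + 2)
      (Nat.succ_le_of_lt (ih fun i => u i.succ)))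
    generalize ∑ i, (u (Fin.succ i) + 1) = s
    rw [Nat.succ_eq_add_one]
    nlinarith [Nat.zero_le (u 0 * s)]

/-- Sequences with fewer than `r` excursions are controlled by a high moment. -/
theorem badMass_le_few (ω : Env d) (α : ℝ) (r : ℕ) (θ : ℝ) {n : ℕ} (hn : 1 ≤ n) (l q : ℕ) :
    badMass ω α r θ n l ≤ ((n : ℝ≥0∞) ^ q)⁻¹ *
      (kernelOp (moment (transProb ω) (cluster ω α) fun n => ((n : ℝ≥0∞) + 2) ^ q) ^ l) 1 0 := by
  have hn0 : (n : ℝ≥0∞) ≠ 0 := by exact_mod_cast (by omega : n ≠ 0)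
  have h := badMass_le_of_le ω α (r := r) (θ := θ) (n := n) (l := l) (pow_ne_zero q hn0)
    (ENNReal.pow_ne_top (by simp)) (fun u => ∏ i, ((u i : ℝ≥0∞) + 2) ^ q) (fun u hu _ => by
      rw [Finset.prod_pow]
      refine pow_le_pow_left' ?_ q
      exact_mod_cast hu.trans (sum_succ_lt_prod u).le)
  refine h.trans (mul_le_mul_right ?_ _)
  rw [tsum_gapsOp_prod (transProb ω) (cluster ω α) fun n => ((n : ℝ≥0∞) + 2) ^ q]
  refine opMono _ ?_ 0
  intro y
  by_cases hy : y = 0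
  · subst hy; simp
  · simp [hy]

/-- Sequences with a moderate number of excursions of which more than `r` are long. -/
theorem badMass_le_moderate (ω : Env d) (α : ℝ) {r : ℕ} {θ : ℝ} (hθ : 1 ≤ θ) {n : ℕ} (hn : 1 ≤ n)
    {l : ℕ} (hr : r ≤ l) (hl : (l : ℝ) ≤ θ) :
    badMass ω α r θ n l ≤ (ENNReal.ofReal (θ ^ r * n))⁻¹ * ((r + 1).factorial *
      words (kernelOp (coarseKernel ω α)) (kernelOp (durationKernel ω α)) l (r + 1)
        (Pi.single 0 1) 0) := by
  have hn0 : (0 : ℝ) < n := by exact_mod_cast hn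
  have hc : 0 < θ ^ r * n := by positivity
  have h := badMass_le_of_le ω α (r := r) (θ := θ) (n := n) (l := l) (ENNReal.ofReal_pos.2 hc).ne'
    ENNReal.ofReal_ne_top
    (fun u => (r + 1).factorial * (tupleEsymm (r + 1) (fun i => u i + 1) : ℝ≥0∞))
    (fun u hu hb => by
      have hb' : (fun i => u i + 1) ∉ trapTuples l r θ := by
        rcases hb with h | h | h
        · omega
        · linarith
        · exact h
      have h3 := pow_mul_sum_le_tupleEsymm (by linarith) hr _ hb'
      have h4 : θ ^ r * n ≤ (((r + 1).factorial * tupleEsymm (r + 1) fun i => u i + 1 : ℕ) : ℝ) := by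
        push_cast at h3 ⊢
        refine le_trans (mul_le_mul_of_nonneg_left ?_ (by positivity)) h3
        exact_mod_cast hu
      calc _ ≤ ENNReal.ofReal _ := ENNReal.ofReal_le_ofReal h4
        _ = _ := by rw [ENNReal.ofReal_natCast]; push_cast; rfl)
  simp only [mul_assoc] at h
  rw [ENNReal.tsum_mul_left, tsum_gapsOp_esymm] at h
  exact h

/-- Sequences with an arbitrary number of excursions, by Markov's inequality for the duration. -/
theorem badMass_le_many (ω : Env d) (α : ℝ) (r : ℕ) (θ : ℝ) {n : ℕ} (hn : 1 ≤ n) (l : ℕ) :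
    badMass ω α r θ n l ≤ (n : ℝ≥0∞)⁻¹ *
      words (kernelOp (coarseKernel ω α)) (kernelOp (durationKernel ω α)) l 1
        (Pi.single 0 1) 0 := by
  have hn0 : (n : ℝ≥0∞) ≠ 0 := by exact_mod_cast (by omega : n ≠ 0)
  have h := badMass_le_of_le ω α (r := r) (θ := θ) (n := n) (l := l) hn0 (by simp)
    (fun u => (tupleEsymm 1 (fun i => u i + 1) : ℝ≥0∞)) (fun u hu _ => by
      rw [tupleEsymm_one]; exact_mod_cast hu)
  rw [tsum_gapsOp_esymm] at h
  exact h

theorem badMass_eq_zero (ω : Env d) (α : ℝ) (r : ℕ) (θ : ℝ) {n l : ℕ} (hl : 2 * n < l) :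
    badMass ω α r θ n l = 0 := by
  refine ENNReal.tsum_eq_zero.2 fun u => if_neg fun h => ?_
  have h1 : ∑ i, (u i + 1) = ∑ i, u i + l := by simp [Finset.sum_add_distrib]
  omega

theorem pow_mul_inv_rpow {l : ℕ} (hl : 1 ≤ l) (j : ℕ) (p : ℝ) :
    (l : ℝ≥0∞) ^ j * ((l : ℝ≥0∞) ^ p)⁻¹ = ENNReal.ofReal ((l : ℝ) ^ ((j : ℝ) - p)) := by
  have hl0 : (0 : ℝ) < l := by exact_mod_cast hl
  rw [← ENNReal.ofReal_rpow_of_pos hl0, ENNReal.ofReal_natCast, ENNReal.rpow_sub _ _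
    (by exact_mod_cast hl0.ne') (by simp), ENNReal.rpow_natCast, div_eq_mul_inv]

variable [NeZero d]

/-- The random constant that controls the sequences with fewer than `r` excursions. -/
def fewConst (α : ℝ) (r : ℕ) (ω : Env d) : ℝ≥0∞ :=
  ∑ l ∈ Finset.range r, (kernelOp (moment (transProb ω) (cluster ω α)
    fun n => ((n : ℝ≥0∞) + 2) ^ d) ^ l) 1 0

/-- The violating sequences, split according to whether the number of excursions is less than `r`,
between `r` and `θ`, or more than `θ`. -/
theorem tsum_badMass_le {ω : Env d} {α : ℝ} (hα : 0 < α) {r : ℕ} (hr : 1 ≤ r) {θ : ℝ}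
    (hθ : 1 ≤ θ) {n : ℕ} (hn : 1 ≤ n) :
    ∑' l, badMass ω α r θ n l ≤
      fewConst α r ω * ENNReal.ofReal ((n : ℝ) ^ d)⁻¹ +
      (r + 1).factorial * wordConst α (r + 1) ω * ENNReal.ofReal ((θ ^ r * n)⁻¹ *
        ∑ l ∈ Finset.Icc 1 ⌊θ⌋₊, (l : ℝ) ^ (((r + 1 : ℕ) : ℝ) - (d : ℝ) / 2)) +
      wordConst α 1 ω * ENNReal.ofReal ((n : ℝ)⁻¹ *
        ∑ l ∈ Finset.Ioc ⌊θ⌋₊ (2 * n), (l : ℝ) ^ (((1 : ℕ) : ℝ) - (d : ℝ) / 2)) := by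
  have hn0 : (0 : ℝ) < n := by exact_mod_cast hn
  have hc : 0 < θ ^ r * n := by positivity
  have hf1 : ∑ l ∈ Finset.range r, badMass ω α r θ n l ≤
      fewConst α r ω * ENNReal.ofReal ((n : ℝ) ^ d)⁻¹ := by
    refine (Finset.sum_le_sum fun l _ => badMass_le_few ω α r θ hn l d).trans (le_of_eq ?_)
    rw [← Finset.mul_sum, mul_comm, fewConst, ENNReal.ofReal_inv_of_pos (by positivity),
      ENNReal.ofReal_pow hn0.le, ENNReal.ofReal_natCast]
  have hf2 : ∑ l ∈ Finset.Icc r ⌊θ⌋₊, badMass ω α r θ n l ≤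
      (r + 1).factorial * wordConst α (r + 1) ω * ENNReal.ofReal ((θ ^ r * n)⁻¹ *
        ∑ l ∈ Finset.Icc 1 ⌊θ⌋₊, (l : ℝ) ^ (((r + 1 : ℕ) : ℝ) - (d : ℝ) / 2)) := by
    calc _ ≤ ∑ l ∈ Finset.Icc r ⌊θ⌋₊, (r + 1).factorial * wordConst α (r + 1) ω *
          (ENNReal.ofReal (θ ^ r * n)⁻¹ *
            ENNReal.ofReal ((l : ℝ) ^ (((r + 1 : ℕ) : ℝ) - (d : ℝ) / 2))) := by
          refine Finset.sum_le_sum fun l hl => ?_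
          rw [Finset.mem_Icc] at hl
          have hlθ : (l : ℝ) ≤ θ := (Nat.cast_le.2 hl.2).trans (Nat.floor_le (by linarith))
          refine (badMass_le_moderate ω α hθ hn hl.1 hlθ).trans ?_
          refine (mul_le_mul_right (mul_le_mul_right
            (words_return_le hα (by omega) (r + 1)) _) _).trans (le_of_eq ?_)
          rw [pow_mul_inv_rpow (by omega), ENNReal.ofReal_inv_of_pos hc]
          ring
      _ = (r + 1).factorial * wordConst α (r + 1) ω * ENNReal.ofReal ((θ ^ r * n)⁻¹ *
            ∑ l ∈ Finset.Icc r ⌊θ⌋₊, (l : ℝ) ^ (((r + 1 : ℕ) : ℝ) - (d : ℝ) / 2)) := by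
          rw [← Finset.mul_sum, ← Finset.mul_sum, ENNReal.ofReal_mul (by positivity),
            ENNReal.ofReal_sum_of_nonneg fun _ _ => by positivity]
      _ ≤ _ := by
          refine mul_le_mul_right (ENNReal.ofReal_le_ofReal
            (mul_le_mul_of_nonneg_left ?_ (by positivity))) _
          exact Finset.sum_le_sum_of_subset_of_nonneg (Finset.Icc_subset_Icc hr le_rfl)
            fun _ _ _ => by positivity
  have hf3 : ∑ l ∈ Finset.Ioc ⌊θ⌋₊ (2 * n), badMass ω α r θ n l ≤
      wordConst α 1 ω * ENNReal.ofReal ((n : ℝ)⁻¹ *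
        ∑ l ∈ Finset.Ioc ⌊θ⌋₊ (2 * n), (l : ℝ) ^ (((1 : ℕ) : ℝ) - (d : ℝ) / 2)) := by
    calc _ ≤ ∑ l ∈ Finset.Ioc ⌊θ⌋₊ (2 * n), wordConst α 1 ω * (ENNReal.ofReal (n : ℝ)⁻¹ *
            ENNReal.ofReal ((l : ℝ) ^ (((1 : ℕ) : ℝ) - (d : ℝ) / 2))) := by
          refine Finset.sum_le_sum fun l hl => ?_
          rw [Finset.mem_Ioc] at hl
          refine (badMass_le_many ω α r θ hn l).trans ?_
          refine (mul_le_mul_right (words_return_le hα (by omega) 1) _).trans (le_of_eq ?_)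
          rw [pow_mul_inv_rpow (by omega), ENNReal.ofReal_inv_of_pos hn0, ENNReal.ofReal_natCast]
          ring
      _ = _ := by
          rw [← Finset.mul_sum, ← Finset.mul_sum, ENNReal.ofReal_mul (by positivity),
            ENNReal.ofReal_sum_of_nonneg fun _ _ => by positivity]
  refine le_trans ?_ (add_le_add (add_le_add hf1 hf2) hf3)
  have hcover : ∀ l ∉ Finset.range r ∪ Finset.Icc r ⌊θ⌋₊ ∪ Finset.Ioc ⌊θ⌋₊ (2 * n),
      badMass ω α r θ n l = 0 := by
    intro l hl
    refine badMass_eq_zero ω α r θ ?_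
    simp only [Finset.mem_union, Finset.mem_range, Finset.mem_Icc, Finset.mem_Ioc] at hl
    omega
  rw [tsum_eq_sum hcover]
  have hunion : ∀ s t : Finset ℕ, ∑ l ∈ s ∪ t, badMass ω α r θ n l ≤
      ∑ l ∈ s, badMass ω α r θ n l + ∑ l ∈ t, badMass ω α r θ n l := fun s t =>
    le_self_add.trans Finset.sum_union_inter.le
  exact (hunion _ _).trans (add_le_add_left (hunion _ _) _)

end GapSums


/-! ### The trapping estimate -/

section Trapping

variable {d : ℕ} [NeZero d]

/-- The random constant of the trapping estimate, with values in `[0, ∞]`. -/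
def trapConst (α : ℝ) (ω : Env d) : ℝ≥0∞ :=
  fewConst α ⌊(d : ℝ) / 2 - 1⌋₊ ω * ENNReal.ofReal 2 +
  (⌊(d : ℝ) / 2 - 1⌋₊ + 1).factorial * wordConst α (⌊(d : ℝ) / 2 - 1⌋₊ + 1) ω *
    ENNReal.ofReal (2 / (1 - fracExponent d)) +
  wordConst α 1 ω * ENNReal.ofReal (3 + 2 ^ ((d : ℝ) / 2 - 2) / ((d : ℝ) / 2 - 2))

omit [NeZero d] in
theorem isCov_kernelOp_pow_one {k : Env d → Vertex d → Vertex d → ℝ≥0∞} (hk : IsCovKernel k)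
    (l : ℕ) : IsCov fun ω => (kernelOp (k ω) ^ l) 1 := by
  induction l with
  | zero => exact IsCov.const 1
  | succ l ih =>
    have := hk.op ih
    simpa only [pow_succ', opMul_apply] using this

omit [NeZero d] in
theorem measurable_trapConst (α : ℝ) : Measurable (trapConst (d := d) α) := by
  have h1 : Measurable (fewConst (d := d) α ⌊(d : ℝ) / 2 - 1⌋₊) :=
    Finset.measurable_sum _ fun l _ =>
      (isCov_kernelOp_pow_one (isCovKernel_moment α fun n => ((n : ℝ≥0∞) + 2) ^ d) l).meas 0
  exact ((h1.mul_const _).add (((measurable_wordConst α _).const_mul _).mul_const _)).add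
    ((measurable_wordConst α _).mul_const _)

theorem ae_trapConst_lt_top {P : Measure (Env d)} [IsProbabilityMeasure P] (herg : ShiftErgodic P)
    {α₀ α : ℝ} (hd : DiffusiveBound P α₀) (hα : α ∈ Set.Ioo 0 α₀) :
    ∀ᵐ ω ∂(condLaw P α), trapConst α ω < ∞ := by
  have hfew : ∀ᵐ ω ∂(condLaw P α), fewConst α ⌊(d : ℝ) / 2 - 1⌋₊ ω < ∞ := by
    refine ae_condLaw_of_ae ?_
    filter_upwards [ae_finite_weakNeighborhood herg hα.1 (hα.2.trans_le hd.1.2)] with ω hω h0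
    exact ENNReal.sum_lt_top.2 fun l _ => kernelOp_moment_pow_lt_top hα.1 hω d l 0 h0
  filter_upwards [hfew, ae_wordConst_lt_top herg hd hα 1,
    ae_wordConst_lt_top herg hd hα (⌊(d : ℝ) / 2 - 1⌋₊ + 1)] with ω h1 h2 h3
  refine ENNReal.add_lt_top.2 ⟨ENNReal.add_lt_top.2 ⟨?_, ?_⟩, ?_⟩
  · exact ENNReal.mul_lt_top h1 ENNReal.ofReal_lt_top
  · exact ENNReal.mul_lt_top (ENNReal.mul_lt_top (by simp) h3) ENNReal.ofReal_lt_top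
  · exact ENNReal.mul_lt_top h2 ENNReal.ofReal_lt_top

theorem sum_walkLaw_diff_le_trapConst (hd : 4 ≤ d) {ω : Env d} {α : ℝ} (hα : 0 < α)
    (h0 : (0 : Vertex d) ∈ cluster ω α) {n : ℕ} (hn : 1 ≤ n) {θ : ℝ} (h1 : 1 ≤ θ)
    (h2 : θ ≤ (n : ℝ) / 2) :
    ∑ m ∈ Finset.Icc ⌈(n : ℝ) - θ⌉₊ n, walkLaw ω 0 ({X | X (2 * m) = 0} \
        trapEvent ω α ⌊(d : ℝ) / 2 - 1⌋₊ θ m) ≤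
      trapConst α ω *
        ENNReal.ofReal (θ * (n : ℝ) ^ (-((d : ℝ) / 2)) * trapRate d (n / θ)) := by
  have hd' : (4 : ℝ) ≤ d := by exact_mod_cast hd
  have hr : 1 ≤ ⌊(d : ℝ) / 2 - 1⌋₊ := Nat.one_le_floor_iff _ |>.2 (by linarith)
  have hβ := sub_pos.2 (fracExponent_lt_one d)
  have hc : 0 ≤ 3 + 2 ^ ((d : ℝ) / 2 - 2) / ((d : ℝ) / 2 - 2) := by
    have : 0 ≤ (d : ℝ) / 2 - 2 := by linarith
    positivity
  refine (sum_walkLaw_diff_le h0 _ hn h2).trans ((tsum_badMass_le hα hr h1 hn).trans ?_)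
  rw [trapConst, add_mul, add_mul]
  simp only [mul_assoc]
  rw [← ENNReal.ofReal_mul hc, ← ENNReal.ofReal_mul (div_nonneg zero_le_two hβ.le),
    ← ENNReal.ofReal_mul (by norm_num)]
  refine add_le_add (add_le_add ?_ ?_) ?_
  · exact mul_le_mul_right (ENNReal.ofReal_le_ofReal (by
      simpa only [mul_assoc] using rate_few_visits hd hn h1 h2)) _
  · exact mul_le_mul_right (mul_le_mul_right (ENNReal.ofReal_le_ofReal (by
      simpa only [mul_assoc] using rate_many_excursions hd hn h1 h2)) _) _
  · exact mul_le_mul_right (ENNReal.ofReal_le_ofReal (by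
      simpa only [mul_assoc] using rate_many_visits hd hn h1 h2)) _

/-- Some final time in `[n - θ, n]` has at most the average probability; there are at least `θ` of
them. -/
theorem exists_walkLaw_diff_le (hd : 4 ≤ d) {ω : Env d} {α : ℝ} (hα : 0 < α)
    (h0 : (0 : Vertex d) ∈ cluster ω α) {n : ℕ} (hn : 1 ≤ n) {θ : ℝ} (h1 : 1 ≤ θ)
    (h2 : θ ≤ (n : ℝ) / 2) :
    ∃ m : ℕ, (n : ℝ) - θ ≤ m ∧ m ≤ n ∧
      walkLaw ω 0 ({X | X (2 * m) = 0} \ trapEvent ω α ⌊(d : ℝ) / 2 - 1⌋₊ θ m) ≤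
        trapConst α ω * ENNReal.ofReal ((n : ℝ) ^ (-((d : ℝ) / 2)) * trapRate d (n / θ)) := by
  set S := Finset.Icc ⌈(n : ℝ) - θ⌉₊ n with hS
  have hθ : 0 < θ := by linarith
  have hcard : θ ≤ (S.card : ℝ) := by
    have h3 : ⌈(n : ℝ) - θ⌉₊ ≤ n := Nat.ceil_le.2 (by linarith)
    have h4 := Nat.ceil_lt_add_one (by linarith : 0 ≤ (n : ℝ) - θ)
    rw [hS, Nat.card_Icc, Nat.cast_sub (by omega)]
    push_cast
    linarith
  have hne : S.Nonempty := Finset.card_pos.1 (by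
    have : (0 : ℝ) < S.card := hθ.trans_le hcard
    exact_mod_cast this)
  set f : ℕ → ℝ≥0∞ := fun m =>
    walkLaw ω 0 ({X | X (2 * m) = 0} \ trapEvent ω α ⌊(d : ℝ) / 2 - 1⌋₊ θ m) with hf
  obtain ⟨m, hm, hmin⟩ := Finset.exists_min_image S f hne
  have hm' := mem_Icc_ceil h2 hm
  refine ⟨m, hm'.1, hm'.2.1, ?_⟩
  have h3 : ENNReal.ofReal θ * f m ≤ ENNReal.ofReal θ * (trapConst α ω *
      ENNReal.ofReal ((n : ℝ) ^ (-((d : ℝ) / 2)) * trapRate d (n / θ))) := by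
    calc ENNReal.ofReal θ * f m ≤ (S.card : ℝ≥0∞) * f m := by
          refine mul_le_mul_left ?_ _
          rw [← ENNReal.ofReal_natCast]
          exact ENNReal.ofReal_le_ofReal hcard
      _ ≤ ∑ m ∈ S, f m := by
          rw [← nsmul_eq_mul]; exact Finset.card_nsmul_le_sum S f _ hmin
      _ ≤ _ := sum_walkLaw_diff_le_trapConst hd hα h0 hn h1 h2
      _ = _ := by rw [mul_assoc, ENNReal.ofReal_mul hθ.le]; ring
  exact (ENNReal.mul_le_mul_iff_right (ENNReal.ofReal_pos.2 hθ).ne' ENNReal.ofReal_ne_top).1 h3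

theorem one_sub_le_cond_real {Ω : Type*} [MeasurableSpace Ω] {μ : Measure Ω}
    [IsFiniteMeasure μ] {A E : Set Ω} (hA : MeasurableSet A) (hpos : 0 < μ.real A) :
    1 - μ.real (A \ E) / μ.real A ≤ (μ[|A]).real E := by
  have h1 : μ.real A ≤ μ.real (A ∩ E) + μ.real (A \ E) := by
    have := measureReal_union_le (μ := μ) (A ∩ E) (A \ E)
    rwa [Set.inter_union_sdiff] at this
  rw [measureReal_def (μ[|A]), cond_apply hA, ENNReal.toReal_mul, ENNReal.toReal_inv,
    ← measureReal_def, ← measureReal_def, ← div_eq_inv_mul, sub_le_iff_le_add, ← add_div,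
    le_div_iff₀ hpos, one_mul]
  exact h1

end Trapping

end RandomConductance

end

theorem theorem2p6 (d : ℕ) [NeZero d] (hd : 4 ≤ d)
    (P : Measure (Env d)) [IsProbabilityMeasure P]
    (hergodic : ShiftErgodic P)
    (hexhaust : ClustersExhaust P)
    (hcomponents : SmallWeakComponents P)
    (α₀ : ℝ) (hdiffusive : DiffusiveBound P α₀)
    (α : ℝ) (hα : α ∈ Set.Ioo 0 α₀) :
    ∃ C : Env d → ℝ, Measurable C ∧
      ∀ᵐ ω ∂(condLaw P α), ∀ n : ℕ, 1 ≤ n → ∀ θ : ℝ, 1 ≤ θ → θ ≤ (n : ℝ) / 2 →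
        ∃ m : ℕ, (n : ℝ) - θ ≤ m ∧ m ≤ n ∧
          1 - C ω / lam ω n *
              (if d = 4 then (n : ℝ) / θ * Real.log ((n : ℝ) / θ)
                else ((n : ℝ) / θ) ^ ((d : ℝ) / 2 - 1))
            ≤ ((walkLaw ω 0)[|{X | X (2 * m) = 0}]).real
                (trapEvent ω α ⌊(d : ℝ) / 2 - 1⌋₊ θ m) := by
  have hα0 : 0 < α := hα.1
  refine ⟨fun ω => (trapConst α ω).toReal, (measurable_trapConst α).ennreal_toReal, ?_⟩
  have h0 : ∀ᵐ ω ∂(condLaw P α), (0 : Vertex d) ∈ cluster ω α :=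
    ae_condLaw_of_ae (Filter.Eventually.of_forall fun ω h => h)
  filter_upwards [ae_trapConst_lt_top hergodic hdiffusive hα, h0] with ω hC h0 n hn θ h1 h2
  obtain ⟨m, hm1, hm2, hm⟩ := exists_walkLaw_diff_le hd hα0 h0 hn h1 h2
  refine ⟨m, hm1, hm2, ?_⟩
  change 1 - (trapConst α ω).toReal / lam ω n * trapRate d (n / θ) ≤ _
  have hn0 : (0 : ℝ) < n := by exact_mod_cast hn
  have hrate : 0 ≤ trapRate d (n / θ) := trapRate_nonneg (two_le_div h1 h2)
  have hret : ∀ k, (walkLaw ω 0).real {X | X (2 * k) = 0} =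
      (kernelPow (transProb ω) (2 * k) 0 0).toReal := fun k => by
    rw [measureReal_def, walkLaw_eq_kernelPow]
  have hpos : ∀ k, 0 < (kernelPow (transProb ω) (2 * k) 0 0).toReal := fun k =>
    ENNReal.toReal_pos (kernelPow_two_mul_pos ω k).ne' (kernelPow_transProb_ne_top ω _ _ _)
  have hmono : (kernelPow (transProb ω) (2 * n) 0 0).toReal ≤
      (kernelPow (transProb ω) (2 * m) 0 0).toReal :=
    ENNReal.toReal_mono (kernelPow_transProb_ne_top ω _ _ _) (kernelPow_two_mul_antitone ω hm2)
  refine le_trans ?_ (one_sub_le_cond_real (measurableSet_coord (2 * m) {0})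
    (by simpa only [Set.mem_singleton_iff] using (hret m).symm ▸ hpos m))
  refine sub_le_sub_left ?_ 1
  have hnum : (walkLaw ω 0).real ({X | X (2 * m) = 0} \
      trapEvent ω α ⌊(d : ℝ) / 2 - 1⌋₊ θ m) ≤
      (trapConst α ω).toReal * ((n : ℝ) ^ (-((d : ℝ) / 2)) * trapRate d (n / θ)) := by
    have h3 := ENNReal.toReal_mono (ENNReal.mul_ne_top hC.ne ENNReal.ofReal_ne_top) hm
    rwa [ENNReal.toReal_mul, ENNReal.toReal_ofReal (mul_nonneg (by positivity) hrate)] at h3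
  have hlam : (trapConst α ω).toReal / lam ω n * trapRate d (n / θ) =
      (trapConst α ω).toReal * ((n : ℝ) ^ (-((d : ℝ) / 2)) * trapRate d (n / θ)) /
        (kernelPow (transProb ω) (2 * n) 0 0).toReal := by
    rw [lam, Real.rpow_neg hn0.le]
    have := (Real.rpow_pos_of_pos hn0 ((d : ℝ) / 2)).ne'
    have := (hpos n).ne'
    field_simp
  rw [hlam]
  simp only [hret]
  exact div_le_div₀ (mul_nonneg ENNReal.toReal_nonneg (mul_nonneg (by positivity) hrate)) hnum
    (hpos n) hmono
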